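/- **Theorem 2.8 (generalised Kobayashi vanishing theorem).** Let $X$ be a compact complex manifold of dimension $n$, let $m\in\{1,\dots,n\}$, let $\omega$ be a Kähler metric on $X$, and let $\Omega$ be a real $C^\infty$ form of bidegree $(n-m,n-m)$ on $X$ such that $\partial\bar\partial\Omega=0$ and $\Omega>0$ weakly, i.e. at every $x\in X$ the $(n,n)$-form $\Omega\wedge i\alpha_1\wedge\bar\alpha_1\wedge\dots\wedge i\alpha_m\wedge\bar\alpha_m$ is positive for all linearly independent $(1,0)$-covectors $\alpha_1,\dots,\alpha_m$ at $x$. Let $E$ be a holomorphic vector bundle of finite rank on $X$, let $h$ be a $C^\infty$ Hermitian fibre metric on $E$, let $D_h$ be the Chern connection of $(E,h)$ and $\Theta_h(E)$ its curvature form. Suppose that $h$ is $(\omega,\Omega)$-Hermite–Einstein with Einstein factor $\lambda_h\in\mathbb{R}$ (a constant), that is $$i\Theta_h(E)\wedge\omega^{m-1}\wedge\Omega=\lambda_h\,dV_\omega\otimes\mathrm{Id}_E,\qquad dV_\omega=\frac{\omega^n}{n!}.$$ (i) If $\lambda_h<0$, then $H^0(X,E)=\{0\}$, i.e. $E$ has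 no non-zero global holomorphic section. (ii) If $\lambda_h=0$, then $D_hs=0$ on $X$ for every $s\in H^0(X,E)$. -/

import Mathlib

open scoped Manifold ContDiff TensorProduct Bundle Matrix
open Bundle

noncomputable section

namespace HermiteEinstein

/-! ### Real multilinear algebra on a complex vector space

A complex vector space `M` is regarded as a real vector space with complex structure `v ↦ i v`;
`M [⋀^Fin k]→ₗ[ℝ] W` are the `k`-forms on the underlying real space with values in a complex
vector space `W`. -/

section Algebra

variable {M : Type*} [AddCommGroup M] [Module ℂ M]
variable {W : Type*} [AddCommGroup W] [Module ℂ W]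

/-- The pairing `W ⊗ ℂ → W`, `w ⊗ z ↦ z w`. -/
def scalarPairing (W : Type*) [AddCommGroup W] [Module ℂ W] : W ⊗[ℝ] ℂ →ₗ[ℝ] W :=
  TensorProduct.lift (LinearMap.mk₂ ℝ (fun (w : W) (z : ℂ) => z • w)
    (fun w w' z => smul_add z w w') (fun c w z => smul_comm z c w)
    (fun w z z' => add_smul z z' w) (fun c w z => smul_assoc c z w))

/-- Wedge product of a `W`-valued `k`-form with a complex-valued `l`-form (sum over shuffles, so
`(α ∧ β) (u, v) = α u * β v - α v * β u` for complex-valued one-forms). -/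
def wedge {k l : ℕ} (α : M [⋀^Fin k]→ₗ[ℝ] W) (β : M [⋀^Fin l]→ₗ[ℝ] ℂ) :
    M [⋀^Fin (k + l)]→ₗ[ℝ] W :=
  ((scalarPairing W).compAlternatingMap (α.domCoprod β)).domDomCongr finSumFinEquiv

/-- The product `β ⊗ w` of a complex-valued form `β` and a vector `w`. -/
def formTensor {k : ℕ} (β : M [⋀^Fin k]→ₗ[ℝ] ℂ) (w : W) : M [⋀^Fin k]→ₗ[ℝ] W :=
  ((LinearMap.toSpanSingleton ℂ W w).restrictScalars ℝ).compAlternatingMap β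

/-- Transport of a form along an equality of degrees. -/
def formCast {k l : ℕ} (e : k = l) (α : M [⋀^Fin k]→ₗ[ℝ] W) : M [⋀^Fin l]→ₗ[ℝ] W :=
  α.domDomCongr (finCongr e)

/-- The wedge product `β 0 ∧ β 1 ∧ ⋯ ∧ β (j - 1)` of `j` two-forms. -/
def wedgeProd : (j : ℕ) → (Fin j → M [⋀^Fin 2]→ₗ[ℝ] ℂ) → M [⋀^Fin (2 * j)]→ₗ[ℝ] ℂ
  | 0, _ => (AlternatingMap.constOfIsEmpty ℝ M (Fin 0) (1 : ℂ) : M [⋀^Fin 0]→ₗ[ℝ] ℂ)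
  | j + 1, β => wedge (wedgeProd j (fun i => β i.castSucc)) (β (Fin.last j))

/-- The wedge power `κ ^ j` of a two-form. -/
def wedgePow (κ : M [⋀^Fin 2]→ₗ[ℝ] ℂ) (j : ℕ) : M [⋀^Fin (2 * j)]→ₗ[ℝ] ℂ :=
  wedgeProd j (fun _ => κ)

/-- A real-linear complex-valued functional as a one-form. -/
def oneForm (α : M →ₗ[ℝ] ℂ) : M [⋀^Fin 1]→ₗ[ℝ] ℂ :=
  AlternatingMap.ofSubsingleton ℝ M ℂ (0 : Fin 1) α

/-- The real `(1,1)`-form `i α ∧ ᾱ` of a `(1,0)`-form `α`, i.e. of a complex-linear functional. -/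
def elementary (α : M →ₗ[ℂ] ℂ) : M [⋀^Fin 2]→ₗ[ℝ] ℂ :=
  Complex.I • wedge (oneForm (α.restrictScalars ℝ))
    (oneForm (Complex.conjAe.toLinearMap ∘ₗ α.restrictScalars ℝ))

/-- The family `(v₀, i v₀, v₁, i v₁, …, vₙ₋₁, i vₙ₋₁)`. -/
def realFrame {n : ℕ} (v : Fin n → M) : Fin (2 * n) → M :=
  fun j => Complex.I ^ ((j : ℕ) % 2) • v ⟨(j : ℕ) / 2, by omega⟩

/-- Positivity of a form of top degree on a complex vector space of dimension `n`, with respect to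
the canonical orientation, in which `(v₀, i v₀, …, vₙ₋₁, i vₙ₋₁)` is positively oriented for every
complex basis `v`. -/
def TopPositive (n : ℕ) (τ : M [⋀^Fin (2 * n)]→ₗ[ℝ] ℂ) : Prop :=
  ∀ v : Fin n → M, LinearIndependent ℂ v →
    (τ (realFrame v)).im = 0 ∧ 0 < (τ (realFrame v)).re

/-- `α` is of bidegree `(p, q)` (where `p + q` is the degree of `α`): multiplication of the
arguments by `c ∈ ℂ` acts on `α` as `c ^ p c̄ ^ q`. -/
def IsOfBidegree {k : ℕ} (p q : ℕ) (α : M [⋀^Fin k]→ₗ[ℝ] W) : Prop :=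
  ∀ (c : ℂ) (v : Fin k → M),
    α (fun j => c • v j) = (c ^ p * (starRingEnd ℂ c) ^ q) • α v

/-- (Strict) weak positivity of a form `Ω` of bidegree `(n - m, n - m)` on an `n`-dimensional
complex space: `Ω ∧ iα₁ ∧ ᾱ₁ ∧ ⋯ ∧ iαₘ ∧ ᾱₘ > 0` for all linearly independent `(1,0)`-forms
`α₁, …, αₘ`. -/
def WeaklyPositive {n m : ℕ} (hmn : m ≤ n) (Ω : M [⋀^Fin (2 * (n - m))]→ₗ[ℝ] ℂ) : Prop :=
  ∀ α : Fin m → (M →ₗ[ℂ] ℂ), LinearIndependent ℂ α →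
    TopPositive n (formCast (show 2 * (n - m) + 2 * m = 2 * n by omega)
      (wedge Ω (wedgeProd m (fun j => elementary (α j)))))

end Algebra

/-! ### The operators `∂` and `∂̄` in a complex normed space -/

section Flat

variable {E : Type*} [NormedAddCommGroup E] [NormedSpace ℂ E]
variable {W : Type*} [NormedAddCommGroup W] [NormedSpace ℂ W]

/-- Multiplication by `i`, as a real-linear map. -/
def mulI (E : Type*) [NormedAddCommGroup E] [NormedSpace ℂ E] : E →L[ℝ] E :=
  (Complex.I • ContinuousLinearMap.id ℂ E).restrictScalars ℝ

/-- The complex-linear part `v ↦ (L v - i L (i v)) / 2` of a real-linear map. -/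
def linPart (L : E →L[ℝ] W) : E →L[ℝ] W :=
  (1 / 2 : ℂ) • (L - Complex.I • L.comp (mulI E))

/-- The conjugate-linear part `v ↦ (L v + i L (i v)) / 2` of a real-linear map. -/
def antilinPart (L : E →L[ℝ] W) : E →L[ℝ] W :=
  (1 / 2 : ℂ) • (L + Complex.I • L.comp (mulI E))

/-- Value of the complex-linear part. -/
theorem linPart_apply (L : E →L[ℝ] W) (v : E) :
    linPart L v = (1 / 2 : ℂ) • (L v - Complex.I • L (Complex.I • v)) := by
  simp [linPart, mulI]

/-- The operator `∂` on forms: the exterior derivative in which the coefficients are differentiated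
in the holomorphic directions only, `∂ (Σ α_{IJ} dz_I ∧ dz̄_J) = Σ ∂α_{IJ} ∧ dz_I ∧ dz̄_J`. -/
def del {k : ℕ} (α : E → E [⋀^Fin k]→L[ℝ] ℂ) (y : E) : E [⋀^Fin (k + 1)]→L[ℝ] ℂ :=
  .alternatizeUncurryFin (linPart (fderiv ℝ α y))

/-- The operator `∂̄` on forms, `∂̄ (Σ α_{IJ} dz_I ∧ dz̄_J) = Σ ∂̄α_{IJ} ∧ dz_I ∧ dz̄_J`. -/
def delbar {k : ℕ} (α : E → E [⋀^Fin k]→L[ℝ] ℂ) (y : E) : E [⋀^Fin (k + 1)]→L[ℝ] ℂ :=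
  .alternatizeUncurryFin (antilinPart (fderiv ℝ α y))

/-- Check: `d = ∂ + ∂̄`. -/
theorem del_add_delbar {k : ℕ} (α : E → E [⋀^Fin k]→L[ℝ] ℂ) (y : E) :
    del α y + delbar α y = extDeriv α y := by
  have h : linPart (fderiv ℝ α y) + antilinPart (fderiv ℝ α y) = fderiv ℝ α y := by
    unfold linPart antilinPart
    rw [← smul_add, sub_add_add_cancel, ← two_smul ℂ, smul_smul]
    norm_num
  rw [del, delbar, extDeriv, ← ContinuousAlternatingMap.alternatizeUncurryFin_add, h]

end Flat

/-! ### Differential forms on a complex manifold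

`E` is the model space. The real tangent space at `x` is the real vector space underlying the
complex tangent space `TangentSpace 𝓘(ℂ, E) x`. -/

section Forms

variable (E : Type*) [NormedAddCommGroup E] [NormedSpace ℂ E]
variable (X : Type*) [TopologicalSpace X] [ChartedSpace E X]

/-- Complex-valued differential `k`-forms on `X` (no regularity imposed). -/
abbrev DForm (k : ℕ) : Type _ :=
  ∀ x : X, TangentSpace 𝓘(ℂ, E) x [⋀^Fin k]→L[ℝ] ℂ

variable {E X}

/-- The coordinate expression of a form in a chart `φ`, i.e. its pull-back by `φ⁻¹`. -/
def DForm.inChart {k : ℕ} (α : DForm E X k) (φ : OpenPartialHomeomorph X E) (y : E) :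
    E [⋀^Fin k]→L[ℝ] ℂ :=
  (α (φ.symm y)).compContinuousLinearMap
    ((mfderiv 𝓘(ℂ, E) 𝓘(ℂ, E) φ.symm y).restrictScalars ℝ :)

/-- A form is smooth if its coordinate expressions are `C^∞` (in the real sense). -/
def DForm.IsSmooth {k : ℕ} (α : DForm E X k) : Prop :=
  ∀ φ ∈ atlas E X, ContDiffOn ℝ ∞ (α.inChart φ) φ.target

/-- A form is real if it takes real values. -/
def DForm.IsReal {k : ℕ} (α : DForm E X k) : Prop :=
  ∀ x v, (α x v).im = 0

/-- A form on `X` is of bidegree `(p, q)`. -/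
def DForm.OfBidegree {k : ℕ} (p q : ℕ) (α : DForm E X k) : Prop :=
  ∀ x, IsOfBidegree p q (α x).toAlternatingMap

/-- `d α = 0`. -/
def DForm.IsClosed {k : ℕ} (α : DForm E X k) : Prop :=
  ∀ φ ∈ atlas E X, ∀ y ∈ φ.target, extDeriv (α.inChart φ) y = 0

/-- `∂∂̄ α = 0`. -/
def DForm.IsDelDelbarClosed {k : ℕ} (α : DForm E X k) : Prop :=
  ∀ φ ∈ atlas E X, ∀ y ∈ φ.target, del (delbar (α.inChart φ)) y = 0

/-- Kähler metrics, identified with their fundamental forms: smooth real `d`-closed `(1,1)`-forms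
`κ` with `κ (v, i v) > 0` for `v ≠ 0`. -/
structure IsKaehler (κ : DForm E X 2) : Prop where
  smooth : κ.IsSmooth
  real : κ.IsReal
  bidegree : κ.OfBidegree 1 1
  positive : ∀ (x : X) (v : TangentSpace 𝓘(ℂ, E) x), v ≠ 0 → 0 < (κ x ![v, Complex.I • v]).re
  closed : κ.IsClosed

/-- The admissible forms `Ω`: smooth real `(n - m, n - m)`-forms with `Ω > 0` weakly and
`∂∂̄ Ω = 0`. -/
structure IsAdmissible {n m : ℕ} (hmn : m ≤ n) (Ω : DForm E X (2 * (n - m))) : Prop where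
  smooth : Ω.IsSmooth
  real : Ω.IsReal
  bidegree : Ω.OfBidegree (n - m) (n - m)
  positive : ∀ x, WeaklyPositive hmn (Ω x).toAlternatingMap
  closed : Ω.IsDelDelbarClosed

/-- The volume form `dV_κ = κ ^ n / n!` at a point. -/
def volumeForm (n : ℕ) (κ : DForm E X 2) (x : X) :
    TangentSpace 𝓘(ℂ, E) x [⋀^Fin (2 * n)]→ₗ[ℝ] ℂ :=
  (1 / (n.factorial : ℂ)) • wedgePow (κ x).toAlternatingMap n

end Forms

/-! ### Hermitian metrics, the Chern connection and its curvature -/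

section Bundle

variable {E : Type*} [NormedAddCommGroup E] [NormedSpace ℂ E]
variable {X : Type*} [TopologicalSpace X] [ChartedSpace E X]
variable {r : ℕ} {V : X → Type*} [∀ x, AddCommGroup (V x)] [∀ x, Module ℂ (V x)]
  [∀ x, TopologicalSpace (V x)] [TopologicalSpace (TotalSpace (Fin r → ℂ) V)]
  [FiberBundle (Fin r → ℂ) V] [VectorBundle ℂ (Fin r → ℂ) V]

variable (E r V) in
/-- A `C^∞` Hermitian fibre metric `h` on a complex vector bundle `V` of rank `r`. As usual in
Mathlib, `h x u w` is conjugate-linear in `u` and linear in `w`. -/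
structure HermitianMetric where
  /-- the Hermitian form on each fibre -/
  form : ∀ x, V x →ₗ⋆[ℂ] V x →ₗ[ℂ] ℂ
  conj_symm : ∀ x u w, starRingEnd ℂ (form x u w) = form x w u
  pos : ∀ x u, u ≠ 0 → 0 < (form x u u).re
  smooth : ∀ (e : Trivialization (Fin r → ℂ) (π (Fin r → ℂ) V)) [MemTrivializationAtlas e]
    (a b : Fin r → ℂ),
    ContMDiffOn 𝓘(ℝ, E) 𝓘(ℝ, ℂ) ∞ (fun x => form x (e.symm x a) (e.symm x b)) e.baseSet

/-- The local frame `e₁, …, e_r` of `V` defined by a trivialization. -/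
def frame (e : Trivialization (Fin r → ℂ) (π (Fin r → ℂ) V)) (a : Fin r) (x : X) : V x :=
  e.symm x (Pi.single a 1)

/-- The Gram matrix `H` of `h` in the frame defined by `e`, in the coordinates `φ`. -/
def gram (h : HermitianMetric E r V) (φ : OpenPartialHomeomorph X E)
    (e : Trivialization (Fin r → ℂ) (π (Fin r → ℂ) V)) (y : E) : Matrix (Fin r) (Fin r) ℂ :=
  Matrix.of fun a b => h.form (φ.symm y) (frame e a (φ.symm y)) (frame e b (φ.symm y))

/-- The connection matrix `A = H⁻¹ ∂H` of the Chern connection in the holomorphic frame defined by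
`e`, in the coordinates `φ`: a matrix of `(1,0)`-forms, with `D e_b = Σ_a A_{ab} e_a`. -/
def connectionMatrix (h : HermitianMetric E r V) (φ : OpenPartialHomeomorph X E)
    (e : Trivialization (Fin r → ℂ) (π (Fin r → ℂ) V)) (a b : Fin r) (y : E) : E →L[ℝ] ℂ :=
  ∑ c, (gram h φ e y)⁻¹ a c • linPart (fderiv ℝ (fun z => gram h φ e z c b) y)

/-- Check: the connection is compatible with `h`,
`d h(e_a, e_b) = h(D e_a, e_b) + h(e_a, D e_b)`. -/
theorem fderiv_gram (h : HermitianMetric E r V) (φ : OpenPartialHomeomorph X E)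
  (e : Trivialization (Fin r → ℂ) (π (Fin r → ℂ) V)) (y v : E)
  (hu : IsUnit (gram h φ e y).det)
  (hd : ∀ a b, DifferentiableAt ℝ (fun z => gram h φ e z a b) y) (a b : Fin r) :
  fderiv ℝ (fun z => gram h φ e z a b) y v =
    ∑ c, gram h φ e y a c * connectionMatrix h φ e c b y v +
    ∑ c, starRingEnd ℂ (connectionMatrix h φ e c a y v) * gram h φ e y c b := by
  have herm : ∀ z a b, starRingEnd ℂ (gram h φ e z a b) = gram h φ e z b a :=
    fun z a b => h.conj_symm _ _ _
  have key : ∀ a b, ∑ c, gram h φ e y a c * connectionMatrix h φ e c b y v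
        = linPart (fderiv ℝ (fun z => gram h φ e z a b) y) v := by
    intro a b
    have h1 := Matrix.mul_nonsing_inv _ hu
    have h2 : (gram h φ e y * ((gram h φ e y)⁻¹ * Matrix.of fun c b =>
        linPart (fderiv ℝ (fun z => gram h φ e z c b) y) v)) a b
        = linPart (fderiv ℝ (fun z => gram h φ e z a b) y) v := by
      rw [← Matrix.mul_assoc, h1, Matrix.one_mul]; rfl
    rw [← h2]
    simp [Matrix.mul_apply, connectionMatrix]
  have h3 : ∑ c, starRingEnd ℂ (connectionMatrix h φ e c a y v) * gram h φ e y c b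
      = starRingEnd ℂ (linPart (fderiv ℝ (fun z => gram h φ e z b a) y) v) := by
    rw [← key, map_sum]
    refine Finset.sum_congr rfl fun c _ => ?_
    rw [map_mul, herm, mul_comm]
  have h4 : ∀ w, starRingEnd ℂ (fderiv ℝ (fun z => gram h φ e z b a) y w)
      = fderiv ℝ (fun z => gram h φ e z a b) y w := by
    intro w
    have := (Complex.conjCLE.hasFDerivAt (x := gram h φ e y b a)).comp y (hd b a).hasFDerivAt
    have h5 : (Complex.conjCLE ∘ fun z => gram h φ e z b a) = fun z => gram h φ e z a b := by
      funext z; exact herm z b a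
    rw [h5] at this
    rw [this.fderiv]; rfl
  rw [h3, key, linPart_apply, linPart_apply]
  simp only [smul_eq_mul, map_mul, map_sub, h4, Complex.conj_I, map_div₀, map_one, map_ofNat]
  ring

/-- The curvature matrix `dA + A ∧ A` of the Chern connection, a matrix of two-forms. -/
def curvatureMatrix (h : HermitianMetric E r V) (φ : OpenPartialHomeomorph X E)
    (e : Trivialization (Fin r → ℂ) (π (Fin r → ℂ) V)) (a b : Fin r) (y : E) :
    E [⋀^Fin 2]→ₗ[ℝ] ℂ :=
  (extDeriv (fun z => ContinuousAlternatingMap.ofSubsingleton ℝ E ℂ (0 : Fin 1)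
      (connectionMatrix h φ e a b z)) y).toAlternatingMap
    + ∑ c, wedge (oneForm (connectionMatrix h φ e a c y : E →ₗ[ℝ] ℂ))
        (oneForm (connectionMatrix h φ e c b y : E →ₗ[ℝ] ℂ))

/-- The components of a section of `V` in the frame defined by `e`, in the coordinates `φ`. -/
def components (s : ∀ x, V x) (φ : OpenPartialHomeomorph X E)
    (e : Trivialization (Fin r → ℂ) (π (Fin r → ℂ) V)) (a : Fin r) (y : E) : ℂ :=
  (e (TotalSpace.mk' (Fin r → ℂ) (φ.symm y) (s (φ.symm y)))).2 a

/-- The differential at `x` of the preferred chart around `x`. -/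
def chartDeriv (E : Type*) [NormedAddCommGroup E] [NormedSpace ℂ E]
    {X : Type*} [TopologicalSpace X] [ChartedSpace E X] (x : X) :
    TangentSpace 𝓘(ℂ, E) x →ₗ[ℝ] E :=
  ((mfderiv 𝓘(ℂ, E) 𝓘(ℂ, E) (chartAt E x) x).restrictScalars ℝ).toLinearMap

/-- The Chern connection of `(V, h)`: the value `D_h s` at `x` of the covariant derivative of a
section `s`, a real-linear map from the tangent space at `x` to the fibre. It is computed in the
preferred coordinates and the preferred holomorphic frame around `x`:
`D_h (Σ_a s_a e_a) = Σ_a (d s_a + Σ_b A_{ab} s_b) e_a`. -/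
def chernConnection (h : HermitianMetric E r V) (s : ∀ x, V x) (x : X) :
    TangentSpace 𝓘(ℂ, E) x →ₗ[ℝ] V x :=
  let φ := chartAt E x
  let e := trivializationAt (Fin r → ℂ) V x
  ((e.symmₗ ℂ x).restrictScalars ℝ) ∘ₗ
    (LinearMap.pi fun a =>
      ((fderiv ℝ (components s φ e a) (φ x)
        + ∑ b, components s φ e b (φ x) • connectionMatrix h φ e a b (φ x) : E →L[ℝ] ℂ) :
          E →ₗ[ℝ] ℂ)) ∘ₗ chartDeriv E x

/-- The endomorphism of the fibre `V x` with matrix `N` in the frame defined by `e`. -/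
def frameEnd (e : Trivialization (Fin r → ℂ) (π (Fin r → ℂ) V)) [MemTrivializationAtlas e]
    (x : X) (N : Matrix (Fin r) (Fin r) ℂ) : V x →ₗ[ℂ] V x :=
  (e.symmₗ ℂ x) ∘ₗ Matrix.toLin' N ∘ₗ (e.linearMapAt ℂ x)

/-- The curvature `Θ_h` at `x` of the Chern connection, a two-form with values in `End (V x)`,
computed in the preferred coordinates and the preferred holomorphic frame around `x`. -/
def chernCurvature (h : HermitianMetric E r V) (x : X) :
    TangentSpace 𝓘(ℂ, E) x [⋀^Fin 2]→ₗ[ℝ] (V x →ₗ[ℂ] V x) :=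
  let φ := chartAt E x
  let e := trivializationAt (Fin r → ℂ) V x
  ∑ a, ∑ b, formTensor ((curvatureMatrix h φ e a b (φ x)).compLinearMap (chartDeriv E x))
    (frameEnd e x (Matrix.single a b 1))

/-- `h` is `(κ, Ω)`-Hermite–Einstein with (constant) Einstein factor `lam`:
`i Θ_h ∧ κ ^ (m - 1) ∧ Ω = lam dV_κ ⊗ Id`. -/
def IsHermiteEinstein {n m : ℕ} (hm : 1 ≤ m) (hmn : m ≤ n) (κ : DForm E X 2)
    (Ω : DForm E X (2 * (n - m))) (h : HermitianMetric E r V) (lam : ℝ) : Prop :=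
  ∀ x : X,
    formCast (show 2 + 2 * (m - 1) + 2 * (n - m) = 2 * n by omega)
      (wedge (wedge (Complex.I • chernCurvature h x) (wedgePow (κ x).toAlternatingMap (m - 1)))
        (Ω x).toAlternatingMap)
    = (lam : ℂ) • formTensor (volumeForm n κ x) (LinearMap.id : V x →ₗ[ℂ] V x)

variable (E r V) in
/-- The space `H⁰(X, V)` of global holomorphic sections. -/
abbrev HolomorphicSections : Type _ :=
  ContMDiffSection 𝓘(ℂ, E) (Fin r → ℂ) ω V

end Bundle

end HermiteEinstein

end

/-! Let u = |s|² for a holomorphic section s. In a holomorphic frame with Gram matrix H and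
connection matrix A = H⁻¹∂H, the Bochner formula reads i∂∂̄u = i⟨Ds, Ds⟩ - ⟨iΘs, s⟩ (`bochner`). It
follows from HΘ = i(i∂∂̄H) - ∂̄H ∧ A (`gram_mul_curvature`) by completing a square. A factorization
H = C*C turns i⟨Ds, Ds⟩ into a sum of forms iγ ∧ γ̄, with γ running over the components of C·Ds.
Wedging with ω^(m-1) ∧ Ω and inserting the Hermite–Einstein equation gives, with P(u) = i∂∂̄u ∧
ω^(m-1) ∧ Ω, the identity P(u) = Σ iγ ∧ γ̄ ∧ ω^(m-1) ∧ Ω - λ u dV (`pairing_leviForm_normSq`).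

The operator P is elliptic, without terms of lower order. Indeed ω = Σ iβ_k ∧ β̄_k for a basis β of
functionals, so iα ∧ ᾱ ∧ ω^(m-1) ∧ Ω is a sum of products Ω ∧ iβ_J ∧ β̄_J ∧ iα ∧ ᾱ. Weak positivity
makes each product positive or zero, and some choice of J completes α ≠ 0 to an independent family
(`pairing_elementary`). Top-degree forms are compared through their values on one frame, so that
`pairing` is a number and P an ordinary second-order operator on functions.

If λ < 0, then at a maximum of u the Hessian is nonpositive, so P(u) ≤ 0, while P(u) ≥ -λ u dV.
Hence u ≤ 0 there, and s = 0.

If λ = 0, then P(u) ≥ 0 and Hopf's strong maximum principle (`isOpen_setOf_eq_max`) makes u constant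
on each connected component. Then P(u) = 0, so every γ vanishes, and Ds = 0 because H is invertible.

The connection and its curvature are computed at each point in the chart and frame preferred there.
The maximum principle needs one chart on an open set; `leviForm_comp` carries the pointwise identity
over, because transition maps are holomorphic. -/

noncomputable section

namespace HermiteEinstein

set_option linter.unusedSectionVars false

/-! ### Algebra of the wedge product: bilinearity, naturality, commutation. -/

section WedgeFormula

variable {M : Type*} [AddCommGroup M] [Module ℂ M]
variable {W : Type*} [AddCommGroup W] [Module ℂ W]

theorem scalarPairing_tmul (w : W) (z : ℂ) : scalarPairing W (w ⊗ₜ[ℝ] z) = z • w := rfl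

/-- The wedge product as a signed sum over all permutations. -/
theorem factorial_smul_wedge_apply {k l : ℕ} (α : M [⋀^Fin k]→ₗ[ℝ] W) (β : M [⋀^Fin l]→ₗ[ℝ] ℂ)
    (v : Fin (k + l) → M) :
    (k.factorial * l.factorial) • wedge α β v =
      ∑ σ : Equiv.Perm (Fin (k + l)), (Equiv.Perm.sign σ : ℤ) •
        (β (fun j => v (σ (Fin.natAdd k j))) • α (fun i => v (σ (Fin.castAdd l i)))) := by
  have h1 := MultilinearMap.domCoprod_alternization_eq α β
  simp only [Fintype.card_fin] at h1
  have h2 : (k.factorial * l.factorial) • wedge α β v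
      = scalarPairing W (((k.factorial * l.factorial) • α.domCoprod β) (v ∘ finSumFinEquiv)) := by
    rw [AlternatingMap.smul_apply, map_nsmul]; rfl
  rw [h2, ← h1, MultilinearMap.alternatization_apply, map_sum]
  refine Fintype.sum_equiv (finSumFinEquiv.permCongr) _ _ fun σ => ?_
  rw [Equiv.Perm.sign_permCongr]
  simp [map_zsmul, Units.smul_def, MultilinearMap.domDomCongr_apply, scalarPairing_tmul,
    Equiv.permCongr_apply]

/-- The explicit formula from which bilinearity, naturality and continuity of `wedge` are read off.
-/
theorem wedge_apply {k l : ℕ} (α : M [⋀^Fin k]→ₗ[ℝ] W) (β : M [⋀^Fin l]→ₗ[ℝ] ℂ)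
    (v : Fin (k + l) → M) :
    wedge α β v = ((k.factorial * l.factorial : ℕ) : ℂ)⁻¹ •
      ∑ σ : Equiv.Perm (Fin (k + l)), (Equiv.Perm.sign σ : ℤ) •
        (β (fun j => v (σ (Fin.natAdd k j))) • α (fun i => v (σ (Fin.castAdd l i)))) := by
  have h0 : ((k.factorial * l.factorial : ℕ) : ℂ) ≠ 0 := by
    exact_mod_cast Nat.mul_ne_zero k.factorial_ne_zero l.factorial_ne_zero
  rw [← factorial_smul_wedge_apply, ← Nat.cast_smul_eq_nsmul ℂ, smul_smul, inv_mul_cancel₀ h0,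
    one_smul]

theorem wedge_add_left {k l : ℕ} (α α' : M [⋀^Fin k]→ₗ[ℝ] W) (β : M [⋀^Fin l]→ₗ[ℝ] ℂ) :
    wedge (α + α') β = wedge α β + wedge α' β := by
  ext v
  rw [AlternatingMap.add_apply, wedge_apply, wedge_apply, wedge_apply, ← smul_add]
  refine congrArg _ ?_
  rw [← Finset.sum_add_distrib]
  simp only [AlternatingMap.add_apply, smul_add]

theorem wedge_smul_left {k l : ℕ} (c : ℂ) (α : M [⋀^Fin k]→ₗ[ℝ] W) (β : M [⋀^Fin l]→ₗ[ℝ] ℂ) :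
    wedge (c • α) β = c • wedge α β := by
  ext v
  simp only [AlternatingMap.smul_apply, wedge_apply]
  rw [smul_comm c, Finset.smul_sum (r := c)]
  refine congrArg _ (Finset.sum_congr rfl fun σ _ => ?_)
  rw [smul_comm _ c, smul_comm _ c]

theorem wedge_add_right {k l : ℕ} (α : M [⋀^Fin k]→ₗ[ℝ] W) (β β' : M [⋀^Fin l]→ₗ[ℝ] ℂ) :
    wedge α (β + β') = wedge α β + wedge α β' := by
  ext v
  simp only [AlternatingMap.add_apply, wedge_apply, add_smul, smul_add, Finset.sum_add_distrib]

theorem wedge_smul_right {k l : ℕ} (c : ℂ) (α : M [⋀^Fin k]→ₗ[ℝ] W) (β : M [⋀^Fin l]→ₗ[ℝ] ℂ) :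
    wedge α (c • β) = c • wedge α β := by
  ext v
  simp only [AlternatingMap.smul_apply, wedge_apply]
  rw [smul_comm c, Finset.smul_sum (r := c)]
  refine congrArg _ (Finset.sum_congr rfl fun σ _ => ?_)
  rw [smul_assoc, smul_comm _ c]

/-- The wedge product as a complex-bilinear map. -/
def wedgeHom (M W : Type*) [AddCommGroup M] [Module ℂ M] [AddCommGroup W] [Module ℂ W] (k l : ℕ) :
    (M [⋀^Fin k]→ₗ[ℝ] W) →ₗ[ℂ] (M [⋀^Fin l]→ₗ[ℝ] ℂ) →ₗ[ℂ] M [⋀^Fin (k + l)]→ₗ[ℝ] W :=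
  LinearMap.mk₂ ℂ wedge wedge_add_left wedge_smul_left wedge_add_right wedge_smul_right

theorem wedge_sum_left {ι : Type*} (s : Finset ι) {k l : ℕ} (α : ι → M [⋀^Fin k]→ₗ[ℝ] W)
    (β : M [⋀^Fin l]→ₗ[ℝ] ℂ) : wedge (∑ i ∈ s, α i) β = ∑ i ∈ s, wedge (α i) β := by
  have := congrArg (fun f => f β) (map_sum (wedgeHom M W k l) α s)
  rw [LinearMap.sum_apply] at this
  exact this

theorem wedge_sum_right {ι : Type*} (s : Finset ι) {k l : ℕ} (α : M [⋀^Fin k]→ₗ[ℝ] W)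
    (β : ι → M [⋀^Fin l]→ₗ[ℝ] ℂ) : wedge α (∑ i ∈ s, β i) = ∑ i ∈ s, wedge α (β i) :=
  map_sum (wedgeHom M W k l α) β s

theorem wedge_formTensor {k l : ℕ} (γ : M [⋀^Fin k]→ₗ[ℝ] ℂ) (w : W) (β : M [⋀^Fin l]→ₗ[ℝ] ℂ) :
    wedge (formTensor γ w) β = formTensor (wedge γ β) w := by
  ext v
  have : ∀ {j : ℕ} (δ : M [⋀^Fin j]→ₗ[ℝ] ℂ) u, formTensor δ w u = δ u • w := fun _ _ => rfl
  rw [this, wedge_apply, wedge_apply, smul_assoc, Finset.sum_smul]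
  simp only [this, smul_assoc]

/-- Pull-back commutes with the wedge product. -/
theorem wedge_compLinearMap {M' : Type*} [AddCommGroup M'] [Module ℂ M'] {k l : ℕ}
    (α : M [⋀^Fin k]→ₗ[ℝ] W) (β : M [⋀^Fin l]→ₗ[ℝ] ℂ) (T : M' →ₗ[ℝ] M) :
    wedge (α.compLinearMap T) (β.compLinearMap T) = (wedge α β).compLinearMap T := by
  ext v
  simp only [AlternatingMap.compLinearMap_apply, wedge_apply]

theorem wedgeProd_compLinearMap {M' : Type*} [AddCommGroup M'] [Module ℂ M'] (T : M' →ₗ[ℝ] M) :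
    ∀ (j : ℕ) (β : Fin j → M [⋀^Fin 2]→ₗ[ℝ] ℂ),
      wedgeProd j (fun i => (β i).compLinearMap T) = (wedgeProd j β).compLinearMap T
  | 0, _ => by ext; rfl
  | j + 1, β => by
    rw [wedgeProd, wedgeProd, ← wedge_compLinearMap, ← wedgeProd_compLinearMap T j]

/-- Forms of even degree commute with all forms. -/
theorem wedge_comm_of_even {k l : ℕ} (hl : Even l) (α : M [⋀^Fin k]→ₗ[ℝ] ℂ)
    (β : M [⋀^Fin l]→ₗ[ℝ] ℂ) :
    wedge α β = formCast (add_comm l k) (wedge β α) := by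
  -- Degree zero is separate: the rotation used below needs a nonempty cyclic index set.
  rcases Nat.eq_zero_or_pos (k + l) with h0 | h0
  · obtain ⟨rfl, rfl⟩ : k = 0 ∧ l = 0 := by omega
    ext v
    simp only [formCast, AlternatingMap.domDomCongr_apply, wedge_apply, smul_eq_mul]
    simp [mul_comm, Subsingleton.elim _ (default : Fin 0 → M)]
  have : NeZero (k + l) := ⟨h0.ne'⟩
  obtain ⟨c, rfl⟩ := hl
  -- Exchanging the two blocks is rotation by c + c, the square of rotation by c, and a square has
  -- sign 1.
  set ρ : Equiv.Perm (Fin (k + (c + c))) :=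
    Equiv.addRight (Fin.ofNat (k + (c + c)) c) * Equiv.addRight (Fin.ofNat (k + (c + c)) c) with hρ
  have hsign : Equiv.Perm.sign ρ = 1 := by
    rw [hρ, map_mul, Int.units_mul_self]
  have hval : ∀ x, ((ρ x : Fin _) : ℕ) = (x + (c + c)) % (k + (c + c)) := by
    intro x
    simp [hρ, Fin.val_add, Fin.ofNat, add_assoc]
  have h1 : ∀ j : Fin (c + c), ρ (Fin.natAdd k j) = finCongr (add_comm _ _) (Fin.castAdd k j) := by
    intro j
    apply Fin.ext
    rw [hval]
    simp only [Fin.val_natAdd, finCongr_apply, Fin.val_cast, Fin.val_castAdd]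
    rw [show k + (j : ℕ) + (c + c) = j + (k + (c + c)) by omega, Nat.add_mod_right,
      Nat.mod_eq_of_lt (by omega)]
  have h2 : ∀ i : Fin k,
      ρ (Fin.castAdd (c + c) i) = finCongr (add_comm _ _) (Fin.natAdd (c + c) i) := by
    intro i
    apply Fin.ext
    rw [hval]
    simp only [Fin.val_natAdd, finCongr_apply, Fin.val_cast, Fin.val_castAdd]
    rw [Nat.mod_eq_of_lt (by omega)]
    omega
  ext v
  simp only [formCast, AlternatingMap.domDomCongr_apply, wedge_apply, smul_eq_mul]
  rw [mul_comm (Nat.factorial _)]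
  congr 1
  refine (Fintype.sum_equiv (((finCongr (add_comm (c + c) k)).permCongr).trans
    (Equiv.mulRight ρ)) _ _ fun τ => ?_).symm
  simp only [Equiv.trans_apply, Equiv.coe_mulRight, Equiv.Perm.sign_mul, hsign, mul_one,
    Equiv.Perm.sign_permCongr, Equiv.Perm.mul_apply, h1, h2, Equiv.permCongr_apply,
    Equiv.symm_apply_apply]
  rw [mul_comm (α _)]
  rfl

end WedgeFormula

/-! ### Products of one-forms as determinants. -/

section Products

variable {M : Type*} [AddCommGroup M] [Module ℂ M]

/-- The wedge product `f 0 ∧ f 1 ∧ ⋯` of a family of one-forms. -/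
def prodForm {ι : Type*} [Fintype ι] [DecidableEq ι] (f : ι → M →ₗ[ℝ] ℂ) : M [⋀^ι]→ₗ[ℝ] ℂ :=
  MultilinearMap.alternatization ((MultilinearMap.mkPiAlgebra ℝ ι ℂ).compLinearMap f)

theorem prodForm_apply {ι : Type*} [Fintype ι] [DecidableEq ι] (f : ι → M →ₗ[ℝ] ℂ) (v : ι → M) :
    prodForm f v = Matrix.det (Matrix.of fun i j => f j (v i)) := by
  rw [prodForm, MultilinearMap.alternatization_apply, Matrix.det_apply]
  refine Finset.sum_congr rfl fun σ _ => ?_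
  simp [MultilinearMap.domDomCongr_apply]

/-- Both sides alternatize the same multilinear map, since the product of two alternatizations is
the alternatization of the product; no factorials appear. -/
theorem wedge_prodForm {k l : ℕ} (f : Fin k → M →ₗ[ℝ] ℂ) (g : Fin l → M →ₗ[ℝ] ℂ) :
    wedge (prodForm f) (prodForm g) = prodForm (Fin.append f g) := by
  ext v
  rw [wedge, prodForm, prodForm, prodForm, ← MultilinearMap.domCoprod_alternization,
    AlternatingMap.domDomCongr_apply, LinearMap.compAlternatingMap_apply,
    MultilinearMap.alternatization_apply, map_sum, MultilinearMap.alternatization_apply]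
  refine Fintype.sum_equiv (finSumFinEquiv.permCongr) _ _ fun σ => ?_
  rw [Equiv.Perm.sign_permCongr]
  rw [Units.smul_def, Units.smul_def, map_zsmul]
  refine congrArg _ ?_
  rw [MultilinearMap.domDomCongr_apply, MultilinearMap.domCoprod_apply, scalarPairing_tmul]
  simp [Equiv.permCongr_apply, MultilinearMap.domDomCongr_apply, Fin.prod_univ_add, mul_comm]

theorem oneForm_eq_prodForm (α : M →ₗ[ℝ] ℂ) : oneForm α = prodForm (fun _ : Fin 1 => α) := by
  ext v
  rw [prodForm_apply]
  simp [oneForm]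

/-- The family `α₀, ᾱ₀, α₁, ᾱ₁, …`. -/
def interleave {j : ℕ} (α : Fin j → M →ₗ[ℂ] ℂ) : Fin (2 * j) → M →ₗ[ℝ] ℂ :=
  fun i => if (i : ℕ) % 2 = 0 then (α ⟨(i : ℕ) / 2, by omega⟩).restrictScalars ℝ
    else Complex.conjAe.toLinearMap ∘ₗ (α ⟨(i : ℕ) / 2, by omega⟩).restrictScalars ℝ

theorem interleave_apply {j : ℕ} (α : Fin j → M →ₗ[ℂ] ℂ) (i : Fin (2 * j)) (k : Fin j)
    (hk : (i : ℕ) / 2 = k) :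
    interleave α i = if (i : ℕ) % 2 = 0 then (α k).restrictScalars ℝ
      else Complex.conjAe.toLinearMap ∘ₗ (α k).restrictScalars ℝ := by
  rw [show k = ⟨(i : ℕ) / 2, by omega⟩ from Fin.ext hk.symm]
  rfl

/-- Reduces products of elementary forms to a determinant, from which vanishing and positivity can
be decided. -/
theorem wedgeProd_elementary : ∀ (j : ℕ) (α : Fin j → M →ₗ[ℂ] ℂ),
    wedgeProd j (fun i => elementary (α i)) = Complex.I ^ j • prodForm (interleave α)
  | 0, α => by
    ext v
    rw [AlternatingMap.smul_apply, prodForm_apply]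
    simp [wedgeProd]
  | j + 1, α => by
    rw [wedgeProd, wedgeProd_elementary j, elementary, wedge_smul_left, wedge_smul_right,
      oneForm_eq_prodForm, oneForm_eq_prodForm, wedge_prodForm, wedge_prodForm, smul_smul,
      ← pow_succ]
    congr 2
    funext i
    refine Fin.addCases (fun i => ?_) (fun i => ?_) i
    · rw [Fin.append_left]
      rfl
    · rw [Fin.append_right]
      rw [interleave_apply α _ (Fin.last j) (by simp; omega)]
      have h3 : ((Fin.natAdd (Nat.mul 2 j) i : Fin (Nat.mul 2 j + 2)) : ℕ) % 2 = (i : ℕ) := by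
        rw [Fin.val_natAdd, Nat.mul_eq]; omega
      rw [h3]
      fin_cases i <;> rfl

/-- The products of elementary forms of dependent functionals vanish. -/
theorem wedgeProd_elementary_eq_zero {j : ℕ} (α : Fin j → M →ₗ[ℂ] ℂ)
    (h : ¬ LinearIndependent ℂ α) : wedgeProd j (fun i => elementary (α i)) = 0 := by
  rw [wedgeProd_elementary]
  ext v
  rw [AlternatingMap.smul_apply, prodForm_apply, ← Matrix.det_transpose]
  rw [Fintype.linearIndependent_iff] at h
  push Not at h
  obtain ⟨g, hg, i, hi⟩ := h
  suffices Matrix.det (Matrix.of fun i j => interleave α j (v i))ᵀ = 0 by rw [this]; simp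
  rw [← Matrix.exists_vecMul_eq_zero_iff]
  -- A relation among the α's is a relation among the rows of even index; the conjugate rows receive
  -- coefficient 0.
  refine ⟨fun a => if (a : ℕ) % 2 = 0 then g ⟨(a : ℕ) / 2, by omega⟩ else 0, ?_, ?_⟩
  · intro h0
    apply hi
    have := congrFun h0 ⟨2 * (i : ℕ), by omega⟩
    simpa using this
  · funext b
    simp only [Matrix.vecMul, dotProduct, Matrix.transpose_apply, Matrix.of_apply, Pi.zero_apply]
    rw [← Equiv.sum_comp (finProdFinEquiv (m := j) (n := 2).trans (finCongr (mul_comm j 2))),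
      Fintype.sum_prod_type]
    have hb := congrArg (fun f => f (v b)) hg
    simp only [LinearMap.sum_apply, LinearMap.smul_apply, LinearMap.zero_apply] at hb
    refine Eq.trans ?_ hb
    refine Finset.sum_congr rfl fun k _ => ?_
    rw [Fin.sum_univ_two]
    have e0 : ((finProdFinEquiv (m := j) (n := 2).trans (finCongr (mul_comm j 2))) (k, 0) : ℕ)
        = 2 * k := by simp
    have e1 : ((finProdFinEquiv (m := j) (n := 2).trans (finCongr (mul_comm j 2))) (k, 1) : ℕ)
        = 2 * k + 1 := by simp; omega
    have e2 : ∀ h, (⟨((finProdFinEquiv (m := j) (n := 2).trans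
        (finCongr (mul_comm j 2))) (k, 0) : ℕ) / 2, h⟩ : Fin j) = k :=
      fun h => Fin.ext (by simp only [e0]; omega)
    rw [if_pos (by rw [e0]; omega), if_neg (by rw [e1]; omega), zero_mul, add_zero, e2,
      interleave_apply α _ k (by rw [e0]; omega), if_pos (by rw [e0]; omega)]
    rfl

/-- Evaluation of a product of elementary forms on a real frame. -/
theorem wedgeProd_elementary_realFrame {n : ℕ} (α : Fin n → M →ₗ[ℂ] ℂ) (v : Fin n → M) :
    wedgeProd n (fun i => elementary (α i)) (realFrame v)
      = ((2 ^ n * Complex.normSq (Matrix.det (Matrix.of fun i j => α j (v i))) : ℝ) : ℂ) := by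
  set B : Matrix (Fin n) (Fin n) ℂ := Matrix.of fun i j => α j (v i) with hB
  -- C records the values of a functional and its conjugate on v and iv. With row index 2k + a, the
  -- evaluation matrix factors as (1 ⊗ C) times the block matrix of B and its conjugate; det C =
  -- -2i, and i · (-2i) = 2 gives the factor 2 ^ n.
  set C : Matrix (Fin 2) (Fin 2) ℂ := !![1, 1; Complex.I, -Complex.I] with hC
  set e : Fin n × Fin 2 ≃ Fin (2 * n) :=
    (finProdFinEquiv (m := n) (n := 2)).trans (finCongr (mul_comm n 2)) with he
  have e0 : ∀ k a, (e (k, a) : ℕ) = 2 * k + a := by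
    intro k a; simp [he]; omega
  have key : (Matrix.of fun i j => interleave α j (realFrame v i)).submatrix e e
      = Matrix.kroneckerMap (· * ·) (1 : Matrix (Fin n) (Fin n) ℂ) C *
        Matrix.blockDiagonal (fun a : Fin 2 => if a = 0 then B else B.map (starRingEnd ℂ)) := by
    ext ⟨i, a⟩ ⟨j, b⟩
    rw [Matrix.mul_apply, Fintype.sum_prod_type, Finset.sum_eq_single i, Finset.sum_eq_single b]
    · rw [Matrix.submatrix_apply, Matrix.of_apply,
        interleave_apply α _ j (by rw [e0]; omega)]
      have e2 : realFrame v (e (i, a)) = Complex.I ^ (a : ℕ) • v i := by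
        rw [realFrame]
        congr 2
        · rw [e0]; omega
        · exact Fin.ext (by simp only [e0]; omega)
      rw [e2, e0]
      fin_cases a <;> fin_cases b <;> simp [hB, hC, Matrix.blockDiagonal_apply]
    · intro c _ hc
      rw [Matrix.blockDiagonal_apply_ne _ _ _ hc, mul_zero]
    · simp
    · intro k _ hk
      refine Finset.sum_eq_zero fun c _ => ?_
      simp [Matrix.kroneckerMap_apply, Matrix.one_apply_ne hk.symm]
    · simp
  have hdet : Matrix.det (Matrix.of fun i j => interleave α j (realFrame v i))
      = (-2 * Complex.I) ^ n * (B.det * (starRingEnd ℂ) B.det) := by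
    rw [← Matrix.det_submatrix_equiv_self e, key, Matrix.det_mul, Matrix.det_kronecker,
      Matrix.det_blockDiagonal]
    have hC' : C.det = -2 * Complex.I := by rw [hC, Matrix.det_fin_two_of]; ring
    have : (B.map (starRingEnd ℂ)).det = (starRingEnd ℂ) B.det := by
      rw [RingHom.map_det]; rfl
    simp [hC', this]
  rw [wedgeProd_elementary, AlternatingMap.smul_apply, prodForm_apply, hdet, smul_eq_mul,
    Complex.mul_conj, ← mul_assoc, ← mul_pow]
  have : Complex.I * (-2 * Complex.I) = 2 := by
    linear_combination (-2) * Complex.I_sq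
  rw [this]
  push_cast
  ring

/-- A product of sums is the sum of the products over all choices of summands. -/
theorem wedgeProd_sum {ι : Type*} [Fintype ι] (β : ι → M [⋀^Fin 2]→ₗ[ℝ] ℂ) :
    ∀ j : ℕ, wedgeProd j (fun _ => ∑ k, β k) = ∑ J : Fin j → ι, wedgeProd j (fun i => β (J i))
  | 0 => by simp [wedgeProd]
  | j + 1 => by
    rw [wedgeProd, wedgeProd_sum β j, wedge_sum_left]
    simp_rw [wedge_sum_right]
    rw [← Equiv.sum_comp (Fin.snocEquiv (fun _ : Fin (j + 1) => ι)), Fintype.sum_prod_type,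
      Finset.sum_comm]
    refine Finset.sum_congr rfl fun a _ => Finset.sum_congr rfl fun J _ => ?_
    rw [wedgeProd]
    simp [Fin.snocEquiv]

end Products

/-! ### Diagonalization of positive (1,1)-forms and ellipticity of the pairing. -/

section Positivity

variable {M : Type*} [AddCommGroup M] [Module ℂ M]

theorem alternatingMap_sum_apply {W : Type*} [AddCommGroup W] [Module ℂ W] {ι ι' : Type*}
    (s : Finset ι) (α : ι → M [⋀^ι']→ₗ[ℝ] W) (v : ι' → M) : (∑ i ∈ s, α i) v = ∑ i ∈ s, α i v := by
  induction s using Finset.cons_induction with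
  | empty => rfl
  | cons a s ha ih => rw [Finset.sum_cons, Finset.sum_cons, AlternatingMap.add_apply, ih]

theorem formCast_apply {W : Type*} [AddCommGroup W] [Module ℂ W] {k l : ℕ} (e : k = l)
    (α : M [⋀^Fin k]→ₗ[ℝ] W) (v : Fin l → M) :
    formCast e α v = α (fun i => v (Fin.cast e i)) := rfl

theorem wedge_formCast_right {W : Type*} [AddCommGroup W] [Module ℂ W] {k l l' : ℕ} (e : l = l')
    (α : M [⋀^Fin k]→ₗ[ℝ] W) (β : M [⋀^Fin l]→ₗ[ℝ] ℂ) :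
    wedge α (formCast e β) = formCast (congrArg (k + ·) e) (wedge α β) := by
  subst e
  rfl

theorem elementary_apply (α : M →ₗ[ℂ] ℂ) (u : Fin 2 → M) :
    elementary α u = Complex.I * (α (u 0) * starRingEnd ℂ (α (u 1))
      - α (u 1) * starRingEnd ℂ (α (u 0))) := by
  rw [elementary, oneForm_eq_prodForm, oneForm_eq_prodForm, wedge_prodForm,
    AlternatingMap.smul_apply, prodForm_apply, smul_eq_mul, Matrix.det_fin_two]
  have h0 : Fin.append (fun _ : Fin 1 => α.restrictScalars ℝ)
      (fun _ : Fin 1 => Complex.conjAe.toLinearMap ∘ₗ α.restrictScalars ℝ) 0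
      = α.restrictScalars ℝ := rfl
  have h1 : Fin.append (fun _ : Fin 1 => α.restrictScalars ℝ)
      (fun _ : Fin 1 => Complex.conjAe.toLinearMap ∘ₗ α.restrictScalars ℝ) 1
      = Complex.conjAe.toLinearMap ∘ₗ α.restrictScalars ℝ := rfl
  simp only [Matrix.of_apply, h0, h1]
  simp [mul_comm]

theorem elementary_zero : elementary (0 : M →ₗ[ℂ] ℂ) = 0 := by
  ext u
  simp [elementary_apply]

theorem elementary_compLinearMap {M' : Type*} [AddCommGroup M'] [Module ℂ M'] (α : M →ₗ[ℂ] ℂ)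
    (T : M' →ₗ[ℂ] M) :
    (elementary α).compLinearMap (T.restrictScalars ℝ) = elementary (α ∘ₗ T) := by
  ext u
  simp [elementary_apply]

/-- The complex-linear functional with the given real-linear, `i`-homogeneous underlying map. -/
def functionalOfReal (L : M →ₗ[ℝ] ℂ) (hL : ∀ v, L (Complex.I • v) = Complex.I * L v) :
    M →ₗ[ℂ] ℂ where
  toFun := L
  map_add' := map_add L
  map_smul' c v := by
    have : c • v = c.re • v + c.im • (Complex.I • v) := by
      conv_lhs => rw [← Complex.re_add_im c]
      rw [add_smul, mul_smul]
      rfl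
    rw [this, map_add, map_smul, map_smul, hL]
    simp only [Complex.real_smul, smul_eq_mul, RingHom.id_apply]
    conv_rhs => rw [← Complex.re_add_im c]
    ring

open scoped ComplexOrder MatrixOrder in
-- The positive semidefinite square root is Hermitian, so it serves as the factor. Used over ℂ for
-- metrics and over ℝ for second-derivative forms.
theorem exists_eq_conjTranspose_mul_self {ι 𝕜 : Type*} [Fintype ι] [RCLike 𝕜]
    {G : Matrix ι ι 𝕜} (hG : G.PosSemidef) : ∃ C : Matrix ι ι 𝕜, G = Cᴴ * C := by
  classical
  refine ⟨CFC.sqrt G, ?_⟩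
  rw [(Matrix.nonneg_iff_posSemidef.1 (CFC.sqrt_nonneg G)).1.eq, CFC.sqrt_mul_sqrt_self G hG.nonneg]

open scoped ComplexOrder in
/-- A positive `(1,1)`-form is a sum of elementary forms of a basis of functionals. -/
theorem exists_eq_sum_elementary {n : ℕ} [FiniteDimensional ℂ M] (hn : Module.finrank ℂ M = n)
    (κ : M [⋀^Fin 2]→ₗ[ℝ] ℂ) (hreal : ∀ v, (κ v).im = 0) (hbi : IsOfBidegree 1 1 κ)
    (hpos : ∀ v : M, v ≠ 0 → 0 < (κ ![v, Complex.I • v]).re) :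
    ∃ β : Fin n → M →ₗ[ℂ] ℂ, LinearIndependent ℂ β ∧ κ = ∑ k, elementary (β k) := by
  have hI : ∀ u w, κ ![Complex.I • u, Complex.I • w] = κ ![u, w] := by
    intro u w
    have h := hbi Complex.I ![u, w]
    have h' : (fun j => Complex.I • ![u, w] j) = ![Complex.I • u, Complex.I • w] := by
      funext j; fin_cases j <;> rfl
    rw [h'] at h
    simpa using h
  have hadd2 : ∀ u w w', κ ![u, w + w'] = κ ![u, w] + κ ![u, w'] := by
    intro u w w'
    have h : ∀ z, Function.update ![u, 0] 1 z = ![u, z] := fun z => by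
      funext j; fin_cases j <;> rfl
    simpa only [h] using κ.map_update_add ![u, 0] 1 w w'
  have hsmul2 : ∀ (c : ℝ) u w, κ ![u, c • w] = c • κ ![u, w] := by
    intro c u w
    have h : ∀ z, Function.update ![u, 0] 1 z = ![u, z] := fun z => by
      funext j; fin_cases j <;> rfl
    simpa only [h] using κ.map_update_smul ![u, 0] 1 c w
  have hswap : ∀ u w, κ ![u, w] = - κ ![w, u] := by
    intro u w
    have := κ.map_swap ![w, u] (i := 0) (j := 1) (by decide)
    rw [← this]
    congr 1
    funext j; fin_cases j <;> simp
  have hIneg : ∀ u w, κ ![u, (-1 : ℂ) • w] = - κ ![u, w] := by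
    intro u w
    have := hsmul2 (-1) u w
    rwa [neg_one_smul, neg_one_smul, ← neg_one_smul ℂ w] at this
  have hII : ∀ u w, κ ![Complex.I • u, w] = - κ ![u, Complex.I • w] := by
    intro u w
    rw [← hI u, smul_smul, Complex.I_mul_I, hIneg, neg_neg]
  have hconj : ∀ v, starRingEnd ℂ (κ v) = κ v := fun v => Complex.conj_eq_iff_im.2 (hreal v)
  -- The sesquilinear form behind κ: reality and bidegree (1,1) make S Hermitian, S (u, u) is half
  -- of κ (u, iu), and κ is recovered as i (S (u, w) - S (w, u)).
  set S : M → M → ℂ := fun u w => (1 / 2 : ℂ) * (κ ![u, Complex.I • w] - Complex.I * κ ![u, w])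
    with hS
  have hSsymm : ∀ u w, starRingEnd ℂ (S u w) = S w u := by
    intro u w
    simp only [hS, map_mul, map_sub, hconj, Complex.conj_I, map_div₀, map_one, map_ofNat]
    rw [hswap w u, hswap w, hII]
    ring
  have hSadd : ∀ u w w', S u (w + w') = S u w + S u w' := by
    intro u w w'
    simp only [hS, smul_add, hadd2]
    ring
  have hSsmul : ∀ (c : ℂ) u w, S u (c • w) = starRingEnd ℂ c * S u w := by
    intro c u w
    have hc : c • w = c.re • w + c.im • (Complex.I • w) := by
      conv_lhs => rw [← Complex.re_add_im c]
      rw [add_smul, mul_smul]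
      rfl
    have h1 : ∀ (a : ℝ), S u (a • w) = a * S u w := by
      intro a
      simp only [hS, smul_comm Complex.I a, hsmul2, Complex.real_smul]
      ring
    have h2 : ∀ (a : ℝ), S u (a • Complex.I • w) = -Complex.I * (a * S u w) := by
      intro a
      simp only [hS, smul_comm Complex.I a, hsmul2, Complex.real_smul, smul_smul, Complex.I_mul_I,
        hIneg]
      linear_combination (-(1 / 2) * a * κ ![u, w]) * Complex.I_sq
    rw [hc, hSadd, h1, h2]
    conv_rhs => rw [← Complex.re_add_im c]
    simp only [map_add, map_mul, Complex.conj_ofReal, Complex.conj_I]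
    ring
  let Sf : M →ₗ[ℂ] M →ₗ⋆[ℂ] ℂ := LinearMap.mk₂'ₛₗ (RingHom.id ℂ) (starRingEnd ℂ) S
    (fun u u' w => by rw [← hSsymm, hSadd, map_add, hSsymm, hSsymm])
    (fun c u w => by
      rw [← hSsymm, hSsmul, map_mul, hSsymm, Complex.conj_conj]; rfl)
    hSadd (fun c u w => hSsmul c u w)
  have hκS : ∀ u, κ u = Complex.I * (S (u 0) (u 1) - S (u 1) (u 0)) := by
    intro u
    have hu : u = ![u 0, u 1] := by funext j; fin_cases j <;> rfl
    simp only [hS]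
    rw [hswap (u 1) (Complex.I • u 0), hII, hswap (u 1) (u 0), ← hu]
    linear_combination (κ u) * Complex.I_sq
  set b := Module.finBasisOfFinrankEq ℂ M hn with hb
  -- The indices are exchanged because S is linear in its first slot, so that x* G x = S (y, y) for
  -- y = Σ x_j b_j.
  set G : Matrix (Fin n) (Fin n) ℂ := Matrix.of fun i j => S (b j) (b i) with hG
  have hGpos : G.PosSemidef := by
    refine .of_dotProduct_mulVec_nonneg ?_ fun x => ?_
    · ext i j
      exact hSsymm _ _
    · have h1 : star x ⬝ᵥ (G *ᵥ x) = S (∑ j, x j • b j) (∑ i, x i • b i) := by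
        change _ = Sf _ _
        simp only [map_sum, LinearMap.sum_apply, map_smul, LinearMap.map_smulₛₗ,
          LinearMap.smul_apply, dotProduct, Matrix.mulVec, Finset.mul_sum, smul_eq_mul]
        refine Finset.sum_congr rfl fun i _ => Finset.sum_congr rfl fun j _ => ?_
        rw [mul_comm (G i j)]
        rfl
      rw [h1, Complex.le_def]
      set y := ∑ j, x j • b j
      constructor
      · by_cases hy : y = 0
        · rw [hy]
          have : Sf 0 0 = 0 := by simp
          exact this.symm ▸ le_rfl
        · have := hpos y hy
          simp only [hS, Complex.zero_re]
          have h3 : κ ![y, y] = 0 := κ.map_eq_zero_of_eq _ (i := 0) (j := 1) rfl (by decide)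
          rw [h3]
          simp
          exact this.le
      · exact (Complex.conj_eq_iff_im.1 (hSsymm y y)).symm
  obtain ⟨C, hC⟩ := exists_eq_conjTranspose_mul_self hGpos
  let β : Fin n → M →ₗ[ℂ] ℂ := fun k => b.constr ℂ (fun j => C k j)
  have hβ : ∀ u w, S u w = ∑ k, β k u * starRingEnd ℂ (β k w) := by
    have hβb : ∀ k j, β k (b j) = C k j := fun k j => b.constr_basis ℂ _ j
    let T : M →ₗ[ℂ] M →ₗ⋆[ℂ] ℂ := ∑ k, LinearMap.mk₂'ₛₗ (RingHom.id ℂ) (starRingEnd ℂ)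
      (fun u w => β k u * starRingEnd ℂ (β k w)) (fun u u' w => by simp [add_mul])
      (fun c u w => by simp [mul_assoc]) (fun u w w' => by simp [mul_add])
      (fun c u w => by simp [mul_left_comm])
    have hT : ∀ u w, T u w = ∑ k, β k u * starRingEnd ℂ (β k w) := by
      intro u w
      simp [T, LinearMap.sum_apply]
    have : Sf = T := by
      refine LinearMap.ext_basis b b fun i j => ?_
      rw [hT]
      change G j i = _
      rw [hC, Matrix.mul_apply]
      refine Finset.sum_congr rfl fun k _ => ?_
      rw [hβb, hβb, mul_comm, Matrix.conjTranspose_apply]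
      rfl
    intro u w
    rw [← hT, ← this]
    rfl
  have hκ : κ = ∑ k, elementary (β k) := by
    ext u
    rw [hκS, alternatingMap_sum_apply, hβ, hβ, ← Finset.sum_sub_distrib, Finset.mul_sum]
    exact Finset.sum_congr rfl fun k _ => (elementary_apply _ _).symm
  refine ⟨β, ?_, hκ⟩
  -- A common zero v ≠ 0 of all β_k would make κ (v, iv) vanish. Hence the n functionals embed an
  -- n-dimensional space into ℂⁿ, the embedding is onto, and the functionals are independent.
  have hinj : Function.Injective (LinearMap.pi β) := by
    rw [← LinearMap.ker_eq_bot, LinearMap.ker_eq_bot']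
    intro v hv
    by_contra h0
    have h := hpos v h0
    have h1 : ∀ k, β k v = 0 := fun k => congrFun hv k
    rw [hκ, alternatingMap_sum_apply] at h
    simp [elementary_apply, h1] at h
  have hsurj : Function.Surjective (LinearMap.pi β) :=
    (LinearMap.injective_iff_surjective_of_finrank_eq_finrank (by simp [hn])).1 hinj
  rw [Fintype.linearIndependent_iff]
  intro g hg i
  obtain ⟨v, hv⟩ := hsurj (Pi.single i 1)
  have h1 : ∀ k, β k v = (Pi.single i 1 : Fin n → ℂ) k := fun k => congrFun hv k
  have := congrArg (fun f => f v) hg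
  simpa [h1, Pi.single_apply] using this

/-- Steinitz extension: as long as fewer than n vectors are chosen, their span misses some member of
a spanning family. New vectors are added in front so that α stays last, where `wedgeProd` splits off
its final factor. -/
theorem exists_linearIndependent_snoc {F : Type*} [AddCommGroup F] [Module ℂ F]
    [FiniteDimensional ℂ F] {n : ℕ} (hn : Module.finrank ℂ F = n) {ι : Type*} (β : ι → F)
    (hβ : Submodule.span ℂ (Set.range β) = ⊤) {α : F} (hα : α ≠ 0) :
    ∀ k : ℕ, k + 1 ≤ n → ∃ J : Fin k → ι,
      LinearIndependent ℂ (Fin.snoc (β ∘ J) α : Fin (k + 1) → F)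
  | 0, _ => by
    refine ⟨Fin.elim0, ?_⟩
    have : Subsingleton (Fin (0 + 1)) := inferInstanceAs (Subsingleton (Fin 1))
    exact LinearIndependent.of_subsingleton (0 : Fin 1) (by simpa [Fin.snoc] using hα)
  | k + 1, hk => by
    obtain ⟨J, hJ⟩ := exists_linearIndependent_snoc hn β hβ hα k (by omega)
    obtain ⟨i, hi⟩ : ∃ i, β i ∉ Submodule.span ℂ
        (Set.range (Fin.snoc (β ∘ J) α : Fin (k + 1) → F)) := by
      by_contra! hcon
      have h1 : (⊤ : Submodule ℂ F) ≤ Submodule.span ℂ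
          (Set.range (Fin.snoc (β ∘ J) α : Fin (k + 1) → F)) := by
        rw [← hβ, Submodule.span_le]
        rintro _ ⟨i, rfl⟩
        exact hcon i
      have h2 := finrank_span_eq_card hJ
      rw [top_le_iff.1 h1, finrank_top, hn, Fintype.card_fin] at h2
      omega
    refine ⟨Fin.cons i J, ?_⟩
    have : (Fin.snoc (β ∘ (Fin.cons i J : Fin (k + 1) → ι)) α : Fin (k + 2) → F)
        = Fin.cons (β i) (Fin.snoc (β ∘ J) α : Fin (k + 1) → F) := by
      rw [Fin.cons_snoc_eq_snoc_cons]
      congr 1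
      funext x
      refine Fin.cases ?_ (fun x => ?_) x <;> simp
    rw [this, linearIndependent_finCons]
    exact ⟨hJ, hi⟩

/-- Pairing of a two-form with `κ ^ k ∧ Ω`, evaluated on a real frame. -/
def pairing {n k : ℕ} (hkn : k + 1 ≤ n) (κ : M [⋀^Fin 2]→ₗ[ℝ] ℂ)
    (Ω : M [⋀^Fin (2 * (n - (k + 1)))]→ₗ[ℝ] ℂ) (v : Fin n → M) :
    (M [⋀^Fin 2]→ₗ[ℝ] ℂ) →ₗ[ℂ] ℂ where
  toFun γ := formCast (show 2 + 2 * k + 2 * (n - (k + 1)) = 2 * n by omega)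
    (wedge (wedge γ (wedgePow κ k)) Ω) (realFrame v)
  map_add' γ γ' := by
    rw [wedge_add_left, wedge_add_left]; rfl
  map_smul' c γ := by
    rw [wedge_smul_left, wedge_smul_left]; rfl

/-- Ellipticity. Expanding κ ^ k in elementary forms gives a sum over choices J: dependent choices
contribute 0, independent ones a positive number by weak positivity, and an independent choice
exists because α ≠ 0 can be completed from the β's. -/
theorem pairing_elementary {n k : ℕ} [FiniteDimensional ℂ M] (hn : Module.finrank ℂ M = n)
    (hkn : k + 1 ≤ n) {κ : M [⋀^Fin 2]→ₗ[ℝ] ℂ} (hreal : ∀ v, (κ v).im = 0)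
    (hbi : IsOfBidegree 1 1 κ) (hpos : ∀ v : M, v ≠ 0 → 0 < (κ ![v, Complex.I • v]).re)
    {Ω : M [⋀^Fin (2 * (n - (k + 1)))]→ₗ[ℝ] ℂ} (hΩ : WeaklyPositive hkn Ω) {v : Fin n → M}
    (hv : LinearIndependent ℂ v) {α : M →ₗ[ℂ] ℂ} (hα : α ≠ 0) :
    (pairing hkn κ Ω v (elementary α)).im = 0 ∧ 0 < (pairing hkn κ Ω v (elementary α)).re := by
  obtain ⟨β, hβ, rfl⟩ := exists_eq_sum_elementary hn κ hreal hbi hpos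
  set f : (Fin k → Fin n) → Fin (k + 1) → M →ₗ[ℂ] ℂ := fun J => Fin.snoc (β ∘ J) α with hf
  have key : pairing hkn (∑ k, elementary (β k)) Ω v (elementary α)
      = ∑ J : Fin k → Fin n, formCast (show 2 * (n - (k + 1)) + 2 * (k + 1) = 2 * n by omega)
        (wedge Ω (wedgeProd (k + 1) (fun j => elementary (f J j)))) (realFrame v) := by
    have h1 : ∀ J : Fin k → Fin n, wedgeProd (k + 1) (fun j => elementary (f J j))
        = wedge (wedgeProd k (fun i => elementary (β (J i)))) (elementary α) := by
      intro J
      rw [wedgeProd]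
      simp [hf]
    simp_rw [h1]
    rw [pairing]
    simp only [LinearMap.coe_mk, AddHom.coe_mk]
    rw [wedgePow, wedgeProd_sum, wedge_sum_right, wedge_sum_left, formCast_apply,
      alternatingMap_sum_apply]
    refine Finset.sum_congr rfl fun J _ => ?_
    -- All forms involved have even degree, so Ω moves to the front and α to the end without signs.
    rw [← formCast_apply (show 2 + 2 * k + 2 * (n - (k + 1)) = 2 * n by omega),
      wedge_comm_of_even (even_two_mul _), wedge_comm_of_even (even_two_mul k),
      wedge_formCast_right]
    rfl
  have hterm : ∀ J, (formCast (show 2 * (n - (k + 1)) + 2 * (k + 1) = 2 * n by omega)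
        (wedge Ω (wedgeProd (k + 1) (fun j => elementary (f J j)))) (realFrame v)).im = 0 ∧
      0 ≤ (formCast (show 2 * (n - (k + 1)) + 2 * (k + 1) = 2 * n by omega)
        (wedge Ω (wedgeProd (k + 1) (fun j => elementary (f J j)))) (realFrame v)).re := by
    intro J
    by_cases hJ : LinearIndependent ℂ (f J)
    · exact ⟨(hΩ (f J) hJ v hv).1, (hΩ (f J) hJ v hv).2.le⟩
    · rw [wedgeProd_elementary_eq_zero _ hJ]
      have : wedge Ω (0 : M [⋀^Fin (2 * (k + 1))]→ₗ[ℝ] ℂ) = 0 :=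
        map_zero (wedgeHom M ℂ _ _ Ω)
      rw [this]
      simp [formCast_apply]
  rw [key, Complex.im_sum, Complex.re_sum]
  refine ⟨Finset.sum_eq_zero fun J _ => (hterm J).1, ?_⟩
  have hspan : Submodule.span ℂ (Set.range β) = ⊤ :=
    hβ.span_eq_top_of_card_eq_finrank' (by simp [Subspace.dual_finrank_eq, hn])
  obtain ⟨J, hJ⟩ := exists_linearIndependent_snoc
    (show Module.finrank ℂ (M →ₗ[ℂ] ℂ) = n from Subspace.dual_finrank_eq.trans hn)
    β hspan hα k hkn
  exact Finset.sum_pos' (fun J _ => (hterm J).2) ⟨J, Finset.mem_univ _, (hΩ (f J) hJ v hv).2⟩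

/-- The power is a sum of terms 2 ^ n |det|², and the choice J = id contributes a nonzero
determinant: a singular matrix would give a nonzero vector killed by all β_k, hence by κ. -/
theorem wedgePow_realFrame_pos {n : ℕ} [FiniteDimensional ℂ M] (hn : Module.finrank ℂ M = n)
    {κ : M [⋀^Fin 2]→ₗ[ℝ] ℂ} (hreal : ∀ v, (κ v).im = 0)
    (hbi : IsOfBidegree 1 1 κ) (hpos : ∀ v : M, v ≠ 0 → 0 < (κ ![v, Complex.I • v]).re)
    {v : Fin n → M} (hv : LinearIndependent ℂ v) :
    (wedgePow κ n (realFrame v)).im = 0 ∧ 0 < (wedgePow κ n (realFrame v)).re := by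
  obtain ⟨β, hβ, rfl⟩ := exists_eq_sum_elementary hn κ hreal hbi hpos
  rw [wedgePow, wedgeProd_sum, alternatingMap_sum_apply]
  simp_rw [wedgeProd_elementary_realFrame (fun i => β _)]
  rw [← Complex.ofReal_sum, Complex.ofReal_im, Complex.ofReal_re]
  refine ⟨rfl, Finset.sum_pos' (fun J _ => mul_nonneg (by positivity) (Complex.normSq_nonneg _))
    ⟨id, Finset.mem_univ _, mul_pos (by positivity) (Complex.normSq_pos.2 fun hdet => ?_)⟩⟩
  obtain ⟨x, hx, hx0⟩ := Matrix.exists_vecMul_eq_zero_iff.2 hdet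
  have h1 : ∀ k, β k (∑ i, x i • v i) = 0 := by
    intro k
    rw [map_sum]
    refine Eq.trans ?_ (congrFun hx0 k)
    simp [Matrix.vecMul, dotProduct]
  have h2 : ∑ i, x i • v i ≠ 0 := fun h0 =>
    hx (funext (Fintype.linearIndependent_iff.1 hv x h0))
  have h := hpos _ h2
  rw [alternatingMap_sum_apply] at h
  simp [elementary_apply, h1] at h

end Positivity

/-! ### Hopf's strong maximum principle on an inner product space. -/

section MaximumPrinciple

open Filter Topology

/-- On the line through z in direction v, a positive second derivative would make 0 a local minimum
as well as a maximum. The function would then be locally constant there, with second derivative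
zero. -/
theorem sndDeriv_nonpos_of_isLocalMax {F : Type*} [NormedAddCommGroup F] [NormedSpace ℝ F]
    {f : F → ℝ} {z : F} (hf : ContDiffAt ℝ 2 f z) (hz : IsLocalMax f z) (v : F) :
    fderiv ℝ (fderiv ℝ f) z v v ≤ 0 := by
  by_contra! hpos
  set γ : ℝ → F := fun t => z + t • v with hγ
  have hγ0 : γ 0 = z := by simp [hγ]
  have hγd : ∀ t, HasDerivAt γ v t := fun t => by
    have := ((hasDerivAt_id t).smul_const v).const_add z
    rwa [one_smul] at this
  have hγc : Tendsto γ (𝓝 0) (𝓝 z) := by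
    have := (hγd 0).continuousAt.tendsto
    rwa [hγ0] at this
  have hd1 : ∀ᶠ t in 𝓝 (0 : ℝ), deriv (f ∘ γ) t = fderiv ℝ f (γ t) v := by
    have h1 : ∀ᶠ y in 𝓝 z, DifferentiableAt ℝ f y :=
      (hf.eventually (by simp)).mono fun y hy => hy.differentiableAt (by norm_num)
    filter_upwards [hγc.eventually h1] with t ht
    exact (ht.hasFDerivAt.comp_hasDerivAt t (hγd t)).deriv
  have hdf : DifferentiableAt ℝ (fderiv ℝ f) z :=
    (hf.fderiv_right (m := 1) (by norm_num)).differentiableAt (by norm_num)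
  have hd2 : deriv (deriv (f ∘ γ)) 0 = fderiv ℝ (fderiv ℝ f) z v v := by
    rw [Filter.EventuallyEq.deriv_eq hd1]
    have h2 : HasDerivAt (fun t => fderiv ℝ f (γ t)) (fderiv ℝ (fderiv ℝ f) z v) 0 := by
      have h3 := hdf.hasFDerivAt
      rw [← hγ0] at h3
      have := h3.comp_hasDerivAt 0 (hγd 0)
      rwa [hγ0] at this
    exact (h2.clm_apply (hasDerivAt_const 0 v)).deriv.trans (by simp)
  have hmax : IsLocalMax (f ∘ γ) 0 := by
    rw [IsLocalMax, IsMaxFilter] at hz ⊢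
    simp only [Function.comp_apply, hγ0]
    exact hγc.eventually hz
  have hmin : IsLocalMin (f ∘ γ) 0 := by
    refine isLocalMin_of_deriv_deriv_pos (by rw [hd2]; exact hpos) hmax.deriv_eq_zero ?_
    refine ContinuousAt.comp ?_ (hγd 0).continuousAt
    rw [hγ0]
    exact hf.continuousAt
  have hconst : (f ∘ γ) =ᶠ[𝓝 0] fun _ => (f ∘ γ) 0 := by
    filter_upwards [hmax, hmin] with t h1 h2
    exact le_antisymm h1 h2
  have h4 : deriv (f ∘ γ) =ᶠ[𝓝 0] fun _ => 0 := by
    filter_upwards [hconst.eventuallyEq_nhds] with t ht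
    rw [ht.deriv_eq, deriv_const]
  rw [← hd2, h4.deriv_eq, deriv_const] at hpos
  exact lt_irrefl _ hpos

variable {F : Type*} [NormedAddCommGroup F] [InnerProductSpace ℝ F]

/-- In finite dimension pointwise continuity of a family of functionals is continuity in norm, so
the argument may vary as well. -/
theorem continuousOn_linearMap_apply {X G : Type*} [TopologicalSpace X] [NormedAddCommGroup G]
    [NormedSpace ℝ G] [FiniteDimensional ℝ G] (P : X → G →ₗ[ℝ] ℝ) {S : Set X}
    (hP : ∀ B, ContinuousOn (fun x => P x B) S) {B : X → G} (hB : ContinuousOn B S) :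
    ContinuousOn (fun x => P x (B x)) S := by
  have h1 : ContinuousOn (fun x => LinearMap.toContinuousLinearMap (P x)) S :=
    continuousOn_clm_apply.2 hP
  exact h1.clm_apply hB

variable (F) in
/-- The inner product as a bilinear form. -/
def innerForm : F →L[ℝ] F →L[ℝ] ℝ := innerSL ℝ

@[simp]
theorem innerForm_apply (v w : F) : innerForm F v w = inner ℝ v w := rfl

theorem contDiff_exp_neg_mul_normSq (a : ℝ) (c : F) {n : WithTop ℕ∞} :
    ContDiff ℝ n fun y => Real.exp (-a * ‖y - c‖ ^ 2) :=
  (contDiff_const.mul ((contDiff_id.sub contDiff_const).norm_sq ℝ)).exp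

/-- Hessian of Hopf's barrier: the rank-one term grows like a², the trace term only like a, so large
a makes an elliptic operator positive on it away from the centre. -/
theorem sndDeriv_exp_neg_mul_normSq (a : ℝ) (c y : F) :
    fderiv ℝ (fderiv ℝ fun y => Real.exp (-a * ‖y - c‖ ^ 2)) y =
      Real.exp (-a * ‖y - c‖ ^ 2) • ((4 * a ^ 2) •
        (innerForm F (y - c)).smulRight (innerForm F (y - c)) - (2 * a) • innerForm F) := by
  have h1 : ∀ y, HasFDerivAt (fun y => Real.exp (-a * ‖y - c‖ ^ 2))
      ((-2 * a * Real.exp (-a * ‖y - c‖ ^ 2)) • innerForm F (y - c)) y := by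
    intro y
    have h := ((((hasFDerivAt_id y).sub_const c).norm_sq).const_mul (-a)).exp
    refine h.congr_fderiv ?_
    ext v
    simp
    ring
  have h2 : (fderiv ℝ fun y => Real.exp (-a * ‖y - c‖ ^ 2)) =
      fun y => (-2 * a * Real.exp (-a * ‖y - c‖ ^ 2)) • innerForm F (y - c) :=
    funext fun y => (h1 y).fderiv
  rw [h2]
  have h3 : HasFDerivAt (fun y : F => innerForm F (y - c)) (innerForm F) y :=
    ((innerForm F).hasFDerivAt).comp y ((hasFDerivAt_id y).sub_const c)
  refine (((h1 y).const_mul (-2 * a)).smul h3).fderiv.trans ?_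
  ext v w
  simp
  ring

variable [FiniteDimensional ℝ F]

set_option maxHeartbeats 1000000 in
set_option synthInstance.maxHeartbeats 200000 in
/-- The strong maximum principle: the set where a subsolution of an elliptic second-order
operator without lower-order terms attains its maximum is open. -/
theorem isOpen_setOf_eq_max {U : Set F} (hU : IsOpen U) {u : F → ℝ}
    (hu : ∀ y ∈ U, ContDiffAt ℝ 2 u y) (P : F → (F →L[ℝ] F →L[ℝ] ℝ) →ₗ[ℝ] ℝ)
    (hPc : ∀ B, ContinuousOn (fun y => P y B) U)
    (hPnonneg : ∀ y ∈ U, ∀ B : F →L[ℝ] F →L[ℝ] ℝ, (∀ v w, B v w = B w v) → (∀ v, 0 ≤ B v v) →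
      0 ≤ P y B)
    (hPpos : ∀ y ∈ U, ∀ ℓ : F →L[ℝ] ℝ, ℓ ≠ 0 → 0 < P y (ℓ.smulRight ℓ))
    (hsub : ∀ y ∈ U, 0 ≤ P y (fderiv ℝ (fderiv ℝ u) y)) {A : ℝ} (hA : ∀ y ∈ U, u y ≤ A) :
    IsOpen {y | y ∈ U ∧ u y = A} := by
  rw [isOpen_iff_mem_nhds]
  rintro q₀ ⟨hq₀, hq₀A⟩
  by_contra hnot
  have hucont : ContinuousOn u U := fun y hy => (hu y hy).continuousAt.continuousWithinAt
  obtain ⟨r₀, hr₀, hr₀U⟩ := Metric.isOpen_iff.1 hU q₀ hq₀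
  -- Leaves room: every point used below lies within 3r of q₀, hence in the compact ball of radius
  -- 4r inside U.
  set r := r₀ / 8 with hr
  have hr0 : 0 < r := by positivity
  have hrU : Metric.closedBall q₀ (4 * r) ⊆ U :=
    (Metric.closedBall_subset_ball (by rw [hr]; linarith)).trans hr₀U
  obtain ⟨c, hc, hcA⟩ : ∃ c ∈ Metric.ball q₀ r, u c ≠ A := by
    by_contra! h
    refine hnot (Filter.mem_of_superset (Metric.ball_mem_nhds q₀ hr0) fun y hy => ⟨?_, h y hy⟩)
    exact hrU (Metric.ball_subset_closedBall (Metric.ball_subset_ball (by linarith) hy))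
  set K := {y | y ∈ Metric.closedBall q₀ (4 * r) ∧ u y = A} with hK
  have hKc : IsCompact K := by
    have h1 : K = Metric.closedBall q₀ (4 * r) ∩ u ⁻¹' {A} := rfl
    rw [h1]
    exact (isCompact_closedBall q₀ (4 * r)).of_isClosed_subset
      ((hucont.mono hrU).preimage_isClosed_of_isClosed Metric.isClosed_closedBall
        isClosed_singleton) Set.inter_subset_left
  have hq₀K : q₀ ∈ K := ⟨Metric.mem_closedBall_self (by linarith), hq₀A⟩
  -- q is a maximum point nearest to c, so no maximum point in K is at distance less than R from c.
  -- Passing to the ball on the diameter from c to q makes q the only contact point.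
  obtain ⟨q, hqK, hqdist⟩ := hKc.exists_infDist_eq_dist ⟨q₀, hq₀K⟩ c
  have hdist : ∀ y ∈ K, dist c q ≤ dist c y := fun y hy =>
    hqdist ▸ Metric.infDist_le_dist_of_mem hy
  set R := dist c q with hR
  rw [Metric.mem_ball] at hc
  have hRr : R < r := (hdist q₀ hq₀K).trans_lt hc
  have hR0 : 0 < R := dist_pos.2 fun h => hcA (h ▸ hqK.2)
  have hqq₀ : dist q q₀ < 2 * r := by
    have := dist_triangle q c q₀
    rw [dist_comm q c] at this
    linarith
  -- the only maximum point in the closed ball with diameter `[c, q]` is `q`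
  set c' := midpoint ℝ c q with hc'
  have hbc : ‖c' - c‖ = R / 2 := by
    rw [← dist_eq_norm, hc', dist_midpoint_left, Real.norm_ofNat]
    ring
  have hqc' : q - c' = c' - c := by
    rw [hc', midpoint_eq_smul_add, invOf_eq_inv]
    module
  have honly : ∀ y ∈ U, ‖y - c'‖ ≤ R / 2 → y ≠ q → u y < A := by
    intro y hyU hy hyq
    refine lt_of_le_of_ne (hA y hyU) fun hyA => hyq ?_
    have hyc : dist y c ≤ R := by
      rw [dist_eq_norm, show y - c = (y - c') + (c' - c) by abel]
      exact (norm_add_le _ _).trans (by linarith)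
    have hyK : y ∈ K := by
      refine ⟨?_, hyA⟩
      rw [Metric.mem_closedBall]
      have := dist_triangle y c q₀
      linarith
    have h1 := hdist y hyK
    rw [dist_comm, dist_eq_norm, show y - c = (y - c') + (c' - c) by abel] at h1
    -- Both summands have norm at most R/2 and their sum has norm at least R, so they are equal,
    -- which says y = q.
    have h2 := parallelogram_law_with_norm ℝ (y - c') (c' - c)
    have h3 : ‖(y - c') - (c' - c)‖ * ‖(y - c') - (c' - c)‖ ≤ 0 := by
      have e1 : R * R ≤ ‖(y - c') + (c' - c)‖ * ‖(y - c') + (c' - c)‖ :=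
        mul_self_le_mul_self hR0.le h1
      have e2 : ‖y - c'‖ * ‖y - c'‖ ≤ R / 2 * (R / 2) := mul_self_le_mul_self (norm_nonneg _) hy
      rw [hbc] at h2
      nlinarith
    have h4 : (y - c') - (c' - c) = 0 := by
      rw [← norm_eq_zero]
      exact mul_self_eq_zero.1 (le_antisymm h3 (mul_self_nonneg _))
    rw [← hqc', sub_eq_zero, sub_left_inj] at h4
    exact h4
  -- Smaller than R/2 = ‖q - c'‖, so S omits c' and the rank-one term in the Hessian of the barrier
  -- is nonzero on S.
  set ρ := R / 4 with hρ
  have hρ0 : 0 < ρ := by positivity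
  set S := Metric.closedBall q ρ with hS
  have hSU : S ⊆ U := by
    intro y hy
    rw [hS, Metric.mem_closedBall] at hy
    apply hrU
    rw [Metric.mem_closedBall]
    have := dist_triangle y q q₀
    linarith
  have hSc : IsCompact S := isCompact_closedBall q ρ
  have hqS : q ∈ S := Metric.mem_closedBall_self hρ0.le
  have hSc' : ∀ y ∈ S, y - c' ≠ 0 := by
    intro y hy h0
    rw [hS, Metric.mem_closedBall, sub_eq_zero.1 h0, dist_comm, dist_eq_norm, hqc', hbc] at hy
    linarith
  -- ellipticity constants
  have hPcont : ∀ B : F → F →L[ℝ] F →L[ℝ] ℝ, Continuous B → ContinuousOn (fun y => P y (B y)) S := by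
    intro B hB
    exact continuousOn_linearMap_apply P (fun B => (hPc B).mono hSU) hB.continuousOn
  obtain ⟨δ, hδ0, hδ⟩ : ∃ δ > 0, ∀ y ∈ S,
      δ ≤ P y ((innerForm F (y - c')).smulRight (innerForm F (y - c'))) := by
    have hcont : Continuous fun y : F =>
        (innerForm F (y - c')).smulRight (innerForm F (y - c')) := by
      have h1 : Continuous fun y : F => innerForm F (y - c') :=
        (innerForm F).continuous.comp (continuous_id.sub continuous_const)
      exact ((ContinuousLinearMap.smulRightL ℝ F (F →L[ℝ] ℝ)).continuous.comp h1).clm_apply h1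
    obtain ⟨y₀, hy₀, hmin⟩ := hSc.exists_isMinOn ⟨q, hqS⟩ (hPcont _ hcont)
    refine ⟨_, hPpos y₀ (hSU hy₀) _ fun h0 => hSc' y₀ hy₀ ?_, fun y hy => hmin hy⟩
    have : innerForm F (y₀ - c') (y₀ - c') = 0 := by rw [h0]; rfl
    exact inner_self_eq_zero.1 this
  obtain ⟨C, hC⟩ : ∃ C, ∀ y ∈ S, P y (innerForm F) ≤ C := by
    obtain ⟨y₀, hy₀, hmax⟩ := hSc.exists_isMaxOn ⟨q, hqS⟩ (hPcont (fun _ => innerForm F)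
      continuous_const)
    exact ⟨_, fun y hy => hmax hy⟩
  -- This gives 2aδ = 2|C| + 2 > C, so the term 4a²δ beats 2aC.
  set a := (|C| + 1) / δ with ha
  have ha0 : 0 < a := by positivity
  have haC : C < 2 * a * δ := by
    rw [ha, mul_assoc, div_mul_cancel₀ _ hδ0.ne']
    have := le_abs_self C
    have := abs_nonneg C
    linarith
  set w : F → ℝ := fun y => Real.exp (-a * ‖y - c'‖ ^ 2) with hw
  have hPw : ∀ y ∈ S, 0 < P y (fderiv ℝ (fderiv ℝ w) y) := by
    intro y hy
    have e1 : ∀ (b c d : ℝ) (B B' : F →L[ℝ] F →L[ℝ] ℝ),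
        P y (b • (c • B - d • B')) = b * (c * P y B - d * P y B') := fun b c d B B' => by
      have h1 := map_sub (P y) (c • B) (d • B')
      have h2 := (P y).map_smul c B
      have h3 := (P y).map_smul d B'
      have h4 := (P y).map_smul b (c • B - d • B')
      rw [h4, h1, h2, h3]
      rfl
    rw [hw, sndDeriv_exp_neg_mul_normSq, e1]
    refine mul_pos (Real.exp_pos _) ?_
    have h1 := hδ y hy
    have h2 := hC y hy
    have h3 : 4 * a ^ 2 * δ ≤
        4 * a ^ 2 * P y ((innerForm F (y - c')).smulRight (innerForm F (y - c'))) := by gcongr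
    have h4 : 2 * a * P y (innerForm F) ≤ 2 * a * C := by gcongr
    have h5 : 2 * a * C < 2 * a * (2 * a * δ) := by gcongr
    linarith
  set w₀ := Real.exp (-a * (R / 2) ^ 2) with hw₀
  have hwq : w q = w₀ := by rw [hw, hw₀]; simp only [hqc', hbc]
  have hw1 : ∀ y, w y ≤ 1 := fun y => Real.exp_le_one_iff.2 (by
    have := mul_nonneg ha0.le (sq_nonneg ‖y - c'‖)
    linarith)
  have hw₀0 : 0 < w₀ := Real.exp_pos _
  have hwlt : ∀ y, R / 2 < ‖y - c'‖ → w y < w₀ := fun y hy => by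
    rw [hw, hw₀]
    refine Real.exp_lt_exp.2 ?_
    rw [neg_mul, neg_mul, neg_lt_neg_iff]
    gcongr
  -- The part of the sphere inside the touching ball is compact and avoids q, so u stays below A
  -- there by a fixed amount.
  obtain ⟨η, hη0, hη⟩ : ∃ η > 0, ∀ y ∈ Metric.sphere q ρ, ‖y - c'‖ ≤ R / 2 → u y ≤ A - η := by
    set T := Metric.sphere q ρ ∩ {y | ‖y - c'‖ ≤ R / 2} with hT
    have hTS : T ⊆ S := fun y hy => Metric.sphere_subset_closedBall hy.1
    have hTc : IsCompact T := (isCompact_sphere q ρ).inter_right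
      (isClosed_le (by fun_prop) continuous_const)
    rcases T.eq_empty_or_nonempty with h0 | h0
    · refine ⟨1, one_pos, fun y h1 h2 => ?_⟩
      have : y ∈ T := ⟨h1, h2⟩
      rw [h0] at this
      exact this.elim
    · obtain ⟨y₀, hy₀, hmax⟩ := hTc.exists_isMaxOn h0 (hucont.mono (hTS.trans hSU))
      have hlt : u y₀ < A := honly y₀ (hSU (hTS hy₀)) hy₀.2 fun h => by
        have := hy₀.1
        rw [h, Metric.mem_sphere, dist_self] at this
        exact hρ0.ne this
      refine ⟨A - u y₀, by linarith, fun y h1 h2 => ?_⟩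
      have : u y ≤ u y₀ := hmax (show y ∈ T from ⟨h1, h2⟩)
      linarith
  -- The barrier is normalized by f q = A. Since w - w₀ ≤ 1, the weight η/2 cannot compensate the
  -- gap η on the inner part of the sphere.
  set f : F → ℝ := fun y => u y + (η / 2) * (w y - w₀) with hf
  have hwC : ContDiff ℝ 2 w := contDiff_exp_neg_mul_normSq a c'
  have hfC : ∀ y ∈ U, ContDiffAt ℝ 2 f y := fun y hy =>
    (hu y hy).add (contDiffAt_const.mul (hwC.contDiffAt.sub contDiffAt_const))
  obtain ⟨z, hzS, hzmax⟩ := hSc.exists_isMaxOn ⟨q, hqS⟩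
    (fun y hy => (hfC y (hSU hy)).continuousAt.continuousWithinAt : ContinuousOn f S)
  have hfz : A ≤ f z := by
    have h1 : f q ≤ f z := hzmax hqS
    have h2 : f q = A := by simp [hf, hwq, hqK.2]
    linarith
  have hzball : z ∈ Metric.ball q ρ := by
    rw [Metric.mem_ball]
    refine lt_of_le_of_ne hzS fun hsph => ?_
    have hzA := hA z (hSU hzS)
    -- On the sphere f < A: inside the touching ball because u ≤ A - η, outside because w < w₀. So
    -- the maximum of f over S is interior.
    rcases le_or_gt ‖z - c'‖ (R / 2) with h1 | h1
    · have h2 := hη z hsph h1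
      have h3 := hw1 z
      simp only [hf] at hfz
      nlinarith
    · have h2 := hwlt z h1
      simp only [hf] at hfz
      nlinarith
  have hzloc : IsLocalMax f z :=
    hzmax.isLocalMax (Filter.mem_of_superset (Metric.isOpen_ball.mem_nhds hzball)
      Metric.ball_subset_closedBall)
  have hzU := hSU hzS
  have hD : fderiv ℝ (fderiv ℝ f) z
      = fderiv ℝ (fderiv ℝ u) z + (η / 2) • fderiv ℝ (fderiv ℝ w) z := by
    have h1 : fderiv ℝ f =ᶠ[𝓝 z] fun y => fderiv ℝ u y + (η / 2) • fderiv ℝ w y := by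
      filter_upwards [hU.mem_nhds hzU] with y hy
      have hu1 := ((hu y hy).differentiableAt (by norm_num)).hasFDerivAt
      have hw1 := ((hwC.contDiffAt (x := y)).differentiableAt (by norm_num)).hasFDerivAt
      exact (hu1.add ((hw1.sub_const w₀).const_mul (η / 2))).fderiv
    rw [h1.fderiv_eq]
    have hu2 := (((hu z hzU).fderiv_right (m := 1) (by norm_num)).differentiableAt
      (by norm_num)).hasFDerivAt
    have hw2 := (((hwC.contDiffAt (x := z)).fderiv_right (m := 1) (by norm_num)).differentiableAt
      (by norm_num)).hasFDerivAt
    exact (hu2.add (hw2.const_smul (η / 2))).fderiv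
  -- At the interior maximum P is nonpositive on the Hessian of f, although it is nonnegative on
  -- that of u and positive on that of w.
  have hneg := hPnonneg z hzU (-fderiv ℝ (fderiv ℝ f) z) (fun v w => by
    have := (hfC z hzU).isSymmSndFDerivAt (by simp) v w
    simp [this]) (fun v => by
    have := sndDeriv_nonpos_of_isLocalMax (hfC z hzU) hzloc v
    simpa using this)
  have e1 := map_neg (P z) (fderiv ℝ (fderiv ℝ f) z)
  have e2 := (P z).map_add (fderiv ℝ (fderiv ℝ u) z) ((η / 2) • fderiv ℝ (fderiv ℝ w) z)
  have e3 := (P z).map_smul (η / 2) (fderiv ℝ (fderiv ℝ w) z)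
  rw [e1, hD, e2, e3, smul_eq_mul] at hneg
  have h1 := hsub z hzU
  have h2 := hPw z hzS
  have h3 : 0 < η / 2 * P z (fderiv ℝ (fderiv ℝ w) z) := by positivity
  linarith

end MaximumPrinciple

/-! ### The maximum principle without an inner product. -/

section Normed

open Filter Topology

variable {E : Type*} [NormedAddCommGroup E] [NormedSpace ℝ E]

theorem sndDeriv_comp_clm {F : Type*} [NormedAddCommGroup F] [NormedSpace ℝ F]
    {u : E → ℝ} (L : F →L[ℝ] E) {z : F} (hu : ContDiffAt ℝ 2 u (L z)) (v w : F) :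
    fderiv ℝ (fderiv ℝ (u ∘ L)) z v w = fderiv ℝ (fderiv ℝ u) (L z) (L v) (L w) := by
  have h1 : ∀ᶠ x in 𝓝 z, fderiv ℝ (u ∘ L) x = (fderiv ℝ u (L x)).comp L := by
    have h : ∀ᶠ y in 𝓝 (L z), DifferentiableAt ℝ u y :=
      (hu.eventually (by simp)).mono fun y hy => hy.differentiableAt (by norm_num)
    filter_upwards [L.continuous.continuousAt.eventually h] with x hx
    exact (hx.hasFDerivAt.comp x L.hasFDerivAt).fderiv
  have h2 : DifferentiableAt ℝ (fderiv ℝ u) (L z) :=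
    (hu.fderiv_right (m := 1) (by norm_num)).differentiableAt (by norm_num)
  have h3 : HasFDerivAt (fun x => fderiv ℝ u (L x)) ((fderiv ℝ (fderiv ℝ u) (L z)).comp L) z :=
    h2.hasFDerivAt.comp z L.hasFDerivAt
  rw [Filter.EventuallyEq.fderiv_eq h1, (h3.clm_comp (hasFDerivAt_const L z)).fderiv]
  simp

/-- The strong maximum principle on a finite-dimensional normed space. -/
theorem isOpen_setOf_eq_max_of_normed [FiniteDimensional ℝ E] {U : Set E} (hU : IsOpen U)
    {u : E → ℝ} (hu : ∀ y ∈ U, ContDiffAt ℝ 2 u y) (P : E → (E →L[ℝ] E →L[ℝ] ℝ) →ₗ[ℝ] ℝ)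
    (hPc : ∀ B, ContinuousOn (fun y => P y B) U)
    (hPnonneg : ∀ y ∈ U, ∀ B : E →L[ℝ] E →L[ℝ] ℝ, (∀ v w, B v w = B w v) → (∀ v, 0 ≤ B v v) →
      0 ≤ P y B)
    (hPpos : ∀ y ∈ U, ∀ ℓ : E →L[ℝ] ℝ, ℓ ≠ 0 → 0 < P y (ℓ.smulRight ℓ))
    (hsub : ∀ y ∈ U, 0 ≤ P y (fderiv ℝ (fderiv ℝ u) y)) {A : ℝ} (hA : ∀ y ∈ U, u y ≤ A) :
    IsOpen {y | y ∈ U ∧ u y = A} := by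
  set e : E ≃L[ℝ] EuclideanSpace ℝ (Fin (Module.finrank ℝ E)) := toEuclidean with he
  set L : E →L[ℝ] EuclideanSpace ℝ (Fin (Module.finrank ℝ E)) := e.toContinuousLinearMap with hL
  -- The barrier needs a Euclidean norm; ellipticity does not depend on the norm, so the operator is
  -- transported by a linear isomorphism.
  let P' : EuclideanSpace ℝ (Fin (Module.finrank ℝ E)) →
      (EuclideanSpace ℝ (Fin (Module.finrank ℝ E)) →L[ℝ]
        EuclideanSpace ℝ (Fin (Module.finrank ℝ E)) →L[ℝ] ℝ) →ₗ[ℝ] ℝ := fun z =>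
      { toFun := fun B => P (e.symm z) (B.bilinearComp L L)
        map_add' := fun B B' => by
          have h : (B + B').bilinearComp L L = B.bilinearComp L L + B'.bilinearComp L L := by
            ext; rfl
          rw [h]
          exact (P (e.symm z)).map_add (B.bilinearComp L L) (B'.bilinearComp L L)
        map_smul' := fun c B => by
          have h : (c • B).bilinearComp L L = c • B.bilinearComp L L := by ext; rfl
          rw [h]
          exact (P (e.symm z)).map_smul c (B.bilinearComp L L) }
  have key := isOpen_setOf_eq_max (U := e.symm ⁻¹' U) (hU.preimage e.symm.continuous)
    (u := u ∘ e.symm)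
    (fun z hz => (hu _ hz).comp z e.symm.contDiff.contDiffAt)
    P'
    (fun B => (hPc _).comp e.symm.continuous.continuousOn fun z hz => hz)
    (fun z hz B h1 h2 => hPnonneg _ hz _ (fun v w => h1 _ _) (fun v => h2 _))
    (fun z hz ℓ hℓ => by
      refine lt_of_lt_of_eq (hPpos _ hz (ℓ.comp L) fun h0 => hℓ ?_) ?_
      · ext x
        have := congrArg (fun f => f (e.symm x)) h0
        simpa [hL] using this
      · refine congrArg (P (e.symm z)) ?_
        ext v w
        rfl)
    (fun z hz => by
      refine (hsub _ hz).trans_eq (congrArg (P (e.symm z)) ?_)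
      ext v w
      have := sndDeriv_comp_clm (e.symm : _ →L[ℝ] E) (z := z) (hu _ hz) (e v) (e w)
      simp only [ContinuousLinearEquiv.coe_coe, ContinuousLinearEquiv.symm_apply_apply] at this
      exact this.symm)
    (fun z hz => hA _ hz)
  have := key.preimage e.continuous
  convert! this using 1
  ext y
  simp

end Normed

/-! ### Levi forms of real bilinear forms. -/

section Levi

variable {E : Type*} [NormedAddCommGroup E] [NormedSpace ℂ E]

/-- The two-form `(v, w) ↦ (B (i v, w) - B (v, i w)) / 2` of a symmetric bilinear form `B` (the
formula is symmetrized in `B`); for `B` the second derivative of `f` this is `i ∂∂̄ f`. -/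
def leviForm (B : E →L[ℝ] E →L[ℝ] ℝ) : E [⋀^Fin 2]→ₗ[ℝ] ℂ :=
  Complex.ofRealCLM.toLinearMap.compAlternatingMap
    { toFun := fun u => (1 / 4 : ℝ) * (B (Complex.I • u 0) (u 1) + B (u 1) (Complex.I • u 0)
        - B (u 0) (Complex.I • u 1) - B (Complex.I • u 1) (u 0))
      map_update_add' := by
        intro _ u i x y
        fin_cases i <;> simp <;> ring
      map_update_smul' := by
        intro _ u i c x
        fin_cases i <;> simp [smul_comm Complex.I c] <;> ring
      map_eq_zero_of_eq' := by
        intro u i j hij hne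
        fin_cases i <;> fin_cases j <;> simp_all }

theorem leviForm_apply (B : E →L[ℝ] E →L[ℝ] ℝ) (u : Fin 2 → E) :
    leviForm B u = (((1 / 4 : ℝ) * (B (Complex.I • u 0) (u 1) + B (u 1) (Complex.I • u 0)
        - B (u 0) (Complex.I • u 1) - B (Complex.I • u 1) (u 0)) : ℝ) : ℂ) := rfl

theorem leviForm_apply_of_symm {B : E →L[ℝ] E →L[ℝ] ℝ} (hB : ∀ v w, B v w = B w v)
    (u : Fin 2 → E) : leviForm B u
      = (((1 / 2 : ℝ) * (B (Complex.I • u 0) (u 1) - B (u 0) (Complex.I • u 1)) : ℝ) : ℂ) := by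
  rw [leviForm_apply, hB (u 1), hB _ (u 0)]
  congr 1
  ring

theorem leviForm_add (B B' : E →L[ℝ] E →L[ℝ] ℝ) :
    leviForm (B + B') = leviForm B + leviForm B' := by
  ext u
  rw [AlternatingMap.add_apply, leviForm_apply, leviForm_apply, leviForm_apply,
    ← Complex.ofReal_add]
  congr 1
  simp only [_root_.add_apply]
  ring

theorem leviForm_smul (c : ℝ) (B : E →L[ℝ] E →L[ℝ] ℝ) :
    leviForm (c • B) = (c : ℂ) • leviForm B := by
  ext u
  rw [AlternatingMap.smul_apply, leviForm_apply, leviForm_apply, smul_eq_mul,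
    ← Complex.ofReal_mul]
  congr 1
  simp only [_root_.smul_apply, smul_eq_mul]
  ring

/-- The complex-linear functional with real part `ℓ`. -/
def complexify (ℓ : E →L[ℝ] ℝ) : E →ₗ[ℂ] ℂ :=
  functionalOfReal
    { toFun := fun v => (ℓ v : ℂ) - Complex.I * ℓ (Complex.I • v)
      map_add' := fun v w => by simp; ring
      map_smul' := fun c v => by simp [smul_comm Complex.I c]; ring }
    (fun v => by
      simp only [LinearMap.coe_mk, AddHom.coe_mk, smul_smul, Complex.I_mul_I, neg_one_smul,
        map_neg, Complex.ofReal_neg]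
      linear_combination (ℓ (Complex.I • v) : ℂ) * Complex.I_sq)

theorem complexify_apply (ℓ : E →L[ℝ] ℝ) (v : E) :
    complexify ℓ v = (ℓ v : ℂ) - Complex.I * ℓ (Complex.I • v) := rfl

theorem complexify_ne_zero {ℓ : E →L[ℝ] ℝ} (hℓ : ℓ ≠ 0) : complexify ℓ ≠ 0 := by
  intro h
  apply hℓ
  ext v
  have := congrArg (fun f => (f v).re) h
  simpa [complexify_apply] using this

/-- With α the complexification, ℓ = (α + ᾱ)/2 and ℓ ⊗ ℓ is the Hessian of ℓ²/2, in which only the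
mixed term αᾱ/4 survives i∂∂̄. -/
theorem leviForm_smulRight_self (ℓ : E →L[ℝ] ℝ) :
    leviForm (ℓ.smulRight ℓ) = (1 / 4 : ℂ) • elementary (complexify ℓ) := by
  ext u
  rw [leviForm_apply_of_symm fun v w => by simp [mul_comm], AlternatingMap.smul_apply,
    elementary_apply, complexify_apply, complexify_apply]
  simp only [map_sub, map_mul, Complex.conj_ofReal, Complex.conj_I, smul_eq_mul,
    ContinuousLinearMap.smulRight_apply, _root_.smul_apply]
  push_cast
  linear_combination ((1 / 2) * ((ℓ (Complex.I • u 0) : ℂ) * ℓ (u 1)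
    - ℓ (u 0) * ℓ (Complex.I • u 1))) * Complex.I_sq

/-- A positive semidefinite form is a sum of squares of functionals. -/
theorem exists_eq_sum_smulRight [FiniteDimensional ℂ E] {B : E →L[ℝ] E →L[ℝ] ℝ}
    (hB : ∀ v w, B v w = B w v) (hpos : ∀ v, 0 ≤ B v v) :
    ∃ (N : ℕ) (ℓ : Fin N → E →L[ℝ] ℝ), B = ∑ k, (ℓ k).smulRight (ℓ k) := by
  have : FiniteDimensional ℝ E := FiniteDimensional.complexToReal E
  set b := Module.finBasis ℝ E with hb
  set N := Module.finrank ℝ E with hN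
  set G : Matrix (Fin N) (Fin N) ℝ := Matrix.of fun i j => B (b i) (b j) with hG
  have hGpos : G.PosSemidef := by
    refine .of_dotProduct_mulVec_nonneg ?_ fun x => ?_
    · ext i j
      exact hB _ _
    · refine (hpos (∑ i, x i • b i)).trans_eq ?_
      simp only [map_sum, _root_.sum_apply, map_smul, _root_.smul_apply,
        dotProduct, Matrix.mulVec, Finset.mul_sum, smul_eq_mul]
      rw [Finset.sum_comm]
      refine Finset.sum_congr rfl fun i _ => Finset.sum_congr rfl fun j _ => ?_
      simp [hG]
      ring
  obtain ⟨C, hC⟩ := exists_eq_conjTranspose_mul_self hGpos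
  refine ⟨N, fun k => LinearMap.toContinuousLinearMap (b.constr ℝ (fun j => C k j)), ?_⟩
  have h1 : ∀ k j, LinearMap.toContinuousLinearMap (b.constr ℝ (fun j => C k j)) (b j) = C k j :=
    fun k j => b.constr_basis ℝ _ j
  refine ContinuousLinearMap.coe_injective (b.ext fun i => ?_)
  refine ContinuousLinearMap.coe_injective (b.ext fun j => ?_)
  have h2 : B (b i) (b j) = G i j := rfl
  change B (b i) (b j) = _
  rw [h2, hC, Matrix.mul_apply]
  simp only [ContinuousLinearMap.coe_coe, _root_.sum_apply,
    ContinuousLinearMap.smulRight_apply, _root_.smul_apply, h1]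
  rfl

/-- T has to be complex-linear, since real frames involve multiplication by i. -/
theorem pairing_compLinearMap {M M' : Type*} [AddCommGroup M] [Module ℂ M] [AddCommGroup M']
    [Module ℂ M'] {n k : ℕ} (hkn : k + 1 ≤ n) (κ : M [⋀^Fin 2]→ₗ[ℝ] ℂ)
    (Ω : M [⋀^Fin (2 * (n - (k + 1)))]→ₗ[ℝ] ℂ) (T : M' →ₗ[ℂ] M) (v : Fin n → M')
    (γ : M [⋀^Fin 2]→ₗ[ℝ] ℂ) :
    pairing hkn (κ.compLinearMap (T.restrictScalars ℝ)) (Ω.compLinearMap (T.restrictScalars ℝ)) v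
      (γ.compLinearMap (T.restrictScalars ℝ)) = pairing hkn κ Ω (T ∘ v) γ := by
  simp only [pairing, LinearMap.coe_mk, AddHom.coe_mk, wedgePow]
  rw [wedgeProd_compLinearMap, wedge_compLinearMap, wedge_compLinearMap, formCast_apply,
    formCast_apply, AlternatingMap.compLinearMap_apply]
  refine congrArg _ (funext fun i => ?_)
  simp [realFrame]

end Levi

/-! ### Calculus of second derivatives. -/

section SecondDerivatives

open Filter Topology

variable {E G G' : Type*} [NormedAddCommGroup E] [NormedSpace ℝ E] [NormedAddCommGroup G]
  [NormedSpace ℝ G] [NormedAddCommGroup G'] [NormedSpace ℝ G']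

theorem eventually_differentiableAt_of_contDiffAt {f : E → G} {y : E} (hf : ContDiffAt ℝ 2 f y) :
    ∀ᶠ z in 𝓝 y, DifferentiableAt ℝ f z :=
  (hf.eventually (by simp)).mono fun _ hz => hz.differentiableAt (by norm_num)

theorem differentiableAt_fderiv_of_contDiffAt {f : E → G} {y : E} (hf : ContDiffAt ℝ 2 f y) :
    DifferentiableAt ℝ (fderiv ℝ f) y :=
  (hf.fderiv_right (m := 1) (by norm_num)).differentiableAt (by norm_num)

theorem sndDeriv_congr {f g : E → G} {y : E} (h : f =ᶠ[𝓝 y] g) :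
    fderiv ℝ (fderiv ℝ f) y = fderiv ℝ (fderiv ℝ g) y :=
  h.fderiv.fderiv_eq

theorem sndDeriv_clm_comp (L : G →L[ℝ] G') {f : E → G} {y : E} (hf : ContDiffAt ℝ 2 f y)
    (v w : E) : fderiv ℝ (fderiv ℝ fun z => L (f z)) y v w = L (fderiv ℝ (fderiv ℝ f) y v w) := by
  have h1 : (fderiv ℝ fun z => L (f z)) =ᶠ[𝓝 y] fun z => L.comp (fderiv ℝ f z) := by
    filter_upwards [eventually_differentiableAt_of_contDiffAt hf] with z hz
    exact (L.hasFDerivAt.comp z hz.hasFDerivAt).fderiv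
  rw [h1.fderiv_eq, ((hasFDerivAt_const L y).clm_comp
    (differentiableAt_fderiv_of_contDiffAt hf).hasFDerivAt).fderiv]
  simp

theorem sndDeriv_mul {f g : E → ℂ} {y : E} (hf : ContDiffAt ℝ 2 f y) (hg : ContDiffAt ℝ 2 g y)
    (v w : E) : fderiv ℝ (fderiv ℝ fun z => f z * g z) y v w =
      f y * fderiv ℝ (fderiv ℝ g) y v w + fderiv ℝ f y v * fderiv ℝ g y w
      + fderiv ℝ f y w * fderiv ℝ g y v + g y * fderiv ℝ (fderiv ℝ f) y v w := by
  have h1 : (fderiv ℝ fun z => f z * g z) =ᶠ[𝓝 y]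
      fun z => f z • fderiv ℝ g z + g z • fderiv ℝ f z := by
    filter_upwards [eventually_differentiableAt_of_contDiffAt hf,
      eventually_differentiableAt_of_contDiffAt hg] with z hz hz'
    exact (hz.hasFDerivAt.mul hz'.hasFDerivAt).fderiv
  have hf1 := (hf.differentiableAt (by norm_num)).hasFDerivAt
  have hg1 := (hg.differentiableAt (by norm_num)).hasFDerivAt
  have hf2 := (differentiableAt_fderiv_of_contDiffAt hf).hasFDerivAt
  have hg2 := (differentiableAt_fderiv_of_contDiffAt hg).hasFDerivAt
  rw [h1.fderiv_eq]
  refine (congrArg (fun T => T v w) ((hf1.smul hg2).add (hg1.smul hf2)).fderiv).trans ?_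
  simp
  ring

theorem sndDeriv_sum {ι : Type*} (s : Finset ι) {f : ι → E → G} {y : E}
    (hf : ∀ i ∈ s, ContDiffAt ℝ 2 (f i) y) :
    fderiv ℝ (fderiv ℝ fun z => ∑ i ∈ s, f i z) y = ∑ i ∈ s, fderiv ℝ (fderiv ℝ (f i)) y := by
  have h1 : (fderiv ℝ fun z => ∑ i ∈ s, f i z) =ᶠ[𝓝 y] fun z => ∑ i ∈ s, fderiv ℝ (f i) z := by
    have := (Finset.eventually_all s).2 fun i hi =>
      eventually_differentiableAt_of_contDiffAt (hf i hi)
    filter_upwards [this] with z hz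
    exact fderiv_fun_sum hz
  rw [h1.fderiv_eq]
  exact fderiv_fun_sum fun i hi => differentiableAt_fderiv_of_contDiffAt (hf i hi)

end SecondDerivatives

/-! ### The complex Hessian and holomorphic functions. -/

section ComplexHessian

open Filter Topology

variable {E : Type*} [NormedAddCommGroup E] [NormedSpace ℂ E]

/-- The value of `i ∂∂̄ f` on the pair `(v, w)`, for complex-valued `f`. -/
def leviHessian (f : E → ℂ) (y v w : E) : ℂ :=
  (1 / 2) * (fderiv ℝ (fderiv ℝ f) y (Complex.I • v) w - fderiv ℝ (fderiv ℝ f) y v (Complex.I • w))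

theorem leviHessian_ofReal {u : E → ℝ} {y : E} (hu : ContDiffAt ℝ 2 u y) (v : Fin 2 → E) :
    leviForm (fderiv ℝ (fderiv ℝ u) y) v = leviHessian (fun z => (u z : ℂ)) y (v 0) (v 1) := by
  have h := fun a b => sndDeriv_clm_comp Complex.ofRealCLM hu a b
  simp only [Complex.ofRealCLM_apply] at h
  rw [leviForm_apply_of_symm fun a b => hu.isSymmSndFDerivAt (by simp) a b, leviHessian, h, h]
  push_cast
  ring

theorem leviHessian_congr {f g : E → ℂ} {y : E} (h : f =ᶠ[𝓝 y] g) (v w : E) :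
    leviHessian f y v w = leviHessian g y v w := by
  rw [leviHessian, leviHessian, sndDeriv_congr h]

theorem leviHessian_sum {ι : Type*} (s : Finset ι) {f : ι → E → ℂ} {y : E}
    (hf : ∀ i ∈ s, ContDiffAt ℝ 2 (f i) y) (v w : E) :
    leviHessian (fun z => ∑ i ∈ s, f i z) y v w = ∑ i ∈ s, leviHessian (f i) y v w := by
  simp only [leviHessian, sndDeriv_sum s hf, _root_.sum_apply, ← Finset.sum_sub_distrib,
    Finset.mul_sum]

theorem leviHessian_mul {f g : E → ℂ} {y : E} (hf : ContDiffAt ℝ 2 f y)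
    (hg : ContDiffAt ℝ 2 g y) (v w : E) : leviHessian (fun z => f z * g z) y v w =
      f y * leviHessian g y v w + g y * leviHessian f y v w
      + (1 / 2) * (fderiv ℝ f y (Complex.I • v) * fderiv ℝ g y w
        + fderiv ℝ f y w * fderiv ℝ g y (Complex.I • v)
        - fderiv ℝ f y v * fderiv ℝ g y (Complex.I • w)
        - fderiv ℝ f y (Complex.I • w) * fderiv ℝ g y v) := by
  rw [leviHessian, sndDeriv_mul hf hg, sndDeriv_mul hf hg, leviHessian, leviHessian]
  ring

/-- `f` is holomorphic near `y`: its real differentials are complex-linear. -/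
def HolomorphicNear (f : E → ℂ) (y : E) : Prop :=
  ∀ᶠ z in 𝓝 y, ∀ v, fderiv ℝ f z (Complex.I • v) = Complex.I * fderiv ℝ f z v

/-- Differentiate the Cauchy–Riemann equation, which holds on a whole neighbourhood, in direction v.
-/
theorem HolomorphicNear.sndDeriv {f : E → ℂ} {y : E} (hf : ContDiffAt ℝ 2 f y)
    (h : HolomorphicNear f y) (v w : E) : fderiv ℝ (fderiv ℝ f) y v (Complex.I • w)
      = Complex.I * fderiv ℝ (fderiv ℝ f) y v w := by
  have hf2 := (differentiableAt_fderiv_of_contDiffAt hf).hasFDerivAt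
  have h1 := hf2.clm_apply (hasFDerivAt_const (Complex.I • w) y)
  have h2 := (hf2.clm_apply (hasFDerivAt_const w y)).const_mul Complex.I
  have h3 : (fun z => fderiv ℝ f z (Complex.I • w)) =ᶠ[𝓝 y]
      fun z => Complex.I * fderiv ℝ f z w := h.mono fun z hz => hz w
  have := congrArg (fun T => T v) ((h2.congr_of_eventuallyEq h3).unique h1)
  simpa using this.symm

/-- The second derivative is symmetric and complex-linear in one slot, hence in both, so the two
terms of the Levi form agree. -/
theorem HolomorphicNear.leviHessian_eq_zero {f : E → ℂ} {y : E} (hf : ContDiffAt ℝ 2 f y)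
    (h : HolomorphicNear f y) (v w : E) : leviHessian f y v w = 0 := by
  have hs := hf.isSymmSndFDerivAt (by simp)
  rw [leviHessian, hs (Complex.I • v) w, h.sndDeriv hf, h.sndDeriv hf, hs w v, sub_self, mul_zero]

theorem fderiv_conj {f : E → ℂ} {y : E} (hf : DifferentiableAt ℝ f y) (v : E) :
    fderiv ℝ (fun z => starRingEnd ℂ (f z)) y v = starRingEnd ℂ (fderiv ℝ f y v) := by
  have := (Complex.conjCLE.toContinuousLinearMap.hasFDerivAt (x := f y)).comp y hf.hasFDerivAt
  exact congrArg (fun T => T v) this.fderiv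

theorem contDiffAt_conj {f : E → ℂ} {y : E} {n : WithTop ℕ∞} (hf : ContDiffAt ℝ n f y) :
    ContDiffAt ℝ n (fun z => starRingEnd ℂ (f z)) y :=
  Complex.conjCLE.contDiff.contDiffAt.comp y hf

theorem HolomorphicNear.leviHessian_conj_eq_zero {f : E → ℂ} {y : E} (hf : ContDiffAt ℝ 2 f y)
    (h : HolomorphicNear f y) (v w : E) :
    leviHessian (fun z => starRingEnd ℂ (f z)) y v w = 0 := by
  have hc : ∀ a b, fderiv ℝ (fderiv ℝ fun z => starRingEnd ℂ (f z)) y a b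
      = starRingEnd ℂ (fderiv ℝ (fderiv ℝ f) y a b) := fun a b =>
    sndDeriv_clm_comp Complex.conjCLE.toContinuousLinearMap hf a b
  have hs := hf.isSymmSndFDerivAt (by simp)
  rw [leviHessian, hc, hc, hs (Complex.I • v) w, h.sndDeriv hf, h.sndDeriv hf, hs w v, sub_self,
    mul_zero]

/-- The Levi form of `f̄ H g` for holomorphic `f` and `g`. -/
theorem leviHessian_conj_mul_mul {f H g : E → ℂ} {y : E} (hf : ContDiffAt ℝ 2 f y)
    (hH : ContDiffAt ℝ 2 H y) (hg : ContDiffAt ℝ 2 g y) (hf' : HolomorphicNear f y)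
    (hg' : HolomorphicNear g y) (v w : E) :
    leviHessian (fun z => starRingEnd ℂ (f z) * (H z * g z)) y v w =
      Complex.I * (starRingEnd ℂ (fderiv ℝ f y w)
        * (linPart (fderiv ℝ H y) v * g y + H y * fderiv ℝ g y v))
      - Complex.I * (starRingEnd ℂ (fderiv ℝ f y v)
        * (linPart (fderiv ℝ H y) w * g y + H y * fderiv ℝ g y w))
      + starRingEnd ℂ (f y) * (leviHessian H y v w * g y)
      - Complex.I * (starRingEnd ℂ (f y) * (antilinPart (fderiv ℝ H y) v * fderiv ℝ g y w))
      + Complex.I * (starRingEnd ℂ (f y) * (antilinPart (fderiv ℝ H y) w * fderiv ℝ g y v)) := by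
  have hd : ∀ {f : E → ℂ}, ContDiffAt ℝ 2 f y → DifferentiableAt ℝ f y := fun hf =>
    hf.differentiableAt (by norm_num)
  have hHg : ∀ a, fderiv ℝ (fun z => H z * g z) y a
      = H y * fderiv ℝ g y a + g y * fderiv ℝ H y a := fun a => by
    exact congrArg (fun T => T a) ((hd hH).hasFDerivAt.mul (hd hg).hasFDerivAt).fderiv
  have hfI := hf'.self_of_nhds
  have hgI := hg'.self_of_nhds
  have hanti : ∀ a, antilinPart (fderiv ℝ H y) a
      = (1 / 2) * (fderiv ℝ H y a + Complex.I * fderiv ℝ H y (Complex.I • a)) := fun a => by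
    simp [antilinPart, mulI, mul_add]
  have hlin : ∀ a, linPart (fderiv ℝ H y) a
      = (1 / 2) * (fderiv ℝ H y a - Complex.I * fderiv ℝ H y (Complex.I • a)) := fun a => by
    simp [linPart, mulI]
  rw [leviHessian_mul (contDiffAt_conj hf) (hH.mul hg), leviHessian_mul hH hg,
    hf'.leviHessian_conj_eq_zero hf, hg'.leviHessian_eq_zero hg]
  simp only [fderiv_conj (hd hf), hHg, hfI, hgI, map_mul, Complex.conj_I, hanti, hlin]
  generalize fderiv ℝ H y v = Hv
  generalize fderiv ℝ H y w = Hw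
  generalize fderiv ℝ H y (Complex.I • v) = Hiv
  generalize fderiv ℝ H y (Complex.I • w) = Hiw
  generalize starRingEnd ℂ (fderiv ℝ f y v) = fv
  generalize starRingEnd ℂ (fderiv ℝ f y w) = fw
  generalize fderiv ℝ g y v = gv
  generalize fderiv ℝ g y w = gw
  generalize starRingEnd ℂ (f y) = f0
  generalize leviHessian H y v w = LH
  linear_combination (1 / 2 : ℂ) * (fw * Hiv * g y - fv * Hiw * g y + f0 * Hiv * gw
    - f0 * Hiw * gv) * Complex.I_sq

end ComplexHessian

/-! ### The Chern curvature in terms of the Gram matrix. -/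

section Curvature

open Filter Topology

variable {E : Type*} [NormedAddCommGroup E] [NormedSpace ℂ E] {r : ℕ}

/-- The connection matrix `H⁻¹ ∂H` of a matrix-valued function `H`. -/
def connectionOfGram (H : E → Matrix (Fin r) (Fin r) ℂ) (a b : Fin r) (y : E) : E →L[ℝ] ℂ :=
  ∑ c, (H y)⁻¹ a c • linPart (fderiv ℝ (fun z => H z c b) y)

/-- The curvature matrix `dA + A ∧ A` of `A = H⁻¹ ∂H`. -/
def curvatureOfGram (H : E → Matrix (Fin r) (Fin r) ℂ) (a b : Fin r) (y : E) :
    E [⋀^Fin 2]→ₗ[ℝ] ℂ :=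
  (extDeriv (fun z => ContinuousAlternatingMap.ofSubsingleton ℝ E ℂ (0 : Fin 1)
      (connectionOfGram H a b z)) y).toAlternatingMap
    + ∑ c, wedge (oneForm (connectionOfGram H a c y : E →ₗ[ℝ] ℂ))
        (oneForm (connectionOfGram H c b y : E →ₗ[ℝ] ℂ))

theorem wedge_oneForm_apply {M : Type*} [AddCommGroup M] [Module ℂ M] (α β : M →ₗ[ℝ] ℂ)
    (u : Fin 2 → M) : wedge (oneForm α) (oneForm β) u = α (u 0) * β (u 1) - α (u 1) * β (u 0) := by
  rw [oneForm_eq_prodForm, oneForm_eq_prodForm, wedge_prodForm, prodForm_apply,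
    Matrix.det_fin_two]
  have h0 : Fin.append (fun _ : Fin 1 => α) (fun _ : Fin 1 => β) 0 = α := rfl
  have h1 : Fin.append (fun _ : Fin 1 => α) (fun _ : Fin 1 => β) 1 = β := rfl
  simp only [Matrix.of_apply, h0, h1]
  ring

theorem extDeriv_oneForm_apply {A : E → E →L[ℝ] ℂ} {y : E} (hA : DifferentiableAt ℝ A y)
    (u : Fin 2 → E) :
    extDeriv (fun z => ContinuousAlternatingMap.ofSubsingleton ℝ E ℂ (0 : Fin 1) (A z)) y u
      = fderiv ℝ (fun z => A z (u 1)) y (u 0) - fderiv ℝ (fun z => A z (u 0)) y (u 1) := by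
  have hd : DifferentiableAt ℝ
      (fun z => ContinuousAlternatingMap.ofSubsingleton ℝ E ℂ (0 : Fin 1) (A z)) y :=
    (ContinuousAlternatingMap.ofSubsingletonLIE (𝕜 := ℝ) (E := E) (F := ℂ)
      (0 : Fin 1)).differentiableAt.comp y hA
  rw [extDeriv_apply hd, Fin.sum_univ_two]
  simp [Fin.removeNth, sub_eq_add_neg]
  rfl

theorem differentiableAt_det {ι : Type*} [Fintype ι] [DecidableEq ι] {A : E → Matrix ι ι ℂ}
    {y : E} (hA : ∀ a b, DifferentiableAt ℝ (fun z => A z a b) y) :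
    DifferentiableAt ℝ (fun z => (A z).det) y := by
  simp only [Matrix.det_apply]
  refine DifferentiableAt.fun_sum fun σ _ => DifferentiableAt.const_smul ?_ _
  have := (HasFDerivAt.finsetProd (u := Finset.univ)
    fun i _ => (hA (σ i) i).hasFDerivAt).differentiableAt
  simpa [Finset.prod_fn] using this

/-- Cramer's rule: the entries are minors divided by the determinant. -/
theorem differentiableAt_inv_apply {ι : Type*} [Fintype ι] [DecidableEq ι] {A : E → Matrix ι ι ℂ}
    {y : E} (hA : ∀ a b, DifferentiableAt ℝ (fun z => A z a b) y) (hdet : IsUnit (A y).det)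
    (a b : ι) : DifferentiableAt ℝ (fun z => (A z)⁻¹ a b) y := by
  simp only [Matrix.inv_def, Matrix.smul_apply, Ring.inverse_eq_inv', smul_eq_mul,
    Matrix.adjugate_apply]
  refine (DifferentiableAt.fun_inv (differentiableAt_det hA) hdet.ne_zero).mul
    (differentiableAt_det fun i j => ?_)
  by_cases hi : i = b
  · subst hi
    simp only [Matrix.updateRow_self]
    exact differentiableAt_const _
  · simp only [Matrix.updateRow_ne hi]
    exact hA i j

theorem linPart_sndDeriv {f : E → ℂ} {y : E} (hf : ContDiffAt ℝ 2 f y) (v w : E) :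
    fderiv ℝ (fun z => linPart (fderiv ℝ f z) w) y v = (1 / 2) *
      (fderiv ℝ (fderiv ℝ f) y v w - Complex.I * fderiv ℝ (fderiv ℝ f) y v (Complex.I • w)) := by
  have hf2 := (differentiableAt_fderiv_of_contDiffAt hf).hasFDerivAt
  have h1 := hf2.clm_apply (hasFDerivAt_const w y)
  have h2 := (hf2.clm_apply (hasFDerivAt_const (Complex.I • w) y)).const_mul Complex.I
  simp only [linPart_apply, smul_eq_mul]
  refine (congrArg (fun T => T v) ((h1.sub h2).const_mul (1 / 2 : ℂ)).fderiv).trans ?_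
  simp

theorem differentiableAt_linPart {F : E → E →L[ℝ] ℂ} {y : E} (hF : DifferentiableAt ℝ F y) :
    DifferentiableAt ℝ (fun z => linPart (F z)) y := by
  have h1 : DifferentiableAt ℝ (fun z => (F z).comp (mulI E)) y :=
    hF.clm_comp (differentiableAt_const _)
  have h2 : DifferentiableAt ℝ (fun z => Complex.I • (F z).comp (mulI E)) y :=
    h1.const_smul Complex.I
  exact (hF.sub h2).const_smul (1 / 2 : ℂ)

theorem differentiableAt_connectionOfGram {H : E → Matrix (Fin r) (Fin r) ℂ} {y : E}
    (hH : ∀ a b, ContDiffAt ℝ 2 (fun z => H z a b) y) (hdet : IsUnit (H y).det) (a b : Fin r) :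
    DifferentiableAt ℝ (connectionOfGram H a b) y := by
  unfold connectionOfGram
  refine DifferentiableAt.fun_sum fun c _ => ?_
  exact (differentiableAt_inv_apply (fun a b => (hH a b).differentiableAt (by norm_num)) hdet
    a c).smul (differentiableAt_linPart (differentiableAt_fderiv_of_contDiffAt (hH c b)))

theorem gram_mul_connection {H : E → Matrix (Fin r) (Fin r) ℂ} {y : E} (hdet : IsUnit (H y).det)
    (w : E) : H y * (Matrix.of fun a b => connectionOfGram H a b y w)
      = Matrix.of fun a b => linPart (fderiv ℝ (fun z => H z a b) y) w := by
  have : (Matrix.of fun a b => connectionOfGram H a b y w)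
      = (H y)⁻¹ * Matrix.of fun a b => linPart (fderiv ℝ (fun z => H z a b) y) w := by
    ext a b
    simp [connectionOfGram, Matrix.mul_apply]
  rw [this, Matrix.mul_nonsing_inv_cancel_left _ _ hdet]

theorem linPart_add_antilinPart {W : Type*} [NormedAddCommGroup W] [NormedSpace ℂ W]
    (L : E →L[ℝ] W) (v : E) : linPart L v + antilinPart L v = L v := by
  have h : linPart L + antilinPart L = L := by
    unfold linPart antilinPart
    rw [← smul_add, sub_add_add_cancel, ← two_smul ℂ, smul_smul]
    norm_num
  exact congrArg (fun T => T v) h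

/-- `H Θ = i (i ∂∂̄ H) - ∂̄H ∧ A`. -/
theorem gram_mul_curvature {H : E → Matrix (Fin r) (Fin r) ℂ} {y : E}
    (hH : ∀ a b, ContDiffAt ℝ 2 (fun z => H z a b) y) (hdet : IsUnit (H y).det) (u : Fin 2 → E) :
    H y * (Matrix.of fun a b => curvatureOfGram H a b y u)
      = Complex.I • (Matrix.of fun a b => leviHessian (fun z => H z a b) y (u 0) (u 1))
        - (Matrix.of fun a b => antilinPart (fderiv ℝ (fun z => H z a b) y) (u 0))
          * (Matrix.of fun a b => connectionOfGram H a b y (u 1))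
        + (Matrix.of fun a b => antilinPart (fderiv ℝ (fun z => H z a b) y) (u 1))
          * (Matrix.of fun a b => connectionOfGram H a b y (u 0)) := by
  set A : E → Matrix (Fin r) (Fin r) ℂ := fun w => Matrix.of fun a b => connectionOfGram H a b y w
    with hA
  have hdH : ∀ a b, DifferentiableAt ℝ (fun z => H z a b) y :=
    fun a b => (hH a b).differentiableAt (by norm_num)
  have hdA : ∀ a b, DifferentiableAt ℝ (connectionOfGram H a b) y :=
    differentiableAt_connectionOfGram hH hdet
  have hdet' : ∀ᶠ z in 𝓝 y, IsUnit (H z).det :=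
    ((differentiableAt_det hdH).continuousAt.eventually_ne hdet.ne_zero).mono
      fun z hz => hz.isUnit
  -- differentiate `H A = ∂H`
  have hD : ∀ v w a b, ∑ c, H y a c * fderiv ℝ (fun z => connectionOfGram H c b z w) y v
      = (1 / 2) * (fderiv ℝ (fderiv ℝ fun z => H z a b) y v w
        - Complex.I * fderiv ℝ (fderiv ℝ fun z => H z a b) y v (Complex.I • w))
        - ∑ c, fderiv ℝ (fun z => H z a c) y v * connectionOfGram H c b y w := by
    intro v w a b
    have h1 : (fun z => ∑ c, H z a c * connectionOfGram H c b z w) =ᶠ[𝓝 y]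
        fun z => linPart (fderiv ℝ (fun z => H z a b) z) w := by
      filter_upwards [hdet'] with z hz
      have := congrFun (congrFun (gram_mul_connection hz w) a) b
      rwa [Matrix.mul_apply] at this
    have h2 : HasFDerivAt (fun z => ∑ c, H z a c * connectionOfGram H c b z w)
        (∑ c, (H y a c • fderiv ℝ (fun z => connectionOfGram H c b z w) y
          + connectionOfGram H c b y w • fderiv ℝ (fun z => H z a c) y)) y := by
      refine HasFDerivAt.fun_sum fun c _ => ?_
      exact (hdH a c).hasFDerivAt.mul
        ((hdA c b).clm_apply (differentiableAt_const w)).hasFDerivAt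
    have h3 := congrArg (fun T => T v) (h1.fderiv_eq.symm.trans h2.fderiv)
    rw [linPart_sndDeriv (hH a b)] at h3
    rw [h3]
    simp [Finset.sum_add_distrib, mul_comm]
  ext a b
  have hcurv : ∀ c, curvatureOfGram H c b y u
      = fderiv ℝ (fun z => connectionOfGram H c b z (u 1)) y (u 0)
        - fderiv ℝ (fun z => connectionOfGram H c b z (u 0)) y (u 1)
        + (A (u 0) * A (u 1) - A (u 1) * A (u 0)) c b := by
    intro c
    rw [curvatureOfGram, AlternatingMap.add_apply, alternatingMap_sum_apply]
    congr 1
    · exact extDeriv_oneForm_apply (hdA c b) u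
    · simp only [wedge_oneForm_apply, Matrix.sub_apply, Matrix.mul_apply, hA, Matrix.of_apply,
        Finset.sum_sub_distrib, ContinuousLinearMap.coe_coe]
  -- H (A ∧ A) = ∂H ∧ A cancels the ∂H half of the term dH ∧ A coming from the derivative of HA =
  -- ∂H; only ∂̄H ∧ A remains.
  have hAA : ∀ v w, ∑ c, H y a c * (A v * A w) c b
      = ∑ c, linPart (fderiv ℝ (fun z => H z a c) y) v * connectionOfGram H c b y w := by
    intro v w
    have : H y * (A v * A w)
        = (Matrix.of fun a b => linPart (fderiv ℝ (fun z => H z a b) y) v) * A w := by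
      rw [← Matrix.mul_assoc, hA, gram_mul_connection hdet]
    exact congrFun (congrFun this a) b
  have hs := (hH a b).isSymmSndFDerivAt (by simp)
  have hsplit : ∀ v w, ∑ c, fderiv ℝ (fun z => H z a c) y v * connectionOfGram H c b y w
      = ∑ c, linPart (fderiv ℝ (fun z => H z a c) y) v * connectionOfGram H c b y w
      + ∑ c, antilinPart (fderiv ℝ (fun z => H z a c) y) v * connectionOfGram H c b y w := by
    intro v w
    simp only [← Finset.sum_add_distrib, ← add_mul, linPart_add_antilinPart]
  rw [Matrix.mul_apply]
  simp only [Matrix.of_apply, hcurv, mul_add, mul_sub, Finset.sum_add_distrib,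
    Finset.sum_sub_distrib, Matrix.sub_apply, hAA, hD, hsplit, Matrix.add_apply, Matrix.smul_apply,
    smul_eq_mul, leviHessian]
  simp only [Matrix.mul_apply, Matrix.of_apply]
  rw [hs (u 1) (u 0), hs (u 1) (Complex.I • u 0)]
  ring

end Curvature

/-! ### The Bochner formula. -/

section Bochner

open Filter Topology

variable {E : Type*} [NormedAddCommGroup E] [NormedSpace ℂ E] {r : ℕ}

/-- The algebraic core of the Bochner formula. P and P' stand for ∂H on two vectors, their adjoints
for ∂̄H, and d, d' for the derivatives of the components S. Substituting P = HA and Pᴴ = AᴴH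
completes the square in d + AS. -/
theorem bochner_matrix_identity {H A A' P P' L Θ : Matrix (Fin r) (Fin r) ℂ} (hH : Hᴴ = H)
    (hA : H * A = P) (hA' : H * A' = P')
    (hΘ : H * Θ = Complex.I • L - Pᴴ * A' + P'ᴴ * A) (S d d' : Fin r → ℂ) :
    Complex.I * (star d' ⬝ᵥ (P *ᵥ S + H *ᵥ d)) - Complex.I * (star d ⬝ᵥ (P' *ᵥ S + H *ᵥ d'))
      + star S ⬝ᵥ (L *ᵥ S) - Complex.I * (star S ⬝ᵥ (Pᴴ *ᵥ d'))
      + Complex.I * (star S ⬝ᵥ (P'ᴴ *ᵥ d))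
    = Complex.I * (star (d' + A' *ᵥ S) ⬝ᵥ (H *ᵥ (d + A *ᵥ S))
        - star (d + A *ᵥ S) ⬝ᵥ (H *ᵥ (d' + A' *ᵥ S)))
      - Complex.I * (star S ⬝ᵥ ((H * Θ) *ᵥ S)) := by
  have hP : Pᴴ = Aᴴ * H := by rw [← hA, Matrix.conjTranspose_mul, hH]
  have hP' : P'ᴴ = A'ᴴ * H := by rw [← hA', Matrix.conjTranspose_mul, hH]
  rw [hΘ, hP, hP', ← hA, ← hA']
  have e : ∀ (B : Matrix (Fin r) (Fin r) ℂ) (x y : Fin r → ℂ),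
      star (B *ᵥ x) ⬝ᵥ y = star x ⬝ᵥ (Bᴴ *ᵥ y) := fun B x y => by
    rw [Matrix.star_mulVec, Matrix.dotProduct_mulVec]
  simp only [star_add, add_dotProduct, dotProduct_add, Matrix.mulVec_add, Matrix.add_mulVec,
    Matrix.sub_mulVec, dotProduct_sub, e, Matrix.smul_mulVec, dotProduct_smul,
    ← Matrix.mulVec_mulVec, smul_eq_mul]
  linear_combination (star S ⬝ᵥ (L *ᵥ S)) * Complex.I_sq

/-- The complex-linear part of a real-linear map is `i`-homogeneous. -/
theorem linPart_smul_I {W : Type*} [NormedAddCommGroup W] [NormedSpace ℂ W] (L : E →L[ℝ] W)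
    (v : E) : linPart L (Complex.I • v) = Complex.I • linPart L v := by
  rw [linPart_apply, linPart_apply, smul_smul, Complex.I_mul_I, neg_one_smul, map_neg,
    smul_comm Complex.I (1 / 2 : ℂ), smul_sub Complex.I, smul_smul Complex.I Complex.I,
    Complex.I_mul_I, neg_one_smul, smul_neg, sub_neg_eq_add, sub_neg_eq_add, add_comm]

theorem connectionOfGram_smul_I (H : E → Matrix (Fin r) (Fin r) ℂ) (a b : Fin r) (y v : E) :
    connectionOfGram H a b y (Complex.I • v) = Complex.I * connectionOfGram H a b y v := by
  simp only [connectionOfGram, _root_.sum_apply, _root_.smul_apply, linPart_smul_I, smul_eq_mul,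
    Finset.mul_sum]
  exact Finset.sum_congr rfl fun c _ => by ring

/-- The components `ds_a + Σ_b A_{ab} s_b` of the covariant derivative. -/
def covariantOfGram (H : E → Matrix (Fin r) (Fin r) ℂ) (s : Fin r → E → ℂ) (y : E) (a : Fin r) :
    E →L[ℝ] ℂ :=
  fderiv ℝ (s a) y + ∑ b, s b y • connectionOfGram H a b y

/-- The Bochner formula `i ∂∂̄ |s|² = i ⟨Ds, Ds⟩ - ⟨i Θ s, s⟩`. -/
theorem bochner {H : E → Matrix (Fin r) (Fin r) ℂ} {s : Fin r → E → ℂ} {u : E → ℝ} {y : E}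
    (hH : ∀ a b, ContDiffAt ℝ 2 (fun z => H z a b) y) (hdet : IsUnit (H y).det)
    (hherm : ∀ z, (H z)ᴴ = H z) (hs : ∀ a, ContDiffAt ℝ 2 (s a) y)
    (hs' : ∀ a, HolomorphicNear (s a) y) (hu : ContDiffAt ℝ 2 u y)
    (hus : ∀ᶠ z in 𝓝 y, (u z : ℂ) = ∑ a, ∑ b, starRingEnd ℂ (s a z) * (H z a b * s b z))
    (v : Fin 2 → E) :
    leviForm (fderiv ℝ (fderiv ℝ u) y) v =
      Complex.I * (star (fun a => covariantOfGram H s y a (v 1)) ⬝ᵥ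
          (H y *ᵥ fun a => covariantOfGram H s y a (v 0))
        - star (fun a => covariantOfGram H s y a (v 0)) ⬝ᵥ
          (H y *ᵥ fun a => covariantOfGram H s y a (v 1)))
      - Complex.I * (star (fun a => s a y) ⬝ᵥ
          ((H y * Matrix.of fun a b => curvatureOfGram H a b y v) *ᵥ fun a => s a y)) := by
  have hd : ∀ {f : E → ℂ}, ContDiffAt ℝ 2 f y → DifferentiableAt ℝ f y := fun hf =>
    hf.differentiableAt (by norm_num)
  set P : E → Matrix (Fin r) (Fin r) ℂ :=
    fun w => Matrix.of fun a b => linPart (fderiv ℝ (fun z => H z a b) y) w with hP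
  -- Since H is Hermitian near y, ∂̄H is the conjugate transpose of ∂H.
  have hanti : ∀ w, (Matrix.of fun a b => antilinPart (fderiv ℝ (fun z => H z a b) y) w)
      = (P w)ᴴ := by
    intro w
    ext a b
    have h1 : ∀ x, fderiv ℝ (fun z => H z a b) y x
        = starRingEnd ℂ (fderiv ℝ (fun z => H z b a) y x) := fun x => by
      rw [← fderiv_conj (hd (hH b a))]
      congr 2
      funext z
      exact (congrFun (congrFun (hherm z) a) b).symm
    simp only [Matrix.of_apply, Matrix.conjTranspose_apply, hP, linPart_apply, smul_eq_mul,
      Complex.star_def, map_mul, map_sub, Complex.conj_I, ← h1, map_div₀, map_one, map_ofNat]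
    simp [antilinPart, mulI, mul_add]
  have hcov : ∀ w, (fun a => covariantOfGram H s y a w) = (fun a => fderiv ℝ (s a) y w)
      + (Matrix.of fun a b => connectionOfGram H a b y w) *ᵥ fun a => s a y := by
    intro w
    funext a
    simp [covariantOfGram, Matrix.mulVec, dotProduct, mul_comm]
  have hΘ := gram_mul_curvature hH hdet v
  rw [hanti, hanti] at hΘ
  have key := bochner_matrix_identity (hherm y) (gram_mul_connection hdet (v 0))
    (gram_mul_connection hdet (v 1)) hΘ (fun a => s a y) (fun a => fderiv ℝ (s a) y (v 0))
    (fun a => fderiv ℝ (s a) y (v 1))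
  rw [hcov, hcov, ← key, leviHessian_ofReal hu, leviHessian_congr hus]
  have hterm : ∀ a b, ContDiffAt ℝ 2 (fun z => starRingEnd ℂ (s a z) * (H z a b * s b z)) y :=
    fun a b => (contDiffAt_conj (hs a)).mul ((hH a b).mul (hs b))
  rw [leviHessian_sum _ fun a _ => ContDiffAt.sum fun b _ => hterm a b]
  simp only [leviHessian_sum _ fun b _ => hterm _ b,
    leviHessian_conj_mul_mul (hs _) (hH _ _) (hs _) (hs' _) (hs' _)]
  rw [← hanti, ← hanti]
  simp only [dotProduct, Matrix.mulVec, Matrix.of_apply, Pi.star_apply, Pi.add_apply,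
    Complex.star_def, Finset.mul_sum, ← Finset.sum_add_distrib, ← Finset.sum_sub_distrib]

end Bochner

/-! ### Naturality of the Levi form. -/

section HolomorphicChange

open Filter Topology

variable {E E' : Type*} [NormedAddCommGroup E] [NormedSpace ℂ E] [NormedAddCommGroup E']
  [NormedSpace ℂ E']

theorem fderiv_real_eq_restrictScalars {f : E → E'} {y : E} (hf : DifferentiableAt ℂ f y) :
    fderiv ℝ f y = (fderiv ℂ f y).restrictScalars ℝ :=
  (hf.hasFDerivAt.restrictScalars ℝ).fderiv

/-- The Levi form is natural under holomorphic maps. -/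
theorem leviForm_comp {f : E' → ℝ} {ψ : E → E'} {y : E} (hf : ContDiffAt ℝ 2 f (ψ y))
    (hψ : ContDiffAt ℂ 2 ψ y) :
    leviForm (fderiv ℝ (fderiv ℝ (f ∘ ψ)) y) = (leviForm (fderiv ℝ (fderiv ℝ f) (ψ y))).compLinearMap
      ((fderiv ℂ ψ y).restrictScalars ℝ).toLinearMap := by
  have hψd : ∀ᶠ z in 𝓝 y, DifferentiableAt ℂ ψ z :=
    (hψ.eventually (by simp)).mono fun _ hz => hz.differentiableAt (by norm_num)
  have hψr : ContDiffAt ℝ 2 ψ y := hψ.restrict_scalars ℝ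
  have hψ2 := (differentiableAt_fderiv_of_contDiffAt hψr).hasFDerivAt
  have hf2 := (differentiableAt_fderiv_of_contDiffAt hf).hasFDerivAt
  have h1 : fderiv ℝ (f ∘ ψ) =ᶠ[𝓝 y] fun z => (fderiv ℝ f (ψ z)).comp (fderiv ℝ ψ z) := by
    filter_upwards [hψd, hψr.continuousAt.eventually
      (eventually_differentiableAt_of_contDiffAt hf)] with z hz hz'
    exact (hz'.hasFDerivAt.comp z (hz.restrictScalars ℝ).hasFDerivAt).fderiv
  -- The second term obstructs naturality of the Hessian. It drops out of the Levi form because the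
  -- second derivative of a holomorphic map is complex-bilinear.
  have h2 : ∀ v w, fderiv ℝ (fderiv ℝ (f ∘ ψ)) y v w
      = fderiv ℝ (fderiv ℝ f) (ψ y) (fderiv ℂ ψ y v) (fderiv ℂ ψ y w)
        + fderiv ℝ f (ψ y) (fderiv ℝ (fderiv ℝ ψ) y v w) := by
    intro v w
    rw [h1.fderiv_eq]
    refine (congrArg (fun T => T v w) ((hf2.comp y
      (hψr.differentiableAt (by norm_num)).hasFDerivAt).clm_comp hψ2).fderiv).trans ?_
    simp [fderiv_real_eq_restrictScalars hψd.self_of_nhds, add_comm]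
  have h3 : ∀ v w, fderiv ℝ (fderiv ℝ ψ) y v (Complex.I • w)
      = Complex.I • fderiv ℝ (fderiv ℝ ψ) y v w := by
    intro v w
    have e1 := hψ2.clm_apply (hasFDerivAt_const (Complex.I • w) y)
    have e2 := (hψ2.clm_apply (hasFDerivAt_const w y)).const_smul Complex.I
    have e3 : (fun z => fderiv ℝ ψ z (Complex.I • w)) =ᶠ[𝓝 y]
        Complex.I • fun z => fderiv ℝ ψ z w := by
      filter_upwards [hψd] with z hz
      simp [fderiv_real_eq_restrictScalars hz]
    have := congrArg (fun T => T v) ((e2.congr_of_eventuallyEq e3).unique e1)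
    simpa using this.symm
  have hs := hψr.isSymmSndFDerivAt (by simp)
  have h4 : ∀ v w, fderiv ℝ (fderiv ℝ ψ) y (Complex.I • v) w
      = Complex.I • fderiv ℝ (fderiv ℝ ψ) y v w := fun v w => by
    rw [hs, h3, hs w v]
  ext u
  rw [AlternatingMap.compLinearMap_apply, leviForm_apply, leviForm_apply]
  simp only [h2, h3, h4, hs (u 1) (u 0)]
  simp only [ContinuousLinearMap.coe_coe, ContinuousLinearMap.coe_restrictScalars', map_smul]
  congr 1
  ring

end HolomorphicChange

/-! ### Ellipticity on real bilinear forms. -/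

section PairingPositivity

variable {E : Type*} [NormedAddCommGroup E] [NormedSpace ℂ E]

theorem leviForm_sum {ι : Type*} (s : Finset ι) (B : ι → E →L[ℝ] E →L[ℝ] ℝ) :
    leviForm (∑ i ∈ s, B i) = ∑ i ∈ s, leviForm (B i) := by
  induction s using Finset.cons_induction with
  | empty =>
    ext u
    simp [leviForm_apply]
  | cons a s ha ih => rw [Finset.sum_cons, Finset.sum_cons, leviForm_add, ih]

/-- The pairing with a Levi form as a real-linear functional on bilinear forms. -/
def leviPairing {n k : ℕ} (hkn : k + 1 ≤ n) (κ : E [⋀^Fin 2]→ₗ[ℝ] ℂ)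
    (Ω : E [⋀^Fin (2 * (n - (k + 1)))]→ₗ[ℝ] ℂ) (v : Fin n → E) :
    (E →L[ℝ] E →L[ℝ] ℝ) →ₗ[ℝ] ℝ where
  toFun B := (pairing hkn κ Ω v (leviForm B)).re
  map_add' B B' := by rw [leviForm_add, map_add, Complex.add_re]
  map_smul' c B := by
    rw [leviForm_smul, map_smul, smul_eq_mul, Complex.re_ofReal_mul]; rfl

variable {n k : ℕ} {hkn : k + 1 ≤ n} {κ : E [⋀^Fin 2]→ₗ[ℝ] ℂ}
  {Ω : E [⋀^Fin (2 * (n - (k + 1)))]→ₗ[ℝ] ℂ} {v : Fin n → E}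

/-- Positivity of the principal symbol on a nonzero real covector, deduced from positivity on its
complexification. -/
theorem leviPairing_smulRight_pos
    (h : ∀ α : E →ₗ[ℂ] ℂ, α ≠ 0 → 0 < (pairing hkn κ Ω v (elementary α)).re)
    {ℓ : E →L[ℝ] ℝ} (hℓ : ℓ ≠ 0) : 0 < leviPairing hkn κ Ω v (ℓ.smulRight ℓ) := by
  change 0 < (pairing hkn κ Ω v (leviForm (ℓ.smulRight ℓ))).re
  rw [leviForm_smulRight_self, map_smul, smul_eq_mul,
    show (1 / 4 : ℂ) = ((1 / 4 : ℝ) : ℂ) by push_cast; rfl, Complex.re_ofReal_mul]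
  have := h _ (complexify_ne_zero hℓ)
  positivity

/-- A semidefinite form is a sum of squares of functionals, and each square contributes zero or a
positive number. -/
theorem leviPairing_nonneg [FiniteDimensional ℂ E]
    (h : ∀ α : E →ₗ[ℂ] ℂ, α ≠ 0 → 0 < (pairing hkn κ Ω v (elementary α)).re)
    {B : E →L[ℝ] E →L[ℝ] ℝ} (hB : ∀ v w, B v w = B w v) (hpos : ∀ v, 0 ≤ B v v) :
    0 ≤ leviPairing hkn κ Ω v B := by
  obtain ⟨N, ℓ, rfl⟩ := exists_eq_sum_smulRight hB hpos
  change 0 ≤ (pairing hkn κ Ω v (leviForm _)).re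
  rw [leviForm_sum, map_sum, Complex.re_sum]
  refine Finset.sum_nonneg fun i _ => ?_
  by_cases hi : ℓ i = 0
  · have h0 : leviForm ((ℓ i).smulRight (ℓ i)) = 0 := by
      ext u
      simp [leviForm_apply, hi]
    rw [h0, map_zero, Complex.zero_re]
  · exact (leviPairing_smulRight_pos h hi).le

end PairingPositivity

/-! ### Continuous dependence of the pairing on the forms. -/

section Continuity

variable {M : Type*} [AddCommGroup M] [Module ℂ M] {Y : Type*} [TopologicalSpace Y] {S : Set Y}

theorem continuousOn_wedge {k l : ℕ} {α : Y → M [⋀^Fin k]→ₗ[ℝ] ℂ} {β : Y → M [⋀^Fin l]→ₗ[ℝ] ℂ}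
    (hα : ∀ u, ContinuousOn (fun y => α y u) S) (hβ : ∀ u, ContinuousOn (fun y => β y u) S)
    (u : Fin (k + l) → M) : ContinuousOn (fun y => wedge (α y) (β y) u) S := by
  simp only [wedge_apply]
  have hσ : ∀ σ : Equiv.Perm (Fin (k + l)), ContinuousOn (fun y => (Equiv.Perm.sign σ : ℤ) •
      (β y (fun j => u (σ (Fin.natAdd k j))) • α y (fun i => u (σ (Fin.castAdd l i))))) S :=
    fun σ => ((hβ _).mul (hα _)).const_smul (Equiv.Perm.sign σ : ℤ)
  have hsum := continuousOn_finsetSum Finset.univ fun σ _ => hσ σ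
  exact hsum.const_smul ((k.factorial * l.factorial : ℕ) : ℂ)⁻¹

theorem continuousOn_wedgePow {κ : Y → M [⋀^Fin 2]→ₗ[ℝ] ℂ}
    (hκ : ∀ u, ContinuousOn (fun y => κ y u) S) :
    ∀ (j : ℕ) (u : Fin (2 * j) → M), ContinuousOn (fun y => wedgePow (κ y) j u) S
  | 0, _ => continuousOn_const
  | j + 1, u => continuousOn_wedge (α := fun y => wedgePow (κ y) j)
      (continuousOn_wedgePow hκ j) hκ u

theorem continuousOn_pairing {n k : ℕ} (hkn : k + 1 ≤ n) {κ : Y → M [⋀^Fin 2]→ₗ[ℝ] ℂ}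
    {Ω : Y → M [⋀^Fin (2 * (n - (k + 1)))]→ₗ[ℝ] ℂ}
    (hκ : ∀ u, ContinuousOn (fun y => κ y u) S) (hΩ : ∀ u, ContinuousOn (fun y => Ω y u) S)
    (v : Fin n → M) (γ : M [⋀^Fin 2]→ₗ[ℝ] ℂ) :
    ContinuousOn (fun y => pairing hkn (κ y) (Ω y) v γ) S :=
  continuousOn_wedge (α := fun y => wedge γ (wedgePow (κ y) k))
    (continuousOn_wedge (α := fun _ => γ) (fun _ => continuousOn_const)
      (continuousOn_wedgePow hκ k)) hΩ _

end Continuity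

/-! ### Metric and sections in the preferred frame, near its centre. -/

section Frame

open Filter Topology

variable {E : Type*} [NormedAddCommGroup E] [NormedSpace ℂ E]
variable {X : Type*} [TopologicalSpace X] [ChartedSpace E X]
variable {r : ℕ} {V : X → Type*} [∀ x, AddCommGroup (V x)] [∀ x, Module ℂ (V x)]
  [∀ x, TopologicalSpace (V x)] [TopologicalSpace (TotalSpace (Fin r → ℂ) V)]
  [FiberBundle (Fin r → ℂ) V] [VectorBundle ℂ (Fin r → ℂ) V]

/-- The coordinate expression of a map to a normed space in the preferred chart. -/
theorem contDiffAt_comp_chart_symm {𝕜 : Type*} [NontriviallyNormedField 𝕜] [NormedSpace 𝕜 E]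
    {F : Type*} [NormedAddCommGroup F] [NormedSpace 𝕜 F] {k : WithTop ℕ∞} {f : X → F} {p : X}
    (hf : ContMDiffAt 𝓘(𝕜, E) 𝓘(𝕜, F) k f p) :
    ContDiffAt 𝕜 k (fun z => f ((chartAt E p).symm z)) (chartAt E p p) := by
  have := (contMDiffAt_iff.1 hf).2
  simpa [contDiffWithinAt_univ, Function.comp_def, chartAt_self_eq] using this

theorem symm_eq_sum_frame (e : Trivialization (Fin r → ℂ) (π (Fin r → ℂ) V))
    [MemTrivializationAtlas e] {q : X} (hq : q ∈ e.baseSet) (c : Fin r → ℂ) :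
    e.symm q c = ∑ a, c a • frame e a q := by
  have hc : c = ∑ a, c a • (Pi.single a 1 : Fin r → ℂ) := by
    ext i
    simp [Finset.sum_apply, Pi.single_apply]
  rw [← e.coe_symmₗ (R := ℂ) hq]
  conv_lhs => rw [hc]
  rw [map_sum]
  refine Finset.sum_congr rfl fun a _ => ?_
  rw [map_smul, e.coe_symmₗ (R := ℂ) hq, frame]

theorem form_symm_symm (h : HermitianMetric E r V)
    (e : Trivialization (Fin r → ℂ) (π (Fin r → ℂ) V))
    [MemTrivializationAtlas e] {q : X} (hq : q ∈ e.baseSet) (c d : Fin r → ℂ) :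
    h.form q (e.symm q c) (e.symm q d)
      = ∑ a, ∑ b, starRingEnd ℂ (c a) * (h.form q (frame e a q) (frame e b q) * d b) := by
  rw [symm_eq_sum_frame e hq c, symm_eq_sum_frame e hq d]
  simp only [map_sum, LinearMap.map_smulₛₗ, LinearMap.sum_apply, LinearMap.smul_apply, map_smul,
    smul_eq_mul, Finset.mul_sum]
  rw [Finset.sum_comm]
  exact Finset.sum_congr rfl fun a _ => Finset.sum_congr rfl fun b _ => by ring

theorem gram_conjTranspose (h : HermitianMetric E r V) (φ : OpenPartialHomeomorph X E)
    (e : Trivialization (Fin r → ℂ) (π (Fin r → ℂ) V)) (y : E) :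
    (gram h φ e y)ᴴ = gram h φ e y := by
  ext a b
  exact h.conj_symm _ _ _

theorem star_dotProduct_mulVec {ι : Type*} [Fintype ι] (G : Matrix ι ι ℂ) (c d : ι → ℂ) :
    star c ⬝ᵥ (G *ᵥ d) = ∑ a, ∑ b, starRingEnd ℂ (c a) * (G a b * d b) := by
  simp [dotProduct, Matrix.mulVec, Finset.mul_sum]

open scoped ComplexOrder in
theorem gram_posDef (h : HermitianMetric E r V) (φ : OpenPartialHomeomorph X E)
    (e : Trivialization (Fin r → ℂ) (π (Fin r → ℂ) V)) [MemTrivializationAtlas e] {y : E}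
    (hy : φ.symm y ∈ e.baseSet) : (gram h φ e y).PosDef := by
  refine .of_dotProduct_mulVec_pos (gram_conjTranspose h φ e y) fun c hc => ?_
  have h1 : star c ⬝ᵥ (gram h φ e y *ᵥ c)
      = h.form (φ.symm y) (e.symm (φ.symm y) c) (e.symm (φ.symm y) c) := by
    rw [star_dotProduct_mulVec, form_symm_symm h e hy]; rfl
  have h2 : e.symm (φ.symm y) c ≠ 0 := by
    intro h0
    refine hc ?_
    have := e.linearMapAt_symmₗ (R := ℂ) hy c
    rw [e.coe_symmₗ (R := ℂ) hy, h0, map_zero] at this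
    exact this.symm
  rw [h1, Complex.pos_iff]
  exact ⟨h.pos _ _ h2, (Complex.conj_eq_iff_im.1 (h.conj_symm _ _ _)).symm⟩

/-- The squared length of a section. -/
def normSq (h : HermitianMetric E r V) (s : ∀ x, V x) (x : X) : ℝ := (h.form x (s x) (s x)).re

theorem ofReal_normSq (h : HermitianMetric E r V) (s : ∀ x, V x) (x : X) :
    (normSq h s x : ℂ) = h.form x (s x) (s x) :=
  Complex.conj_eq_iff_re.1 (h.conj_symm _ _ _)

theorem normSq_eq_sum (h : HermitianMetric E r V) (s : ∀ x, V x) (φ : OpenPartialHomeomorph X E)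
    (e : Trivialization (Fin r → ℂ) (π (Fin r → ℂ) V)) [MemTrivializationAtlas e] {y : E}
    (hy : φ.symm y ∈ e.baseSet) :
    (normSq h s (φ.symm y) : ℂ) = ∑ a, ∑ b, starRingEnd ℂ (components s φ e a y)
      * (gram h φ e y a b * components s φ e b y) := by
  have := form_symm_symm h e hy (fun a => components s φ e a y) (fun a => components s φ e a y)
  rw [ofReal_normSq]
  refine Eq.trans ?_ this
  have hs : e.symm (φ.symm y) (fun a => components s φ e a y) = s (φ.symm y) :=
    e.symm_apply_apply_mk hy _
  rw [hs]

theorem gram_contDiffAt (h : HermitianMetric E r V) (p : X) (a b : Fin r) :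
    ContDiffAt ℝ 2 (fun z => gram h (chartAt E p) (trivializationAt (Fin r → ℂ) V p) z a b)
      (chartAt E p p) := by
  have h1 := h.smooth (trivializationAt (Fin r → ℂ) V p) (Pi.single a 1) (Pi.single b 1)
  have h2 := h1.contMDiffAt ((trivializationAt (Fin r → ℂ) V p).open_baseSet.mem_nhds
    (FiberBundle.mem_baseSet_trivializationAt' p))
  exact (contDiffAt_comp_chart_symm h2).of_le (WithTop.coe_le_coe.2 (le_top : (2 : ℕ∞) ≤ ⊤))

theorem components_contDiffAt [ContMDiffVectorBundle ω (Fin r → ℂ) V 𝓘(ℂ, E)]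
    (s : HolomorphicSections E r V) (p : X) (a : Fin r) :
    ContDiffAt ℂ ω (components s (chartAt E p) (trivializationAt (Fin r → ℂ) V p) a)
      (chartAt E p p) := by
  have h1 := (Bundle.contMDiffAt_section p).1 (s.contMDiff p)
  have h2 := contDiffAt_comp_chart_symm h1
  exact contDiffAt_pi.1 h2 a

theorem holomorphicNear_of_contDiffAt {f : E → ℂ} {y : E} (hf : ContDiffAt ℂ 2 f y) :
    HolomorphicNear f y := by
  filter_upwards [hf.eventually (by simp)] with z hz v
  rw [fderiv_real_eq_restrictScalars (hz.differentiableAt (by norm_num))]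
  simp

/-- The chart may leave the domain of the trivialization; the frame formulas are needed only near
the centre. -/
theorem eventually_symm_mem_baseSet (p : X) : ∀ᶠ z in 𝓝 (chartAt E p p),
    (chartAt E p).symm z ∈ (trivializationAt (Fin r → ℂ) V p).baseSet := by
  have hc := (chartAt E p).continuousAt_symm (mem_chart_target E p)
  refine hc.eventually_mem ((trivializationAt (Fin r → ℂ) V p).open_baseSet.mem_nhds ?_)
  rw [(chartAt E p).left_inv (mem_chart_source E p)]
  exact FiberBundle.mem_baseSet_trivializationAt' p

theorem normSq_contDiffAt [ContMDiffVectorBundle ω (Fin r → ℂ) V 𝓘(ℂ, E)]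
    (h : HermitianMetric E r V) (s : HolomorphicSections E r V) (p : X) :
    ContDiffAt ℝ 2 (fun z => normSq h s ((chartAt E p).symm z)) (chartAt E p p) := by
  set φ := chartAt E p with hφ
  set e := trivializationAt (Fin r → ℂ) V p with he
  have hs : ∀ a, ContDiffAt ℝ 2 (components s φ e a) (φ p) := fun a =>
    ((components_contDiffAt s p a).of_le le_top).restrict_scalars ℝ
  have h1 : ContDiffAt ℝ 2 (fun z => (∑ a, ∑ b, starRingEnd ℂ (components s φ e a z)
      * (gram h φ e z a b * components s φ e b z)).re) (φ p) := by
    refine Complex.reCLM.contDiff.contDiffAt.comp (φ p) ?_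
    refine ContDiffAt.sum fun a _ => ContDiffAt.sum fun b _ => ?_
    exact (contDiffAt_conj (hs a)).mul ((gram_contDiffAt h p a b).mul (hs b))
  refine h1.congr_of_eventuallyEq ?_
  filter_upwards [eventually_symm_mem_baseSet (r := r) (V := V) p] with z hz
  rw [← normSq_eq_sum h s φ e hz, Complex.ofReal_re]

theorem continuous_normSq [ContMDiffVectorBundle ω (Fin r → ℂ) V 𝓘(ℂ, E)]
    (h : HermitianMetric E r V) (s : HolomorphicSections E r V) : Continuous (normSq h s) := by
  refine continuous_iff_continuousAt.2 fun p => ?_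
  have h1 := (normSq_contDiffAt h s p).continuousAt.comp
    ((chartAt E p).continuousAt (mem_chart_source E p))
  refine h1.congr ?_
  filter_upwards [(chartAt E p).open_source.mem_nhds (mem_chart_source E p)] with q hq
  simp [(chartAt E p).left_inv hq]

end Frame

/-! ### The Hermite–Einstein equation and |s|² at a point. -/

section Pointwise

open Filter Topology

variable {E : Type*} [NormedAddCommGroup E] [NormedSpace ℂ E]
variable {X : Type*} [TopologicalSpace X] [ChartedSpace E X]
variable {r : ℕ} {V : X → Type*} [∀ x, AddCommGroup (V x)] [∀ x, Module ℂ (V x)]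
  [∀ x, TopologicalSpace (V x)] [TopologicalSpace (TotalSpace (Fin r → ℂ) V)]
  [FiberBundle (Fin r → ℂ) V] [VectorBundle ℂ (Fin r → ℂ) V]

theorem linearMapAt_frameEnd_symm (e : Trivialization (Fin r → ℂ) (π (Fin r → ℂ) V))
    [MemTrivializationAtlas e] {x : X} (hx : x ∈ e.baseSet) (N : Matrix (Fin r) (Fin r) ℂ)
    (c : Fin r → ℂ) : e.linearMapAt ℂ x (frameEnd e x N (e.symmₗ ℂ x c)) = N *ᵥ c := by
  simp only [frameEnd, LinearMap.comp_apply]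
  rw [e.linearMapAt_symmₗ hx, e.linearMapAt_symmₗ hx, Matrix.toLin'_apply]

/-- The Hermite–Einstein equation in a frame. -/
theorem IsHermiteEinstein.pairing_curvature {n k : ℕ} {hm : 1 ≤ k + 1} {hkn : k + 1 ≤ n}
    {κ : DForm E X 2} {Ω : DForm E X (2 * (n - (k + 1)))} {h : HermitianMetric E r V} {lam : ℝ}
    (hHE : IsHermiteEinstein hm hkn κ Ω h lam) (p : X) (v : Fin n → TangentSpace 𝓘(ℂ, E) p)
    (a b : Fin r) :
    Complex.I * pairing hkn (κ p).toAlternatingMap (Ω p).toAlternatingMap v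
      ((curvatureMatrix h (chartAt E p) (trivializationAt (Fin r → ℂ) V p) a b
        (chartAt E p p)).compLinearMap (chartDeriv E p))
      = lam * volumeForm n κ p (realFrame v) * if a = b then 1 else 0 := by
  set e := trivializationAt (Fin r → ℂ) V p with he
  set Θ : Fin r → Fin r → TangentSpace 𝓘(ℂ, E) p [⋀^Fin 2]→ₗ[ℝ] ℂ := fun a b =>
    (curvatureMatrix h (chartAt E p) e a b (chartAt E p p)).compLinearMap (chartDeriv E p) with hΘ
  have hp : p ∈ e.baseSet := FiberBundle.mem_baseSet_trivializationAt' p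
  have h1 := congrArg (fun T => T (realFrame v)) (hHE p)
  have h2 : formCast (show 2 + 2 * (k + 1 - 1) + 2 * (n - (k + 1)) = 2 * n by omega)
      (wedge (wedge (Complex.I • chernCurvature h p)
        (wedgePow (κ p).toAlternatingMap (k + 1 - 1))) (Ω p).toAlternatingMap) (realFrame v)
      = ∑ a, ∑ b, (Complex.I * pairing hkn (κ p).toAlternatingMap (Ω p).toAlternatingMap v
          (Θ a b)) • frameEnd e p (Matrix.single a b 1) := by
    have hc : chernCurvature h p
        = ∑ a, ∑ b, formTensor (Θ a b) (frameEnd e p (Matrix.single a b 1)) := rfl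
    rw [hc, wedge_smul_left, wedge_smul_left, wedge_sum_left, wedge_sum_left]
    simp_rw [wedge_sum_left, wedge_formTensor]
    rw [formCast_apply, AlternatingMap.smul_apply, alternatingMap_sum_apply]
    simp_rw [alternatingMap_sum_apply]
    simp_rw [Finset.smul_sum, mul_smul]
    rfl
  have h3 := h2.symm.trans h1
  -- Both sides are endomorphisms of the fibre; the matrix entry is the a-th coordinate of the image
  -- of the b-th frame vector.
  have h4 := congrArg (fun T : V p →ₗ[ℂ] V p =>
    e.linearMapAt ℂ p (T (e.symmₗ ℂ p (Pi.single b 1))) a) h3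
  have h5 : ∀ c : ℂ, e.linearMapAt ℂ p ((c • (LinearMap.id : V p →ₗ[ℂ] V p))
      (e.symmₗ ℂ p (Pi.single b 1))) a = c * if a = b then 1 else 0 := by
    intro c
    rw [LinearMap.smul_apply, map_smul, LinearMap.id_apply, e.linearMapAt_symmₗ hp,
      Pi.smul_apply, Pi.single_apply, smul_eq_mul]
  have h6 : e.linearMapAt ℂ p ((((lam : ℂ) • formTensor (volumeForm n κ p)
      (LinearMap.id : V p →ₗ[ℂ] V p)) (realFrame v)) (e.symmₗ ℂ p (Pi.single b 1))) a
      = lam * volumeForm n κ p (realFrame v) * if a = b then 1 else 0 := by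
    rw [← h5, mul_smul]; rfl
  rw [← h6, ← h4]
  simp only [LinearMap.sum_apply, LinearMap.smul_apply, map_sum, map_smul, Finset.sum_apply,
    Pi.smul_apply, linearMapAt_frameEnd_symm e hp]
  simp [Matrix.single_apply, ite_and, hΘ]

theorem star_dotProduct_conjTranspose_mul_mulVec {ι : Type*} [Fintype ι] (C : Matrix ι ι ℂ)
    (x y : ι → ℂ) :
    star x ⬝ᵥ ((Cᴴ * C) *ᵥ y) = ∑ k, starRingEnd ℂ ((C *ᵥ x) k) * (C *ᵥ y) k := by
  rw [← Matrix.mulVec_mulVec, Matrix.dotProduct_mulVec, ← Matrix.star_mulVec]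
  rfl

/-- The Bochner formula with the square term written as a sum of elementary forms. -/
theorem leviForm_eq_sum_elementary {H : E → Matrix (Fin r) (Fin r) ℂ} {s : Fin r → E → ℂ}
    {u : E → ℝ} {y : E} {C : Matrix (Fin r) (Fin r) ℂ} (hC : H y = Cᴴ * C)
    (hH : ∀ a b, ContDiffAt ℝ 2 (fun z => H z a b) y) (hdet : IsUnit (H y).det)
    (hherm : ∀ z, (H z)ᴴ = H z) (hs : ∀ a, ContDiffAt ℝ 2 (s a) y)
    (hs' : ∀ a, HolomorphicNear (s a) y) (hu : ContDiffAt ℝ 2 u y)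
    (hus : ∀ᶠ z in 𝓝 y, (u z : ℂ) = ∑ a, ∑ b, starRingEnd ℂ (s a z) * (H z a b * s b z)) :
    ∃ g : Fin r → E →ₗ[ℂ] ℂ, (∀ k w, g k w = (C *ᵥ fun a => covariantOfGram H s y a w) k) ∧
      leviForm (fderiv ℝ (fderiv ℝ u) y) = ∑ k, elementary (g k)
        - ∑ a, ∑ c, ∑ b, (starRingEnd ℂ (s a y) * H y a c * s b y * Complex.I) •
          curvatureOfGram H c b y := by
  -- Ds is of type (1,0), because s is holomorphic and A = H⁻¹∂H; its components can therefore enter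
  -- elementary forms.
  have hlin : ∀ a w, covariantOfGram H s y a (Complex.I • w)
      = Complex.I * covariantOfGram H s y a w := by
    intro a w
    simp only [covariantOfGram, _root_.add_apply, _root_.sum_apply, _root_.smul_apply,
      connectionOfGram_smul_I, (hs' a).self_of_nhds w, smul_eq_mul, mul_add, Finset.mul_sum]
    congr 1
    exact Finset.sum_congr rfl fun b _ => by ring
  let α : Fin r → E →ₗ[ℂ] ℂ := fun a =>
    functionalOfReal (covariantOfGram H s y a : E →ₗ[ℝ] ℂ) (hlin a)
  refine ⟨fun k => ∑ a, C k a • α a, fun k w => ?_, ?_⟩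
  · simp [Matrix.mulVec, dotProduct, α, functionalOfReal]
  · have hg : ∀ k w, (∑ a, C k a • α a) w = (C *ᵥ fun a => covariantOfGram H s y a w) k := by
      intro k w
      simp [Matrix.mulVec, dotProduct, α, functionalOfReal]
    ext v
    rw [bochner hH hdet hherm hs hs' hu hus v, AlternatingMap.sub_apply, alternatingMap_sum_apply]
    congr 1
    · rw [hC, star_dotProduct_conjTranspose_mul_mulVec, star_dotProduct_conjTranspose_mul_mulVec,
        ← Finset.sum_sub_distrib, Finset.mul_sum]
      refine Finset.sum_congr rfl fun k _ => ?_
      rw [elementary_apply, hg, hg]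
      ring
    · rw [← Matrix.mulVec_mulVec, star_dotProduct_mulVec, alternatingMap_sum_apply, Finset.mul_sum]
      refine Finset.sum_congr rfl fun a _ => ?_
      rw [alternatingMap_sum_apply, Finset.mul_sum]
      refine Finset.sum_congr rfl fun c _ => ?_
      rw [alternatingMap_sum_apply]
      simp only [Matrix.mulVec, dotProduct, Matrix.of_apply, Finset.mul_sum]
      refine Finset.sum_congr rfl fun b _ => ?_
      rw [AlternatingMap.smul_apply, smul_eq_mul]
      ring

open scoped ComplexOrder in
/-- The complex Hessian of `|s|²` for a holomorphic section `s` of a Hermite–Einstein bundle. -/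
theorem pairing_leviForm_normSq [ContMDiffVectorBundle ω (Fin r → ℂ) V 𝓘(ℂ, E)]
    {n k : ℕ} {hm : 1 ≤ k + 1} {hkn : k + 1 ≤ n}
    {κ : DForm E X 2} {Ω : DForm E X (2 * (n - (k + 1)))} {h : HermitianMetric E r V} {lam : ℝ}
    (hHE : IsHermiteEinstein hm hkn κ Ω h lam) (s : HolomorphicSections E r V) (p : X) :
    ∃ γ : Fin r → TangentSpace 𝓘(ℂ, E) p →ₗ[ℂ] ℂ,
      ((∀ j, γ j = 0) → chernConnection h s p = 0) ∧
      ∀ v : Fin n → TangentSpace 𝓘(ℂ, E) p,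
        pairing hkn (κ p).toAlternatingMap (Ω p).toAlternatingMap v
          ((leviForm (fderiv ℝ (fderiv ℝ fun z => normSq h s ((chartAt E p).symm z))
            (chartAt E p p))).compLinearMap (chartDeriv E p))
        = ∑ j, pairing hkn (κ p).toAlternatingMap (Ω p).toAlternatingMap v (elementary (γ j))
          - lam * volumeForm n κ p (realFrame v) * normSq h s p := by
  set φ := chartAt E p with hφ
  set e := trivializationAt (Fin r → ℂ) V p with he
  have hφp : φ.symm (φ p) = p := φ.left_inv (mem_chart_source E p)
  have hp : p ∈ e.baseSet := FiberBundle.mem_baseSet_trivializationAt' p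
  have hp' : φ.symm (φ p) ∈ e.baseSet := hφp.symm ▸ hp
  have hpos := gram_posDef h φ e hp'
  have hdet : IsUnit (gram h φ e (φ p)).det := (Matrix.isUnit_iff_isUnit_det _).1 hpos.isUnit
  obtain ⟨C, hC⟩ := exists_eq_conjTranspose_mul_self hpos.posSemidef
  have hsc := fun a => (components_contDiffAt s p a).of_le (le_top : 2 ≤ ω)
  have hus : ∀ᶠ z in 𝓝 (φ p), (normSq h s (φ.symm z) : ℂ) = ∑ a, ∑ b,
      starRingEnd ℂ (components s φ e a z) * (gram h φ e z a b * components s φ e b z) := by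
    filter_upwards [eventually_symm_mem_baseSet (r := r) (V := V) p] with z hz
    exact normSq_eq_sum h s φ e hz
  obtain ⟨g, hg, hlevi⟩ := leviForm_eq_sum_elementary hC (gram_contDiffAt h p) hdet
    (gram_conjTranspose h φ e) (fun a => (hsc a).restrict_scalars ℝ)
    (fun a => holomorphicNear_of_contDiffAt (hsc a)) (normSq_contDiffAt h s p) hus
  let D : TangentSpace 𝓘(ℂ, E) p →ₗ[ℂ] E := (mfderiv 𝓘(ℂ, E) 𝓘(ℂ, E) φ p).toLinearMap
  have hD : chartDeriv E p = D.restrictScalars ℝ := rfl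
  refine ⟨fun j => g j ∘ₗ D, fun h0 => ?_, fun v => ?_⟩
  · ext w
    have h1 : C *ᵥ (fun a => covariantOfGram (gram h φ e) (components s φ e) (φ p) a (D w)) = 0 := by
      funext j
      rw [← hg]
      exact congrArg (fun T => T w) (h0 j)
    have h2 : (fun a => covariantOfGram (gram h φ e) (components s φ e) (φ p) a (D w)) = 0 := by
      -- C·Ds = 0 gives H·Ds = C*C·Ds = 0, and H is invertible.
      refine Matrix.eq_zero_of_mulVec_eq_zero hdet.ne_zero (M := gram h φ e (φ p)) ?_
      rw [hC, ← Matrix.mulVec_mulVec, h1, Matrix.mulVec_zero]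
    have h3 : chernConnection h s p w = e.symmₗ ℂ p
      (fun a => covariantOfGram (gram h φ e) (components s φ e) (φ p) a (D w)) := rfl
    rw [h3, h2, map_zero]; rfl
  · set P := pairing hkn (κ p).toAlternatingMap (Ω p).toAlternatingMap v with hP
    -- `curvatureOfGram` of the Gram matrix unfolds to `curvatureMatrix`, so the frame equation
    -- applies as it stands.
    have hΘ : ∀ c b, Complex.I * P ((curvatureOfGram (gram h φ e) c b (φ p)).compLinearMap
        (chartDeriv E p)) = lam * volumeForm n κ p (realFrame v) * if c = b then 1 else 0 :=
      fun c b => hHE.pairing_curvature p v c b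
    have hcomp : (leviForm (fderiv ℝ (fderiv ℝ fun z => normSq h s (φ.symm z))
        (φ p))).compLinearMap (chartDeriv E p) = ∑ k, elementary (g k ∘ₗ D)
        - ∑ a, ∑ c, ∑ b, (starRingEnd ℂ (components s φ e a (φ p)) * gram h φ e (φ p) a c *
            components s φ e b (φ p) * Complex.I) •
          (curvatureOfGram (gram h φ e) c b (φ p)).compLinearMap (chartDeriv E p) := by
      rw [hlevi]
      ext w
      simp only [AlternatingMap.compLinearMap_apply, AlternatingMap.sub_apply,
        alternatingMap_sum_apply, AlternatingMap.smul_apply, ← elementary_compLinearMap, hD]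
      rfl
    rw [hcomp, map_sub, map_sum, map_sum]
    congr 1
    -- The contracted curvature is a multiple of the identity, so the triple sum collapses to Σ s̄_a
    -- H_ac s_c = |s|².
    have hu := normSq_eq_sum h s φ e hp'
    rw [hφp] at hu
    rw [hu, Finset.mul_sum]
    refine Finset.sum_congr rfl fun a _ => ?_
    rw [map_sum, Finset.mul_sum]
    refine Finset.sum_congr rfl fun c _ => ?_
    rw [map_sum]
    simp only [map_smul, smul_eq_mul, mul_assoc, hΘ]
    simp only [mul_ite, mul_one, mul_zero, Finset.sum_ite_eq, Finset.mem_univ, if_true]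
    ring

end Pointwise

/-! ### From the preferred chart at each point to one fixed chart. -/

section Transition

open Filter Topology

variable {E : Type*} [NormedAddCommGroup E] [NormedSpace ℂ E]
variable {X : Type*} [TopologicalSpace X] [ChartedSpace E X] [IsManifold 𝓘(ℂ, E) ω X]

/-- The differential of the inverse of a preferred chart. -/
def chartSymmEquiv (x₀ : X) {y : E} (hy : y ∈ (chartAt E x₀).target) :
    E ≃ₗ[ℂ] TangentSpace 𝓘(ℂ, E) ((chartAt E x₀).symm y) :=
  ((mdifferentiable_chart (I := 𝓘(ℂ, E)) x₀).symm.mfderiv hy).toLinearEquiv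

theorem toAlternatingMap_inChart {k : ℕ} (α : DForm E X k) (x₀ : X) {y : E}
    (hy : y ∈ (chartAt E x₀).target) : (α.inChart (chartAt E x₀) y).toAlternatingMap
      = (α ((chartAt E x₀).symm y)).toAlternatingMap.compLinearMap
        ((chartSymmEquiv x₀ hy).toLinearMap.restrictScalars ℝ) := rfl

theorem contDiffAt_chart_transition (x₀ : X) {y : E} (hy : y ∈ (chartAt E x₀).target) :
    ContDiffAt ℂ ω (chartAt E ((chartAt E x₀).symm y) ∘ (chartAt E x₀).symm) y := by
  have h1 : ContMDiffAt 𝓘(ℂ, E) 𝓘(ℂ, E) ω (chartAt E ((chartAt E x₀).symm y))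
      ((chartAt E x₀).symm y) := contMDiffOn_chart.contMDiffAt
    ((chartAt E _).open_source.mem_nhds (mem_chart_source E _))
  have h2 : ContMDiffAt 𝓘(ℂ, E) 𝓘(ℂ, E) ω (chartAt E x₀).symm y :=
    contMDiffOn_chart_symm.contMDiffAt ((chartAt E x₀).open_target.mem_nhds hy)
  exact (h1.comp y h2).contDiffAt

theorem fderiv_chart_transition (x₀ : X) {y : E} (hy : y ∈ (chartAt E x₀).target) :
    ((fderiv ℂ (chartAt E ((chartAt E x₀).symm y) ∘ (chartAt E x₀).symm) y).restrictScalars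
      ℝ).toLinearMap = chartDeriv E ((chartAt E x₀).symm y) ∘ₗ
        (chartSymmEquiv x₀ hy).toLinearMap.restrictScalars ℝ := by
  have h1 := mfderiv_comp (I := 𝓘(ℂ, E)) (I' := 𝓘(ℂ, E)) (I'' := 𝓘(ℂ, E)) y
    ((mdifferentiable_chart (I := 𝓘(ℂ, E)) ((chartAt E x₀).symm y)).mdifferentiableAt
      (mem_chart_source E _))
    ((mdifferentiable_chart (I := 𝓘(ℂ, E)) x₀).mdifferentiableAt_symm hy)
  rw [mfderiv_eq_fderiv] at h1
  rw [h1]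
  rfl

theorem eventuallyEq_chart_transition {F : Type*} (f : X → F) (x₀ : X) {y : E}
    (hy : y ∈ (chartAt E x₀).target) :
    (fun z => f ((chartAt E x₀).symm z)) =ᶠ[𝓝 y]
      (fun z => f ((chartAt E ((chartAt E x₀).symm y)).symm z)) ∘
        (chartAt E ((chartAt E x₀).symm y) ∘ (chartAt E x₀).symm) := by
  have hc := (chartAt E x₀).continuousAt_symm hy
  filter_upwards [hc.eventually_mem ((chartAt E ((chartAt E x₀).symm y)).open_source.mem_nhds
    (mem_chart_source E _))] with z hz
  simp [(chartAt E ((chartAt E x₀).symm y)).left_inv hz]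

theorem contDiffAt_of_chart_transition {f : X → ℝ} (x₀ : X) {y : E}
    (hy : y ∈ (chartAt E x₀).target)
    (hf : ContDiffAt ℝ 2 (fun z => f ((chartAt E ((chartAt E x₀).symm y)).symm z))
      (chartAt E ((chartAt E x₀).symm y) ((chartAt E x₀).symm y))) :
    ContDiffAt ℝ 2 (fun z => f ((chartAt E x₀).symm z)) y := by
  refine ContDiffAt.congr_of_eventuallyEq ?_ (eventuallyEq_chart_transition f x₀ hy)
  exact ContDiffAt.comp y hf
    (((contDiffAt_chart_transition x₀ hy).of_le (le_top : 2 ≤ ω)).restrict_scalars ℝ)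

/-- The transition map is holomorphic, so the Levi form transforms like a two-form although the real
Hessian does not transform like a tensor. -/
theorem leviForm_chart_transition {f : X → ℝ} (x₀ : X) {y : E}
    (hy : y ∈ (chartAt E x₀).target)
    (hf : ContDiffAt ℝ 2 (fun z => f ((chartAt E ((chartAt E x₀).symm y)).symm z))
      (chartAt E ((chartAt E x₀).symm y) ((chartAt E x₀).symm y))) :
    leviForm (fderiv ℝ (fderiv ℝ (fun z => f ((chartAt E x₀).symm z))) y)
      = ((leviForm (fderiv ℝ (fderiv ℝ fun z => f ((chartAt E ((chartAt E x₀).symm y)).symm z))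
        (chartAt E ((chartAt E x₀).symm y) ((chartAt E x₀).symm y)))).compLinearMap
          (chartDeriv E ((chartAt E x₀).symm y))).compLinearMap
            ((chartSymmEquiv x₀ hy).toLinearMap.restrictScalars ℝ) := by
  rw [(eventuallyEq_chart_transition f x₀ hy).fderiv.fderiv_eq,
    leviForm_comp (ψ := chartAt E ((chartAt E x₀).symm y) ∘ (chartAt E x₀).symm) hf
      ((contDiffAt_chart_transition x₀ hy).of_le (le_top : 2 ≤ ω)),
    fderiv_chart_transition x₀ hy]
  rfl

instance (x : X) [FiniteDimensional ℂ E] : FiniteDimensional ℂ (TangentSpace 𝓘(ℂ, E) x) :=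
  inferInstanceAs (FiniteDimensional ℂ E)

/-- The pairing of a metric and an admissible form with `iα ∧ ᾱ` is positive in a chart. -/
theorem pairing_inChart_elementary_pos [FiniteDimensional ℂ E] {n k : ℕ}
    (hn : Module.finrank ℂ E = n) {hkn : k + 1 ≤ n} {κ : DForm E X 2} (hκ : IsKaehler κ)
    {Ω : DForm E X (2 * (n - (k + 1)))} (hΩ : IsAdmissible hkn Ω) (x₀ : X) {y : E}
    (hy : y ∈ (chartAt E x₀).target) {v : Fin n → E} (hv : LinearIndependent ℂ v)
    {α : E →ₗ[ℂ] ℂ} (hα : α ≠ 0) :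
    0 < (pairing hkn (κ.inChart (chartAt E x₀) y).toAlternatingMap
      (Ω.inChart (chartAt E x₀) y).toAlternatingMap v (elementary α)).re := by
  set T := chartSymmEquiv x₀ hy with hT
  have hα' : α = (α ∘ₗ T.symm.toLinearMap) ∘ₗ T.toLinearMap := by
    ext w
    simp
  rw [toAlternatingMap_inChart κ x₀ hy, toAlternatingMap_inChart Ω x₀ hy, hα',
    ← elementary_compLinearMap, pairing_compLinearMap]
  refine (pairing_elementary (M := TangentSpace 𝓘(ℂ, E) ((chartAt E x₀).symm y))
    (show Module.finrank ℂ (TangentSpace 𝓘(ℂ, E) ((chartAt E x₀).symm y)) = n from hn) hkn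
    (hκ.real _) (hκ.bidegree _) (hκ.positive _) (hΩ.positive _)
    (hv.map' T.toLinearMap T.ker) fun h0 => hα ?_).2
  rw [hα', h0, LinearMap.zero_comp]

variable {r : ℕ} {V : X → Type*} [∀ x, AddCommGroup (V x)] [∀ x, Module ℂ (V x)]
  [∀ x, TopologicalSpace (V x)] [TopologicalSpace (TotalSpace (Fin r → ℂ) V)]
  [FiberBundle (Fin r → ℂ) V] [VectorBundle ℂ (Fin r → ℂ) V]
  [ContMDiffVectorBundle ω (Fin r → ℂ) V 𝓘(ℂ, E)]

/-- The complex Hessian of `|s|²` in an arbitrary preferred chart. -/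
theorem pairing_inChart_leviForm_normSq {n k : ℕ} {hm : 1 ≤ k + 1} {hkn : k + 1 ≤ n}
    {κ : DForm E X 2} {Ω : DForm E X (2 * (n - (k + 1)))} {h : HermitianMetric E r V} {lam : ℝ}
    (hHE : IsHermiteEinstein hm hkn κ Ω h lam) (s : HolomorphicSections E r V) (x₀ : X) {y : E}
    (hy : y ∈ (chartAt E x₀).target) :
    ∃ γ : Fin r → E →ₗ[ℂ] ℂ,
      ((∀ j, γ j = 0) → chernConnection h s ((chartAt E x₀).symm y) = 0) ∧
      ∀ v : Fin n → E, pairing hkn (κ.inChart (chartAt E x₀) y).toAlternatingMap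
          (Ω.inChart (chartAt E x₀) y).toAlternatingMap v
          (leviForm (fderiv ℝ (fderiv ℝ fun z => normSq h s ((chartAt E x₀).symm z)) y))
        = ∑ j, pairing hkn (κ.inChart (chartAt E x₀) y).toAlternatingMap
            (Ω.inChart (chartAt E x₀) y).toAlternatingMap v (elementary (γ j))
          - lam * volumeForm n κ ((chartAt E x₀).symm y) (realFrame (chartSymmEquiv x₀ hy ∘ v))
            * normSq h s ((chartAt E x₀).symm y) := by
  set T := chartSymmEquiv x₀ hy with hT
  obtain ⟨γ, hγ, hP⟩ := pairing_leviForm_normSq hHE s ((chartAt E x₀).symm y)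
  refine ⟨fun j => γ j ∘ₗ T.toLinearMap, fun h0 => hγ fun j => ?_, fun v => ?_⟩
  · ext w
    have := congrArg (fun f => f (T.symm w)) (h0 j)
    simpa using this
  · rw [leviForm_chart_transition x₀ hy (normSq_contDiffAt h s _), toAlternatingMap_inChart κ x₀ hy,
      toAlternatingMap_inChart Ω x₀ hy, pairing_compLinearMap]
    have hj : ∀ j, elementary (γ j ∘ₗ T.toLinearMap)
        = (elementary (γ j)).compLinearMap (T.toLinearMap.restrictScalars ℝ) :=
      fun j => (elementary_compLinearMap _ _).symm
    refine (hP (T ∘ v)).trans (congrArg (· - _) (Finset.sum_congr rfl fun j _ => ?_))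
    rw [hj]
    exact (pairing_compLinearMap hkn (κ _).toAlternatingMap (Ω _).toAlternatingMap T.toLinearMap v
      (elementary (γ j))).symm

theorem normSq_contDiffAt_chart (h : HermitianMetric E r V) (s : HolomorphicSections E r V)
    (x₀ : X) {y : E} (hy : y ∈ (chartAt E x₀).target) :
    ContDiffAt ℝ 2 (fun z => normSq h s ((chartAt E x₀).symm z)) y :=
  contDiffAt_of_chart_transition x₀ hy (normSq_contDiffAt h s _)

theorem volumeForm_realFrame_pos [FiniteDimensional ℂ E] {n : ℕ} (hn : Module.finrank ℂ E = n)
    {κ : DForm E X 2} (hκ : IsKaehler κ) (p : X) {v : Fin n → TangentSpace 𝓘(ℂ, E) p}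
    (hv : LinearIndependent ℂ v) :
    (volumeForm n κ p (realFrame v)).im = 0 ∧ 0 < (volumeForm n κ p (realFrame v)).re := by
  have h1 := wedgePow_realFrame_pos (M := TangentSpace 𝓘(ℂ, E) p)
    (show Module.finrank ℂ (TangentSpace 𝓘(ℂ, E) p) = n from hn) (hκ.real p) (hκ.bidegree p)
    (hκ.positive p) hv
  have h2 : volumeForm n κ p (realFrame v)
      = ((1 / n.factorial : ℝ) : ℂ) * wedgePow (κ p).toAlternatingMap n (realFrame v) := by
    push_cast; rfl
  rw [h2, Complex.im_ofReal_mul, Complex.re_ofReal_mul, h1.1, mul_zero]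
  exact ⟨rfl, mul_pos (by positivity) h1.2⟩

theorem DForm.IsSmooth.continuousOn_apply {k : ℕ} {α : DForm E X k} (hα : α.IsSmooth) (x₀ : X)
    (w : Fin k → E) : ContinuousOn (fun y => (α.inChart (chartAt E x₀) y).toAlternatingMap w)
      (chartAt E x₀).target :=
  (ContinuousAlternatingMap.apply ℝ E ℂ w).continuous.comp_continuousOn
    (hα _ (chart_mem_atlas E x₀)).continuousOn

end Transition

/-! ### Conclusion by the maximum principle. -/

section Vanishing

open Filter Topology

variable {E : Type*} [NormedAddCommGroup E] [NormedSpace ℂ E] [FiniteDimensional ℂ E]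
variable {X : Type*} [TopologicalSpace X] [ChartedSpace E X] [IsManifold 𝓘(ℂ, E) ω X]
variable {r : ℕ} {V : X → Type*} [∀ x, AddCommGroup (V x)] [∀ x, Module ℂ (V x)]
  [∀ x, TopologicalSpace (V x)] [TopologicalSpace (TotalSpace (Fin r → ℂ) V)]
  [FiberBundle (Fin r → ℂ) V] [VectorBundle ℂ (Fin r → ℂ) V]
  [ContMDiffVectorBundle ω (Fin r → ℂ) V 𝓘(ℂ, E)]
variable {n k : ℕ} {hm : 1 ≤ k + 1} {hkn : k + 1 ≤ n} {κ : DForm E X 2}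
  {Ω : DForm E X (2 * (n - (k + 1)))} {h : HermitianMetric E r V} {lam : ℝ}

theorem pairing_inChart_elementary_nonneg (hn : Module.finrank ℂ E = n) (hκ : IsKaehler κ)
    (hΩ : IsAdmissible hkn Ω) (x₀ : X) {y : E} (hy : y ∈ (chartAt E x₀).target) {v : Fin n → E}
    (hv : LinearIndependent ℂ v) (α : E →ₗ[ℂ] ℂ) :
    0 ≤ (pairing hkn (κ.inChart (chartAt E x₀) y).toAlternatingMap
      (Ω.inChart (chartAt E x₀) y).toAlternatingMap v (elementary α)).re := by
  by_cases hα : α = 0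
  · rw [hα, elementary_zero, map_zero, Complex.zero_re]
  · exact (pairing_inChart_elementary_pos hn hκ hΩ x₀ hy hv hα).le

set_option synthInstance.maxHeartbeats 200000 in
/-- If the Einstein factor is negative, then `s` vanishes at a maximum of `|s|²`. -/
theorem normSq_nonpos_of_forall_le (hn : Module.finrank ℂ E = n) (hκ : IsKaehler κ)
    (hΩ : IsAdmissible hkn Ω) (hHE : IsHermiteEinstein hm hkn κ Ω h lam) (hlam : lam < 0)
    (s : HolomorphicSections E r V) {p : X} (hp : ∀ q, normSq h s q ≤ normSq h s p) :
    normSq h s p ≤ 0 := by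
  set φ := chartAt E p with hφ
  have hy : φ p ∈ φ.target := mem_chart_target E p
  have hφp : φ.symm (φ p) = p := φ.left_inv (mem_chart_source E p)
  let v := Module.finBasisOfFinrankEq ℂ E hn
  have hv := v.linearIndependent
  have hu := normSq_contDiffAt h s p
  have hmax : IsLocalMax (fun z => normSq h s (φ.symm z)) (φ p) := by
    refine Filter.Eventually.of_forall fun z => ?_
    exact (hp _).trans_eq (congrArg (normSq h s) hφp).symm
  set B := fderiv ℝ (fderiv ℝ fun z => normSq h s (φ.symm z)) (φ p) with hB
  have hsymm : ∀ v w, B v w = B w v := fun v w => hu.isSymmSndFDerivAt (by simp) v w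
  -- At a maximum the negated Hessian is positive semidefinite, so ellipticity applies to -B.
  have h1 : 0 ≤ leviPairing hkn (κ.inChart φ (φ p)).toAlternatingMap
      (Ω.inChart φ (φ p)).toAlternatingMap v (-B) := by
    refine leviPairing_nonneg
      (fun α hα => pairing_inChart_elementary_pos hn hκ hΩ p hy hv hα)
      (fun v w => congrArg Neg.neg (hsymm v w)) (fun w => ?_)
    exact neg_nonneg.2 (sndDeriv_nonpos_of_isLocalMax hu hmax w)
  have hneg := map_neg (leviPairing hkn (κ.inChart φ (φ p)).toAlternatingMap
      (Ω.inChart φ (φ p)).toAlternatingMap v) B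
  rw [hneg] at h1
  obtain ⟨γ, -, hγ⟩ := pairing_inChart_leviForm_normSq hHE s p hy
  have hvol := volumeForm_realFrame_pos hn hκ (φ.symm (φ p))
    (hv.map' (chartSymmEquiv p hy).toLinearMap (chartSymmEquiv p hy).ker)
  have h2 := congrArg Complex.re (hγ v)
  rw [Complex.sub_re, Complex.re_sum, Complex.re_mul_ofReal, Complex.re_ofReal_mul] at h2
  have h3 : 0 ≤ ∑ j, (pairing hkn (κ.inChart φ (φ p)).toAlternatingMap
      (Ω.inChart φ (φ p)).toAlternatingMap v (elementary (γ j))).re :=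
    Finset.sum_nonneg fun j _ => pairing_inChart_elementary_nonneg hn hκ hΩ p hy hv (γ j)
  have h4 : (pairing hkn (κ.inChart φ (φ p)).toAlternatingMap
      (Ω.inChart φ (φ p)).toAlternatingMap v (leviForm B)).re ≤ 0 := by
    have : leviPairing hkn (κ.inChart φ (φ p)).toAlternatingMap
      (Ω.inChart φ (φ p)).toAlternatingMap v B ≤ 0 := by linarith
    exact this
  by_contra! hpos
  -- If |s|² were positive here, -λ · vol · |s|² would be too, and with the nonnegative square terms
  -- the pairing would be positive, against `h4`.
  rw [← hφp] at hpos
  have h5 := mul_pos (mul_pos (neg_pos.2 hlam) hvol.2) hpos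
  have h6 := h2.symm.trans_le h4
  have h7 : (chartSymmEquiv p hy ∘ v : Fin n → _) = (chartSymmEquiv p hy).toLinearMap ∘ v := rfl
  rw [h7] at h6
  linarith

/-- The set where `|s|²` attains its maximum over an open set is open. -/
theorem isOpen_setOf_normSq_eq (hn : Module.finrank ℂ E = n) (hκ : IsKaehler κ)
    (hΩ : IsAdmissible hkn Ω) (hHE : IsHermiteEinstein hm hkn κ Ω h 0)
    (s : HolomorphicSections E r V) {O : Set X} (hO : IsOpen O) {A : ℝ}
    (hA : ∀ q ∈ O, normSq h s q ≤ A) : IsOpen {q | q ∈ O ∧ normSq h s q = A} := by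
  refine isOpen_iff_mem_nhds.2 fun z hz => ?_
  set φ := chartAt E z with hφ
  let v := Module.finBasisOfFinrankEq ℂ E hn
  have hv := v.linearIndependent
  have hU : IsOpen (φ.target ∩ φ.symm ⁻¹' O) := φ.isOpen_inter_preimage_symm hO
  have hW := isOpen_setOf_eq_max_of_normed hU (u := fun y => normSq h s (φ.symm y))
    (fun y hy => normSq_contDiffAt_chart h s z hy.1)
    (fun y => leviPairing hkn (κ.inChart φ y).toAlternatingMap (Ω.inChart φ y).toAlternatingMap v)
    (fun B => Complex.continuous_re.comp_continuousOn
      ((continuousOn_pairing hkn (hκ.smooth.continuousOn_apply z)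
        (hΩ.smooth.continuousOn_apply z) v (leviForm B)).mono Set.inter_subset_left))
    (fun y hy B => leviPairing_nonneg
      (fun α hα => pairing_inChart_elementary_pos hn hκ hΩ z hy.1 hv hα))
    (fun y hy ℓ => leviPairing_smulRight_pos
      (fun α hα => pairing_inChart_elementary_pos hn hκ hΩ z hy.1 hv hα))
    -- With Einstein factor 0 the curvature term disappears and only nonnegative square terms
    -- remain: |s|² is a subsolution.
    (fun y hy => by
      obtain ⟨γ, -, hγ⟩ := pairing_inChart_leviForm_normSq hHE s z hy.1
      have h2 := congrArg Complex.re (hγ v)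
      rw [Complex.ofReal_zero, zero_mul, zero_mul, sub_zero, Complex.re_sum] at h2
      refine le_of_le_of_eq (Finset.sum_nonneg fun j _ => ?_) h2.symm
      exact pairing_inChart_elementary_nonneg hn hκ hΩ z hy.1 hv (γ j))
    (A := A) (fun y hy => hA _ hy.2)
  have hW' := φ.isOpen_inter_preimage hW
  refine Filter.mem_of_superset (hW'.mem_nhds (x := z) ?_) ?_
  · have hz' : φ.symm (φ z) = z := φ.left_inv (mem_chart_source E z)
    refine ⟨mem_chart_source E z, ⟨mem_chart_target E z, ?_⟩, ?_⟩
    · exact (congrArg (· ∈ O) hz').mpr hz.1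
    · exact (congrArg (normSq h s) hz').trans hz.2
  · rintro q ⟨hq, ⟨-, h1⟩, h2⟩
    have hq' : φ.symm (φ q) = q := φ.left_inv hq
    exact ⟨(congrArg (· ∈ O) hq').mp h1, (congrArg (normSq h s) hq').symm.trans h2⟩

/-- Where `|s|²` is locally constant, `s` is parallel if the Einstein factor is zero. -/
theorem chernConnection_eq_zero_of_eventually (hn : Module.finrank ℂ E = n) (hκ : IsKaehler κ)
    (hΩ : IsAdmissible hkn Ω) (hHE : IsHermiteEinstein hm hkn κ Ω h 0)
    (s : HolomorphicSections E r V) {x : X} {A : ℝ} (hx : ∀ᶠ q in 𝓝 x, normSq h s q = A) :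
    chernConnection h s x = 0 := by
  set φ := chartAt E x with hφ
  have hy : φ x ∈ φ.target := mem_chart_target E x
  have hφx : φ.symm (φ x) = x := φ.left_inv (mem_chart_source E x)
  let v := Module.finBasisOfFinrankEq ℂ E hn
  have hv := v.linearIndependent
  obtain ⟨γ, hγ0, hγ⟩ := pairing_inChart_leviForm_normSq hHE s x hy
  have hconst : (fun z => normSq h s (φ.symm z)) =ᶠ[𝓝 (φ x)] fun _ => A := by
    have hc := φ.continuousAt_symm hy
    rw [ContinuousAt, hφx] at hc
    exact hc.eventually hx
  have hB : fderiv ℝ (fderiv ℝ fun z => normSq h s (φ.symm z)) (φ x) = 0 := by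
    rw [hconst.fderiv.fderiv_eq]
    simp
  have hL : leviForm (0 : E →L[ℝ] E →L[ℝ] ℝ) = 0 := by
    ext w
    simp [leviForm_apply]
  have h2 := congrArg Complex.re (hγ v)
  rw [Complex.ofReal_zero, zero_mul, zero_mul, sub_zero, Complex.re_sum, hB, hL, map_zero,
    Complex.zero_re] at h2
  -- The Hessian vanishes, so the nonnegative square terms sum to zero and vanish singly; by strict
  -- ellipticity every γ_j is then 0.
  have h3 := (Finset.sum_eq_zero_iff_of_nonneg fun j _ =>
    pairing_inChart_elementary_nonneg hn hκ hΩ x hy hv (γ j)).1 h2.symm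
  have h4 : chernConnection h s (φ.symm (φ x)) = 0 := by
    refine hγ0 fun j => ?_
    by_contra hj
    exact (pairing_inChart_elementary_pos hn hκ hΩ x hy hv hj).ne' (h3 j (Finset.mem_univ j))
  -- The type of the connection depends on the base point, so the identity is moved along the
  -- equality of points by substitution.
  have key : ∀ q, q = x → chernConnection h s q = 0 → chernConnection h s x = 0 := by
    rintro _ rfl h
    exact h
  exact key _ hφx h4

/-- By compactness |s|² attains its maximum, where it is nonpositive; positive definiteness of h
then excludes nonzero values anywhere. -/
theorem section_eq_zero_of_neg [CompactSpace X] (hn : Module.finrank ℂ E = n) (hκ : IsKaehler κ)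
    (hΩ : IsAdmissible hkn Ω) (hHE : IsHermiteEinstein hm hkn κ Ω h lam) (hlam : lam < 0)
    (s : HolomorphicSections E r V) : s = 0 := by
  ext x
  by_contra hx
  obtain ⟨p, -, hp⟩ := isCompact_univ.exists_isMaxOn ⟨x, Set.mem_univ x⟩
    (continuous_normSq h s).continuousOn
  have h1 := normSq_nonpos_of_forall_le hn hκ hΩ hHE hlam s fun q => hp (Set.mem_univ q)
  exact absurd (hp (Set.mem_univ x)) (not_le.2 (h1.trans_lt (h.pos x (s x) hx)))

/-- X may be disconnected, so the maximum is taken over the component of x, which is compact, and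
open because manifolds are locally connected. The maximum set is clopen, hence the whole component.
-/
theorem chernConnection_eq_zero [CompactSpace X] (hn : Module.finrank ℂ E = n)
    (hκ : IsKaehler κ) (hΩ : IsAdmissible hkn Ω) (hHE : IsHermiteEinstein hm hkn κ Ω h 0)
    (s : HolomorphicSections E r V) (x : X) : chernConnection h s x = 0 := by
  have : LocallyConnectedSpace X := ChartedSpace.locallyConnectedSpace E X
  have hO : IsOpen (connectedComponent x) := isOpen_connectedComponent
  have hc : IsClosed (connectedComponent x) := isClosed_connectedComponent
  obtain ⟨p, hpC, hp⟩ := hc.isCompact.exists_isMaxOn ⟨x, mem_connectedComponent⟩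
    (continuous_normSq h s).continuousOn
  have hZ : IsClopen {q | q ∈ connectedComponent x ∧ normSq h s q = normSq h s p} :=
    ⟨hc.inter (isClosed_eq (continuous_normSq h s) continuous_const),
      isOpen_setOf_normSq_eq hn hκ hΩ hHE s hO fun q hq => hp hq⟩
  have hsub := isPreconnected_connectedComponent.subset_isClopen hZ ⟨p, hpC, hpC, rfl⟩
  refine chernConnection_eq_zero_of_eventually hn hκ hΩ hHE s (A := normSq h s p) ?_
  filter_upwards [hO.mem_nhds mem_connectedComponent] with q hq
  exact (hsub hq).2

end Vanishing

end HermiteEinstein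

end

open HermiteEinstein in
theorem theorem2p8 {n m : ℕ} (hm : 1 ≤ m) (hmn : m ≤ n)
    {E : Type*} [NormedAddCommGroup E] [NormedSpace ℂ E] [FiniteDimensional ℂ E]
    (hn : Module.finrank ℂ E = n)
    {X : Type*} [TopologicalSpace X] [T2Space X] [CompactSpace X]
    [ChartedSpace E X] [IsManifold 𝓘(ℂ, E) ω X]
    (omega : DForm E X 2) (homega : IsKaehler omega)
    (Omega : DForm E X (2 * (n - m))) (hOmega : IsAdmissible hmn Omega)
    {r : ℕ} {V : X → Type*} [∀ x, AddCommGroup (V x)] [∀ x, Module ℂ (V x)]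
    [∀ x, TopologicalSpace (V x)] [TopologicalSpace (TotalSpace (Fin r → ℂ) V)]
    [FiberBundle (Fin r → ℂ) V] [VectorBundle ℂ (Fin r → ℂ) V]
    [ContMDiffVectorBundle ω (Fin r → ℂ) V 𝓘(ℂ, E)]
    (h : HermitianMetric E r V) (lam : ℝ)
    (hHE : IsHermiteEinstein hm hmn omega Omega h lam) :
    (lam < 0 → ∀ s : HolomorphicSections E r V, s = 0) ∧
    (lam = 0 → ∀ s : HolomorphicSections E r V, ∀ x : X, chernConnection h s x = 0) := by
  -- With m = k + 1 the exponent m - 1 reduces definitionally to k, matching the form in which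
  -- `pairing` is set up.
  obtain ⟨k, rfl⟩ : ∃ k, m = k + 1 := ⟨m - 1, by omega⟩
  refine ⟨fun hlam s => section_eq_zero_of_neg hn homega hOmega hHE hlam s, ?_⟩
  rintro rfl s x
  exact chernConnection_eq_zero hn homega hOmega hHE s x
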